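/- Let $p\in[1,\infty)$ with $p\neq 2$ and let $G$ be a countable discrete group. For a unital complex Banach algebra $B$ (with $\|1\|=1$), an element $a\in B$ is hermitian if $\|\exp(ita)\|=1$ for all $t\in\mathbb{R}$; writing $B_{\mathrm h}$ for the set of hermitian elements, put $\operatorname{core}(B)=B_{\mathrm h}+iB_{\mathrm h}$. (When $B$ is an $L^p$-operator algebra this is its $C^*$-core.) A unital $L^p$-operator algebra is a unital complex Banach algebra, with $\|1\|=1$, that admits an isometric (not necessarily unital) representation on $L^p(X,\mu)$ for some measure space $(X,\mu)$. Let $\alpha\colon G\to\operatorname{Aut}(A)$ be an action by isometric automorphisms on a unital complex Banach algebra $A$. Let $C_c(G,A,\alpha)$ be the algebra of finitely supported functions $\sum_g a_gu_g$ from $G$ to $A$, with product determined by $u_gu_h=u_{gh}$ and $u_gau_{g^{-1}}=\alpha_g(a)$. Each unital contractive representation $\pi_0$ of $A$ on some $L^p(X,\mu)$ induces the regular representation $\pi\rtimes v$ of $C_c(G,A,\alpha)$ on $\ell^p(G,L^p(X,\mu))$, $(\pi\rtimes v)(au_g)=\pi(a)v_g$, where $(\pi(a)\xi)(h)=\pi_0(\alpha_h^{-1}(a))(\xi(h))$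 and $(v_g\xi)(h)=\xi(g^{-1}h)$. The reduced crossed product $F^p_\lambda(G,A,\alpha)$ is the completion of $C_c(G,A,\alpha)$ in the norm $\|x\|=\sup\|(\pi\rtimes v)(x)\|$, the supremum being over all these regular representations. 1. If $A$ is a unital $L^p$-operator algebra, then the canonical unital homomorphism $A\to F^p_\lambda(G,A,\alpha)$, $a\mapsto au_1$, is isometric and maps $\operatorname{core}(A)$ onto $\operatorname{core}(F^p_\lambda(G,A,\alpha))$; that is, $\operatorname{core}(F^p_\lambda(G,A,\alpha))=\operatorname{core}(A)$. 2. If $G$ acts by homeomorphisms on a nonempty compact Hausdorff space $X$, and $F^p_\lambda(G,X)$ denotes the reduced crossed product of $C(X)$ by the action $\alpha_g(f)(x)=f(g^{-1}x)$, then the canonical homomorphism $C(X)\to F^p_\lambda(G,X)$ is isometric and its image is $\operatorname{core}(F^p_\lambda(G,X))$; that is, $\operatorname{core}(F^p_\lambda(G,X))=C(X)$. 3. Let $F^p_\lambda(G)$ be the reduced group $L^p$-operator algebra, i.e. the norm closure in $\mathcal{B}(\ell^p(G))$ of the algebra generated by the left translations. Then $\operatorname{core}(F^p_\lambda(G))=\mathbb{C}\cdot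 1$. -/

import Mathlib

open MeasureTheory
open scoped ENNReal

universe u v

noncomputable section

/-! ### Hermitian elements and the core of a unital Banach algebra -/

/-- An element `a` of a unital complex Banach algebra is hermitian if `‖exp (i t a)‖ = 1` for every
real number `t`. -/
def IsHermitianElement {A : Type*} [NormedRing A] [NormedAlgebra ℂ A] (a : A) : Prop :=
  ∀ t : ℝ, ‖NormedSpace.exp ((Complex.I * (t : ℂ)) • a)‖ = 1

/-- The `C*`-core `A_h + i A_h` of a unital complex Banach algebra `A`. -/
def cstarCore (A : Type*) [NormedRing A] [NormedAlgebra ℂ A] : Set A :=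
  {a | ∃ x y : A, IsHermitianElement x ∧ IsHermitianElement y ∧ a = x + Complex.I • y}

/-! ### `L^p`-operator algebras -/

/-- A Banach algebra is an `L^p`-operator algebra if it admits an isometric representation
(a multiplicative linear map, not assumed to preserve units) on the `L^p`-space of some measure
space. -/
def IsLpOperatorAlgebra (p : ℝ≥0∞) [Fact (1 ≤ p)] (A : Type u) [NormedRing A]
    [NormedAlgebra ℂ A] : Prop :=
  ∃ (X : Type u) (_ : MeasurableSpace X) (μ : Measure X)
    (φ : A →ₙₐ[ℂ] (Lp ℂ p μ →L[ℂ] Lp ℂ p μ)), ∀ a : A, ‖φ a‖ = ‖a‖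

/-- A unital contractive representation of `A` on the `L^p`-space of some measure space. -/
structure ContractiveLpRep (p : ℝ≥0∞) [Fact (1 ≤ p)] (A : Type u) [NormedRing A]
    [NormedAlgebra ℂ A] : Type (u + 1) where
  /-- The underlying set of the measure space. -/
  X : Type u
  /-- The sigma-algebra. -/
  mX : MeasurableSpace X
  /-- The measure. -/
  μ : Measure X
  /-- The unital homomorphism into the bounded operators on `L^p(X, μ)`. -/
  toAlgHom : A →ₐ[ℂ] (Lp ℂ p μ →L[ℂ] Lp ℂ p μ)
  contractive : ∀ a : A, ‖toAlgHom a‖ ≤ ‖a‖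

/-- The representation on the zero space `L^p(X, 0)`. -/
instance ContractiveLpRep.instInhabited (p : ℝ≥0∞) [Fact (1 ≤ p)] (A : Type u) [NormedRing A]
    [NormedAlgebra ℂ A] : Inhabited (ContractiveLpRep.{u} p A) :=
  ⟨{ X := PUnit
     mX := ⊤
     μ := 0
     toAlgHom :=
      haveI : Subsingleton (@Lp PUnit ℂ ⊤ _ p 0) :=
        ⟨fun f g => Lp.ext (by simp [Filter.EventuallyEq])⟩
      { toFun := fun _ => 0
        map_one' := Subsingleton.elim _ _
        map_mul' := fun _ _ => Subsingleton.elim _ _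
        map_zero' := rfl
        map_add' := fun _ _ => Subsingleton.elim _ _
        commutes' := fun _ => Subsingleton.elim _ _ }
     contractive := fun a => by
      change ‖(0 : @Lp PUnit ℂ ⊤ _ p 0 →L[ℂ] @Lp PUnit ℂ ⊤ _ p 0)‖ ≤ ‖a‖
      simp }⟩

/-! ### Left translation on `ℓ^p(G, E)` -/

section Translation

variable (p : ℝ≥0∞) [Fact (1 ≤ p)] {G : Type*} (E : Type*) [NormedAddCommGroup E]

theorem memℓp_comp_equiv {f : G → E} (hf : Memℓp f p) (e : G ≃ G) : Memℓp (f ∘ e) p := by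
  have hp1 : (1 : ℝ≥0∞) ≤ p := Fact.out
  obtain rfl | rfl | hp := p.trichotomy
  · simp at hp1
  · rw [memℓp_infty_iff] at hf ⊢
    refine hf.mono ?_
    rintro _ ⟨i, rfl⟩
    exact ⟨e i, rfl⟩
  · rw [memℓp_gen_iff hp] at hf ⊢
    exact (e.summable_iff (f := fun i => ‖f i‖ ^ p.toReal)).2 hf

theorem norm_comp_equiv_le (f : lp (fun _ : G => E) p) (e : G ≃ G) :
    ‖(⟨fun h => f (e h), memℓp_comp_equiv p E (lp.memℓp f) e⟩ : lp (fun _ : G => E) p)‖ ≤ ‖f‖ := by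
  have hp1 : (1 : ℝ≥0∞) ≤ p := Fact.out
  obtain rfl | rfl | hp := p.trichotomy
  · simp at hp1
  · exact lp.norm_le_of_forall_le (norm_nonneg _) fun i => lp.norm_apply_le_norm (by simp) f (e i)
  · refine lp.norm_le_of_tsum_le hp (norm_nonneg _) ?_
    rw [lp.norm_rpow_eq_tsum hp f]
    exact (e.tsum_eq (fun i => ‖f i‖ ^ p.toReal)).le

variable [Group G] [NormedSpace ℂ E]

/-- The operator `v_g` on `ℓ^p(G, E)`, `(v_g ξ)(h) = ξ(g⁻¹ h)`. -/
def translationCLM (g : G) : lp (fun _ : G => E) p →L[ℂ] lp (fun _ : G => E) p :=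
  LinearMap.mkContinuous
    { toFun := fun ξ => ⟨fun h => ξ (g⁻¹ * h),
        memℓp_comp_equiv p E (lp.memℓp ξ) (Equiv.mulLeft g⁻¹)⟩
      map_add' := fun _ _ => rfl
      map_smul' := fun _ _ => rfl }
    1 fun ξ => by
      rw [one_mul]
      exact norm_comp_equiv_le p E ξ (Equiv.mulLeft g⁻¹)

@[simp]
theorem translationCLM_apply (g h : G) (ξ : lp (fun _ : G => E) p) :
    translationCLM p E g ξ h = ξ (g⁻¹ * h) := rfl

theorem norm_translationCLM_le (g : G) : ‖translationCLM p E g‖ ≤ 1 :=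
  LinearMap.mkContinuous_norm_le _ zero_le_one _

/-- The representation `g ↦ v_g` of `G` on `ℓ^p(G, E)` by left translation. -/
def translation : G →* (lp (fun _ : G => E) p →L[ℂ] lp (fun _ : G => E) p) where
  toFun := translationCLM p E
  map_one' := by ext ξ h; simp
  map_mul' g k := by ext ξ h; simp [mul_assoc]

end Translation

/-- The reduced group `L^p`-operator algebra `F^p_λ(G)`: the norm closure, in the bounded operators
on `ℓ^p(G)`, of the algebra generated by the left translations. -/
def reducedGroupAlgebra (p : ℝ≥0∞) [Fact (1 ≤ p)] (G : Type*) [Group G] :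
    Subalgebra ℂ (lp (fun _ : G => ℂ) p →L[ℂ] lp (fun _ : G => ℂ) p) :=
  (Algebra.adjoin ℂ (Set.range (translation p (G := G) ℂ))).topologicalClosure

/-! ### Isometric actions and the algebra `C_c(G, A, α)` -/

/-- An action of the discrete group `G` on the Banach algebra `A` by isometric automorphisms. -/
structure IsometricAction (G : Type*) [Group G] (A : Type*) [NormedRing A] [NormedAlgebra ℂ A] where
  /-- The underlying homomorphism into the automorphism group of the algebra. -/
  toHom : G →* (A ≃ₐ[ℂ] A)
  norm_map : ∀ (g : G) (a : A), ‖toHom g a‖ = ‖a‖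

theorem IsometricAction.norm_inv_map {G : Type*} [Group G] {A : Type*} [NormedRing A]
    [NormedAlgebra ℂ A] (α : IsometricAction G A) (g : G) (a : A) :
    ‖(α.toHom g)⁻¹ a‖ = ‖a‖ := by
  rw [← map_inv, α.norm_map]

section CrossedProduct

variable {G : Type v} [Group G] {A : Type u} [NormedRing A] [NormedAlgebra ℂ A]

/-- The action `g • a = α_g(a)`. -/
@[reducible]
def IsometricAction.mulSemiringAction (α : IsometricAction G A) : MulSemiringAction G A where
  smul g a := α.toHom g a
  one_smul a := by change α.toHom 1 a = a; simp
  mul_smul g h a := by change α.toHom (g * h) a = α.toHom g (α.toHom h a); simp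
  smul_zero g := map_zero (α.toHom g)
  smul_add g a b := map_add (α.toHom g) a b
  smul_one g := map_one (α.toHom g)
  smul_mul g a b := map_mul (α.toHom g) a b

theorem IsometricAction.smulCommClass (α : IsometricAction G A) :
    letI := α.mulSemiringAction
    SMulCommClass G ℂ A :=
  letI := α.mulSemiringAction
  ⟨fun g c a => map_smul (α.toHom g) c a⟩

/-- The algebra `C_c(G, A, α)` of finitely supported functions `G → A`, with the product
determined by `(a u_g) (b u_h) = a α_g(b) u_{gh}`. The function `a u_g` is
`SkewMonoidAlgebra.single g a`. It carries the seminorm of the reduced crossed product for the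
exponent `p`. -/
def CovariantAlgebra (_p : ℝ≥0∞) (_α : IsometricAction G A) : Type (max u v) :=
  SkewMonoidAlgebra A G

namespace CovariantAlgebra

variable (p : ℝ≥0∞) (α : IsometricAction G A)

instance instAddCommGroup : AddCommGroup (CovariantAlgebra p α) :=
  (inferInstance : AddCommGroup (SkewMonoidAlgebra A G))

instance instModule : Module ℂ (CovariantAlgebra p α) :=
  (inferInstance : Module ℂ (SkewMonoidAlgebra A G))

instance instMul : Mul (CovariantAlgebra p α) :=
  letI := α.mulSemiringAction
  (inferInstance : Mul (SkewMonoidAlgebra A G))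

instance instOne : One (CovariantAlgebra p α) :=
  (inferInstance : One (SkewMonoidAlgebra A G))

/-- The ring structure of the skew group algebra. -/
@[reducible]
def skewRing : Ring (SkewMonoidAlgebra A G) :=
  letI := α.mulSemiringAction
  inferInstance

instance instRing : Ring (CovariantAlgebra p α) where
  __ := instAddCommGroup p α
  mul := (· * ·)
  one := 1
  left_distrib := (skewRing α).left_distrib
  right_distrib := (skewRing α).right_distrib
  zero_mul := (skewRing α).zero_mul
  mul_zero := (skewRing α).mul_zero
  mul_assoc := (skewRing α).mul_assoc
  one_mul := (skewRing α).one_mul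
  mul_one := (skewRing α).mul_one

instance instAlgebra : Algebra ℂ (CovariantAlgebra p α) :=
  letI := α.mulSemiringAction
  haveI := α.smulCommClass
  Algebra.ofModule
    (@smul_mul_assoc ℂ (SkewMonoidAlgebra A G) _ _ _)
    (@mul_smul_comm ℂ (SkewMonoidAlgebra A G) _ _ _)

/-- The element `a u_g` of `C_c(G, A, α)`. -/
def single (g : G) (a : A) : CovariantAlgebra p α := SkewMonoidAlgebra.single g a

theorem single_mul_single (g h : G) (a b : A) :
    single p α g a * single p α h b = single p α (g * h) (a * α.toHom g b) := by
  let _ := α.mulSemiringAction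
  exact SkewMonoidAlgebra.single_mul_single

theorem one_eq_single : (1 : CovariantAlgebra p α) = single p α 1 1 := rfl

/-- The canonical unital homomorphism `A → C_c(G, A, α)`, `a ↦ a u_1`. -/
def ofBase : A →ₐ[ℂ] CovariantAlgebra p α where
  toFun a := single p α 1 a
  map_one' := rfl
  map_mul' a b := by rw [single_mul_single]; simp
  map_zero' := SkewMonoidAlgebra.single_zero 1
  map_add' a b := SkewMonoidAlgebra.single_add 1 a b
  commutes' c := by
    rw [Algebra.algebraMap_eq_smul_one, Algebra.algebraMap_eq_smul_one]
    exact (SkewMonoidAlgebra.smul_single c 1 1).symm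

end CovariantAlgebra

/-! ### Regular representations and the reduced crossed product -/

variable {p : ℝ≥0∞} [Fact (1 ≤ p)]

/-- The space `ℓ^p(G, L^p(X, μ))` on which the regular representation induced by `π₀` acts. -/
abbrev ContractiveLpRep.RegSpace (π₀ : ContractiveLpRep p A) (G : Type v) : Type (max u v) :=
  letI := π₀.mX
  lp (fun _ : G => Lp ℂ p π₀.μ) p

/-- The representation `π` of `A` on `ℓ^p(G, L^p(X, μ))`, `(π(a) ξ)(g) = π₀(α_g⁻¹(a)) (ξ(g))`. -/
def ContractiveLpRep.regBase (π₀ : ContractiveLpRep p A) (α : IsometricAction G A) :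
    A →ₐ[ℂ] (π₀.RegSpace G →L[ℂ] π₀.RegSpace G) :=
  letI := π₀.mX
  { toFun := fun a => lp.mapCLM p (fun g => π₀.toAlgHom ((α.toHom g)⁻¹ a)) (norm_nonneg a)
      (fun g => (π₀.contractive _).trans (α.norm_inv_map g a).le)
    map_one' := by ext1 ξ; apply lp.ext; funext g; simp
    map_mul' := fun a b => by ext1 ξ; apply lp.ext; funext g; simp
    map_zero' := by ext1 ξ; apply lp.ext; funext g; simp
    map_add' := fun a b => by ext1 ξ; apply lp.ext; funext g; simp
    commutes' := fun c => by
      ext1 ξ; apply lp.ext; funext g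
      simp [Algebra.algebraMap_eq_smul_one] }

theorem ContractiveLpRep.regBase_apply (π₀ : ContractiveLpRep p A) (α : IsometricAction G A)
    (a : A) (ξ : π₀.RegSpace G) (g : G) :
    letI := π₀.mX
    π₀.regBase α a ξ g = π₀.toAlgHom ((α.toHom g)⁻¹ a) (ξ g) := rfl

theorem ContractiveLpRep.norm_regBase_le (π₀ : ContractiveLpRep p A) (α : IsometricAction G A)
    (a : A) : ‖π₀.regBase α a‖ ≤ ‖a‖ :=
  letI := π₀.mX
  lp.norm_mapCLM_le p (fun g => π₀.toAlgHom ((α.toHom g)⁻¹ a)) (norm_nonneg a)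
    fun g => (π₀.contractive _).trans (α.norm_inv_map g a).le

theorem ContractiveLpRep.regBase_covariant (π₀ : ContractiveLpRep p A) (α : IsometricAction G A)
    {a : A} {g : G} :
    letI := π₀.mX
    π₀.regBase α (α.toHom g a) * translation p (Lp ℂ p π₀.μ) g =
      translation p (Lp ℂ p π₀.μ) g * π₀.regBase α a := by
  let _ := π₀.mX
  ext1 ξ
  apply lp.ext
  funext h
  change π₀.toAlgHom ((α.toHom h)⁻¹ (α.toHom g a)) (ξ (g⁻¹ * h)) =
    π₀.toAlgHom ((α.toHom (g⁻¹ * h))⁻¹ a) (ξ (g⁻¹ * h))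
  have : (α.toHom (g⁻¹ * h))⁻¹ a = (α.toHom h)⁻¹ (α.toHom g a) := by
    rw [← map_inv, ← map_inv, mul_inv_rev, inv_inv, map_mul, AlgEquiv.mul_apply]
  rw [this]

/-- The regular representation `π ⋊ v` of `C_c(G, A, α)` induced by `π₀`,
`(π ⋊ v)(a u_g) = π(a) v_g`. -/
def ContractiveLpRep.regRep (π₀ : ContractiveLpRep p A) (α : IsometricAction G A) :
    CovariantAlgebra p α →ₐ[ℂ] (π₀.RegSpace G →L[ℂ] π₀.RegSpace G) :=
  letI := α.mulSemiringAction
  haveI := α.smulCommClass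
  letI := π₀.mX
  letI ρ := SkewMonoidAlgebra.liftNCAlgHom (π₀.regBase α) (translation p (Lp ℂ p π₀.μ))
    (π₀.regBase_covariant α)
  { toFun := fun x => ρ x
    map_one' := map_one ρ
    map_mul' := fun x y => map_mul ρ x y
    map_zero' := map_zero ρ
    map_add' := fun x y => map_add ρ x y
    commutes' := fun c => by
      rw [Algebra.algebraMap_eq_smul_one, Algebra.algebraMap_eq_smul_one]
      exact (map_smul ρ c 1).trans (congrArg (c • ·) (map_one ρ)) }

theorem ContractiveLpRep.regRep_single (π₀ : ContractiveLpRep p A) (α : IsometricAction G A)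
    (g : G) (a : A) :
    letI := π₀.mX
    π₀.regRep α (CovariantAlgebra.single p α g a) =
      π₀.regBase α a * translation p (Lp ℂ p π₀.μ) g :=
  SkewMonoidAlgebra.liftNC_single _ _ _ _

namespace CovariantAlgebra

variable (α : IsometricAction G A)

theorem bddAbove_norm_regRep (x : CovariantAlgebra p α) :
    BddAbove (Set.range fun π₀ : ContractiveLpRep p A => ‖π₀.regRep α x‖) := by
  change BddAbove (Set.range fun π₀ : ContractiveLpRep p A =>
    ‖π₀.regRep α (show SkewMonoidAlgebra A G from x)‖)
  induction (show SkewMonoidAlgebra A G from x) using SkewMonoidAlgebra.induction_on with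
  | zero =>
    refine ⟨0, ?_⟩
    rintro _ ⟨π₀, rfl⟩
    exact (norm_le_zero_iff).2 (map_zero (π₀.regRep α))
  | single g a =>
    refine ⟨‖a‖, ?_⟩
    rintro _ ⟨π₀, rfl⟩
    let _ := π₀.mX
    change ‖π₀.regRep α (CovariantAlgebra.single p α g a)‖ ≤ ‖a‖
    rw [π₀.regRep_single α g a]
    calc ‖π₀.regBase α a * translation p (Lp ℂ p π₀.μ) g‖
        ≤ ‖π₀.regBase α a‖ * ‖translation p (Lp ℂ p π₀.μ) g‖ := norm_mul_le _ _
      _ ≤ ‖a‖ * 1 := mul_le_mul (π₀.norm_regBase_le α a) (norm_translationCLM_le p _ g)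
          (norm_nonneg _) (norm_nonneg _)
      _ = ‖a‖ := mul_one _
  | add f k hf hk =>
    obtain ⟨C, hC⟩ := hf
    obtain ⟨D, hD⟩ := hk
    refine ⟨C + D, ?_⟩
    rintro _ ⟨π₀, rfl⟩
    have h1 := hC ⟨π₀, rfl⟩
    have h2 := hD ⟨π₀, rfl⟩
    have h3 : π₀.regRep α (f + k : SkewMonoidAlgebra A G) = π₀.regRep α f + π₀.regRep α k :=
      map_add (π₀.regRep α) f k
    change ‖π₀.regRep α (f + k : SkewMonoidAlgebra A G)‖ ≤ C + D
    rw [h3]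
    exact (norm_add_le _ _).trans (add_le_add h1 h2)

/-- The reduced norm on `C_c(G, A, α)`: the supremum of `‖(π ⋊ v)(x)‖` over all regular
representations induced by unital contractive representations of `A` on `L^p`-spaces. -/
instance instNorm : Norm (CovariantAlgebra p α) :=
  ⟨fun x => ⨆ π₀ : ContractiveLpRep.{u} p A, ‖π₀.regRep α x‖⟩

theorem norm_def (x : CovariantAlgebra p α) :
    ‖x‖ = ⨆ π₀ : ContractiveLpRep.{u} p A, ‖π₀.regRep α x‖ := rfl

theorem norm_regRep_le (π₀ : ContractiveLpRep p A) (x : CovariantAlgebra p α) :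
    ‖π₀.regRep α x‖ ≤ ‖x‖ :=
  le_ciSup (bddAbove_norm_regRep α x) π₀

theorem norm_le_of_forall {x : CovariantAlgebra p α} {C : ℝ}
    (h : ∀ π₀ : ContractiveLpRep p A, ‖π₀.regRep α x‖ ≤ C) : ‖x‖ ≤ C :=
  ciSup_le h

/-- The seminormed group structure on `C_c(G, A, α)` given by the reduced norm. -/
@[reducible]
def seminormedAddCommGroup : SeminormedAddCommGroup (CovariantAlgebra p α) :=
  SeminormedAddCommGroup.ofCore (𝕜 := ℂ)
    { norm_nonneg := fun x => (norm_nonneg _).trans (norm_regRep_le α default x)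
      norm_smul := fun c x => by
        rw [norm_def, norm_def, Real.mul_iSup_of_nonneg (norm_nonneg c)]
        congr 1
        funext π₀
        rw [map_smul, norm_smul]
      norm_triangle := fun x y => norm_le_of_forall α fun π₀ => by
        rw [map_add]
        exact (norm_add_le _ _).trans
          (add_le_add (norm_regRep_le α π₀ x) (norm_regRep_le α π₀ y)) }

instance instSeminormedRing : SeminormedRing (CovariantAlgebra p α) where
  toRing := instRing p α
  toNorm := instNorm α
  toPseudoMetricSpace := (seminormedAddCommGroup α).toPseudoMetricSpace
  dist_eq := (seminormedAddCommGroup α).dist_eq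
  norm_mul_le x y := norm_le_of_forall α fun π₀ => by
    rw [map_mul]
    exact (norm_mul_le _ _).trans (mul_le_mul (norm_regRep_le α π₀ x) (norm_regRep_le α π₀ y)
      (norm_nonneg _) ((norm_nonneg _).trans (norm_regRep_le α π₀ x)))

instance instNormedAlgebra : NormedAlgebra ℂ (CovariantAlgebra p α) where
  toAlgebra := instAlgebra p α
  norm_smul_le c x := norm_le_of_forall α fun π₀ => by
    change ‖π₀.regRep α (c • x)‖ ≤ ‖c‖ * ‖x‖
    rw [map_smul, norm_smul]
    exact mul_le_mul_of_nonneg_left (norm_regRep_le α π₀ x) (norm_nonneg c)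

end CovariantAlgebra

/-- The reduced `L^p`-crossed product `F^p_λ(G, A, α)`: the (Hausdorff) completion of
`C_c(G, A, α)` for the reduced norm. -/
abbrev ReducedCrossedProduct (p : ℝ≥0∞) [Fact (1 ≤ p)] (α : IsometricAction G A) :
    Type (max u v) :=
  UniformSpace.Completion (CovariantAlgebra p α)

instance ReducedCrossedProduct.instNormedAlgebra (α : IsometricAction G A) :
    NormedAlgebra ℂ (ReducedCrossedProduct p α) where
  __ := UniformSpace.Completion.algebra (CovariantAlgebra p α) ℂ
  norm_smul_le := norm_smul_le

/-- The canonical map `A → F^p_λ(G, A, α)`. -/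
def ReducedCrossedProduct.ofBase (p : ℝ≥0∞) [Fact (1 ≤ p)] (α : IsometricAction G A) :
    A →ₐ[ℂ] ReducedCrossedProduct p α where
  toRingHom := UniformSpace.Completion.coeRingHom.comp
    (CovariantAlgebra.ofBase p α : A →+* CovariantAlgebra p α)
  commutes' c := congrArg ((↑) : CovariantAlgebra p α → ReducedCrossedProduct p α)
    ((CovariantAlgebra.ofBase p α).commutes c)

end CrossedProduct

/-! ### Topological dynamical systems -/

/-- The automorphism `f ↦ f(g⁻¹ ·)` of `C(X)`. -/
def topologicalAut {G : Type*} (X : Type*) [Group G] [TopologicalSpace X]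
    [MulAction G X] [ContinuousConstSMul G X] (g : G) : C(X, ℂ) ≃ₐ[ℂ] C(X, ℂ) where
  toFun f := ⟨fun x => f (g⁻¹ • x), by fun_prop⟩
  invFun f := ⟨fun x => f (g • x), by fun_prop⟩
  left_inv f := by ext x; simp
  right_inv f := by ext x; simp
  map_mul' _ _ := rfl
  map_add' _ _ := rfl
  commutes' _ := rfl

@[simp]
theorem topologicalAut_apply {G X : Type*} [Group G] [TopologicalSpace X]
    [MulAction G X] [ContinuousConstSMul G X] (g : G) (f : C(X, ℂ)) (x : X) :
    topologicalAut X g f x = f (g⁻¹ • x) := rfl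

/-- The isometric action on `C(X)` induced by an action of `G` by homeomorphisms of the compact
space `X`: `α_g(f)(x) = f(g⁻¹ x)`. -/
def topologicalAction (G X : Type*) [Group G] [TopologicalSpace X] [CompactSpace X]
    [MulAction G X] [ContinuousConstSMul G X] : IsometricAction G C(X, ℂ) where
  toHom :=
    { toFun := topologicalAut X
      map_one' := by ext f x; simp
      map_mul' := fun g h => by ext f x; simp [mul_smul] }
  norm_map g f := by
    change ‖topologicalAut X g f‖ = ‖f‖
    refine le_antisymm ((ContinuousMap.norm_le _ (norm_nonneg _)).2 fun x =>
      f.norm_coe_le_norm (g⁻¹ • x)) ((ContinuousMap.norm_le _ (norm_nonneg _)).2 fun x => ?_)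
    refine le_trans (le_of_eq ?_) (ContinuousMap.norm_coe_le_norm _ (g • x))
    simp

end

/-!
There are two ingredients: for `p ≠ 2`, hermitian operators on `ℓ^p`-sums of copies of an
`L^p`-space are diagonal, and a unital `L^p`-operator algebra has a unital isometric representation
on an `L^p`-space.

**Hermitian operators are diagonal.** Let `E` be an `L^p`-space. Clarkson's inequality compares
`‖a + b‖ ^ p + ‖a - b‖ ^ p` with `2 (‖a‖ ^ p + ‖b‖ ^ p)`, and equality forces `a` and `b` to be
disjoint (`Complex.clarkson`, `Lp.hasClarkson`). Hence a linear isometry `U` of `ℓ^p(ι, E)`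
preserves disjointness, as Banach and Lamperti observed. If moreover `‖U - 1‖ ≤ 1`, then `U` maps
each coordinate subspace to itself (`isometry_near_one_apply_single`). A hermitian operator is the
derivative at `0` of a norm continuous one-parameter group of isometries, so it is diagonal
(`apply_single_eq_zero_of_norm_exp_le`).

Consequently every regular representation sends a hermitian element `y` of `F^p_λ(G, A, α)` to a
diagonal operator. If `A` has a unital isometric representation on an `L^p`-space, then
`∑ a_g u_g ↦ a_1` extends to a contraction `F^p_λ(G, A, α) → A` that computes the diagonal entries
of all regular representations (`ReducedCrossedProduct.exists_expectation`). As the regular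
representations jointly separate points, `y` lies in the image of `A`. The same contraction shows
that `A → F^p_λ(G, A, α)` is isometric. For `A = C(X)`, represented on `ℓ^p(X)`, real functions are
hermitian, so the core is everything. For `F^p_λ(G)`, a diagonal operator that commutes with the
right translations is a scalar.

**Unital representations.** An `L^p`-operator algebra need not be represented unitally: its unit
acts as a contractive idempotent `e`, and the algebra is represented unitally and isometrically on
the fixed space `E` of `e`. It remains to see that `E` is isometric to an `L^p`-space, which is the
theorem of Ando, Bernau and Lacey. The proof here goes through the following property
(`IsPhasedSublattice`): relative to any `f ∈ E`, the quotients `h / f` with `h ∈ E` form the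
complexification of a vector lattice. Given this, the sets `B` with `1_B f ∈ E` form a σ-algebra,
and the elements of `E` supported where `f ≠ 0` are the products `f w` with `w` measurable for it;
a maximal disjoint family of such `f` identifies `E` with the `L^p`-space of a disjoint union
(`IsPhasedSublattice.exists_linearIsometryEquiv`).

The lattice property is proved for the fixed space of any contraction `P`. For `p = 1`, `P`
preserves the cone of nonnegative multiples of a fixed vector `f`
(`isPhasedSublattice_fixedSubmodule_one`). For `1 < p < ∞`, the duality map
`J f = |f| ^ (p - 2) f̄` is a bijection from `E` onto the fixed space `N` of the adjoint
(`exists_dual_fixedSubmodule`). After exchanging `E` and `N` one may take `p > 2`; then the real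
derivative of `J` at `f` in the direction `h` exists and lies in `N`. As `p ≠ 2`, the derivatives
in the directions `h` and `i h` give both `J(f) w` and `J(f) w̄`, where `w = h / f`. Applying the
inverse of `J` yields `f w |w| ^ (c - 1)` with `c = 1 / (p - 1) < 1`. Iteration drives the exponent
`c` to `0` and leaves `f w / |w|` in `E` (`represents_mul_phase`). Closure of `E` under these phase
operations gives the lattice property (`isPhasedSublattice_of_phase`).
-/

noncomputable section

/-! ### Clarkson's inequality and its equality case -/

/-- The failure of the parallelogram law for the exponent `r`. -/
def clarksonDefect (r : ℝ) {E : Type*} [NormedAddCommGroup E] (a b : E) : ℝ :=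
  ‖a + b‖ ^ r + ‖a - b‖ ^ r - 2 * (‖a‖ ^ r + ‖b‖ ^ r)

/-- Clarkson's inequality in `E` for the exponent `r` (the factor `r - 2` accounts for its
reversal at `r = 2`), together with the following consequence of equality, which says for `L^r` that
`a` and `b` are disjoint: the `r`-th power of the norm is additive on `a` and `-b`. -/
def HasClarkson (r : ℝ) (E : Type*) [NormedAddCommGroup E] : Prop :=
  (∀ a b : E, 0 ≤ (r - 2) * clarksonDefect r a b) ∧
    ∀ a b : E, clarksonDefect r a b = 0 → ‖a - b‖ ^ r = ‖a‖ ^ r + ‖b‖ ^ r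

theorem Real.add_rpow_lt_rpow_add {s x y : ℝ} (hs : 1 < s) (hx : 0 < x) (hy : 0 < y) :
    x ^ s + y ^ s < (x + y) ^ s := by
  have hxy : 0 < x + y := by positivity
  have key : ∀ z : ℝ, 0 < z → z < x + y → z ^ s < z * (x + y) ^ (s - 1) := fun z hz hlt => by
    have : z ^ s = z * z ^ (s - 1) := by
      rw [← Real.rpow_one_add' hz.le (by linarith)]; congr 1; ring
    rw [this]
    exact mul_lt_mul_of_pos_left (Real.rpow_lt_rpow hz.le hlt (by linarith)) hz
  have h1 := key x hx (by linarith)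
  have h2 := key y hy (by linarith)
  have : (x + y) ^ s = (x + y) * (x + y) ^ (s - 1) := by
    rw [← Real.rpow_one_add' hxy.le (by linarith)]; congr 1; ring
  rw [this, add_mul]
  exact add_lt_add h1 h2

theorem Real.rpow_add_lt_add_rpow {s x y : ℝ} (hs : s < 1) (hs0 : 0 < s) (hx : 0 < x)
    (hy : 0 < y) : (x + y) ^ s < x ^ s + y ^ s := by
  have hxy : 0 < x + y := by positivity
  have key : ∀ z : ℝ, 0 < z → z < x + y → z * (x + y) ^ (s - 1) < z ^ s := fun z hz hlt => by
    have : z ^ s = z * z ^ (s - 1) := by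
      rw [← Real.rpow_one_add' hz.le (by linarith)]; congr 1; ring
    rw [this]
    exact mul_lt_mul_of_pos_left (Real.rpow_lt_rpow_of_neg hz hlt (by linarith)) hz
  have h1 := key x hx (by linarith)
  have h2 := key y hy (by linarith)
  have : (x + y) ^ s = (x + y) * (x + y) ^ (s - 1) := by
    rw [← Real.rpow_one_add' hxy.le (by linarith)]; congr 1; ring
  rw [this, add_mul]
  exact add_lt_add h1 h2

theorem norm_rpow_eq_sq_rpow {E : Type*} [NormedAddCommGroup E] (r : ℝ) (a : E) :
    ‖a‖ ^ r = (‖a‖ ^ 2) ^ (r / 2) := by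
  rw [← Real.rpow_natCast, ← Real.rpow_mul (norm_nonneg a)]
  congr 1; push_cast; ring

theorem clarksonDefect_eq_zero_of_or {r : ℝ} (hr : r ≠ 0) {E : Type*} [NormedAddCommGroup E]
    {a b : E} (h : a = 0 ∨ b = 0) : ‖a - b‖ ^ r = ‖a‖ ^ r + ‖b‖ ^ r := by
  rcases h with rfl | rfl <;> simp [Real.zero_rpow hr]

/-- Clarkson's inequality for complex numbers, from the parallelogram law: `x ↦ x ^ (r / 2)` is
convex and superadditive for `2 ≤ r`, concave and subadditive for `r ≤ 2`. -/
theorem Complex.clarkson {r : ℝ} (hr : 1 ≤ r) (hr2 : r ≠ 2) (a b : ℂ) :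
    0 ≤ (r - 2) * clarksonDefect r a b ∧ (clarksonDefect r a b = 0 → a = 0 ∨ b = 0) := by
  have hpar : ‖a + b‖ ^ 2 + ‖a - b‖ ^ 2 = 2 * (‖a‖ ^ 2 + ‖b‖ ^ 2) := by
    have := parallelogram_law_with_norm ℝ a b
    simp only [pow_two]; linarith
  unfold clarksonDefect
  simp only [norm_rpow_eq_sq_rpow r]
  set x := ‖a + b‖ ^ 2
  set y := ‖a - b‖ ^ 2
  have hx : 0 ≤ x := by positivity
  have hy : 0 ≤ y := by positivity
  have hmid : (1 / 2 : ℝ) * x + (1 / 2) * y = ‖a‖ ^ 2 + ‖b‖ ^ 2 := by linarith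
  rcases lt_or_gt_of_ne hr2 with h | h
  · have h1 := (Real.concaveOn_rpow (p := r / 2) (by linarith) (by linarith)).2 hx hy
      (by norm_num : (0 : ℝ) ≤ 1 / 2) (by norm_num : (0 : ℝ) ≤ 1 / 2) (by norm_num)
    simp only [smul_eq_mul, hmid] at h1
    constructor
    · have h2 := Real.rpow_add_le_add_rpow (sq_nonneg ‖a‖) (sq_nonneg ‖b‖)
        (p := r / 2) (by linarith) (by linarith)
      exact mul_nonneg_of_nonpos_of_nonpos (by linarith) (by linarith)
    · intro h0
      by_contra! hab
      have := Real.rpow_add_lt_add_rpow (s := r / 2) (by linarith) (by linarith)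
        (pow_pos (norm_pos_iff.2 hab.1) 2) (pow_pos (norm_pos_iff.2 hab.2) 2)
      linarith
  · have h1 := (convexOn_rpow (p := r / 2) (by linarith)).2 hx hy
      (by norm_num : (0 : ℝ) ≤ 1 / 2) (by norm_num : (0 : ℝ) ≤ 1 / 2) (by norm_num)
    simp only [smul_eq_mul, hmid] at h1
    constructor
    · have h2 := Real.add_rpow_le_rpow_add (sq_nonneg ‖a‖) (sq_nonneg ‖b‖)
        (p := r / 2) (by linarith)
      exact mul_nonneg (by linarith) (by linarith)
    · intro h0
      by_contra! hab
      have := Real.add_rpow_lt_rpow_add (s := r / 2) (by linarith)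
        (pow_pos (norm_pos_iff.2 hab.1) 2) (pow_pos (norm_pos_iff.2 hab.2) 2)
      linarith

theorem Complex.hasClarkson {r : ℝ} (hr : 1 ≤ r) (hr2 : r ≠ 2) : HasClarkson r ℂ :=
  ⟨fun a b => (Complex.clarkson hr hr2 a b).1, fun a b h =>
    clarksonDefect_eq_zero_of_or (by linarith) ((Complex.clarkson hr hr2 a b).2 h)⟩

theorem one_le_toReal (p : ℝ≥0∞) [hp1 : Fact (1 ≤ p)] (hp : p ≠ ∞) : 1 ≤ p.toReal := by
  simpa using ENNReal.toReal_mono hp hp1.out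

theorem toReal_ne_two {p : ℝ≥0∞} (hp2 : p ≠ 2) : p.toReal ≠ 2 := fun h => hp2 <| by
  rcases eq_or_ne p ∞ with rfl | hp
  · simp at h
  · rw [← ENNReal.ofReal_toReal hp, h]; simp

section LpNorm

variable {X : Type*} [MeasurableSpace X] {μ : Measure X} {p : ℝ≥0∞} [Fact (1 ≤ p)]

theorem Lp_norm_rpow_eq_integral (hp : p ≠ ∞) (f : Lp ℂ p μ) :
    ‖f‖ ^ p.toReal = ∫ x, ‖f x‖ ^ p.toReal ∂μ := by
  have h1 := one_le_toReal p hp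
  have h0 : p ≠ 0 := by rintro rfl; simp at h1; linarith
  have hI : 0 ≤ ∫ x, ‖f x‖ ^ p.toReal ∂μ := integral_nonneg fun x => by positivity
  rw [Lp.norm_def, (Lp.memLp f).eLpNorm_eq_integral_rpow_norm h0 hp,
    ENNReal.toReal_ofReal (by positivity), ← Real.rpow_mul hI,
    inv_mul_cancel₀ (by linarith), Real.rpow_one]

theorem Lp_integrable_norm_rpow (hp : p ≠ ∞) (f : Lp ℂ p μ) :
    Integrable (fun x => ‖f x‖ ^ p.toReal) μ :=
  (Lp.memLp f).integrable_norm_rpow (zero_lt_one.trans_le (Fact.out : 1 ≤ p)).ne' hp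

theorem Lp_norm_sub_rpow_integrable (hp : p ≠ ∞) (f g : Lp ℂ p μ) :
    (‖f - g‖ ^ p.toReal = ∫ x, ‖f x - g x‖ ^ p.toReal ∂μ) ∧
      Integrable (fun x => ‖f x - g x‖ ^ p.toReal) μ := by
  have : (fun x => ‖(f - g : Lp ℂ p μ) x‖ ^ p.toReal) =ᵐ[μ] fun x => ‖f x - g x‖ ^ p.toReal := by
    filter_upwards [Lp.coeFn_sub f g] with x hx
    rw [hx, Pi.sub_apply]
  exact ⟨(Lp_norm_rpow_eq_integral hp _).trans (integral_congr_ae this),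
    (Lp_integrable_norm_rpow hp _).congr this⟩

theorem Lp_norm_add_rpow_integrable (hp : p ≠ ∞) (f g : Lp ℂ p μ) :
    (‖f + g‖ ^ p.toReal = ∫ x, ‖f x + g x‖ ^ p.toReal ∂μ) ∧
      Integrable (fun x => ‖f x + g x‖ ^ p.toReal) μ := by
  have : (fun x => ‖(f + g : Lp ℂ p μ) x‖ ^ p.toReal) =ᵐ[μ] fun x => ‖f x + g x‖ ^ p.toReal := by
    filter_upwards [Lp.coeFn_add f g] with x hx
    rw [hx, Pi.add_apply]
  exact ⟨(Lp_norm_rpow_eq_integral hp _).trans (integral_congr_ae this),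
    (Lp_integrable_norm_rpow hp _).congr this⟩

/-- The inequality is integrated pointwise; equality of the integrals forces equality almost
everywhere. -/
theorem Lp.hasClarkson (hp : p ≠ ∞) (hp2 : p ≠ 2) : HasClarkson p.toReal (Lp ℂ p μ) := by
  have hr := one_le_toReal p hp
  have hr2 := toReal_ne_two hp2
  have key : ∀ f g : Lp ℂ p μ, clarksonDefect p.toReal f g =
      ∫ x, clarksonDefect p.toReal (f x) (g x) ∂μ ∧
      Integrable (fun x => clarksonDefect p.toReal (f x) (g x)) μ := fun f g => by
    obtain ⟨ha, ia⟩ := Lp_norm_add_rpow_integrable hp f g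
    obtain ⟨hs, is⟩ := Lp_norm_sub_rpow_integrable hp f g
    have i1 := Lp_integrable_norm_rpow hp f
    have i2 := Lp_integrable_norm_rpow hp g
    unfold clarksonDefect
    refine ⟨?_, (ia.add is).sub ((i1.add i2).const_mul 2)⟩
    rw [ha, hs, Lp_norm_rpow_eq_integral hp f, Lp_norm_rpow_eq_integral hp g,
      ← integral_add ia is, ← integral_add i1 i2, ← integral_const_mul]
    exact (integral_sub (ia.add is) ((i1.add i2).const_mul 2)).symm
  refine ⟨fun f g => ?_, fun f g h => ?_⟩
  · rw [(key f g).1, ← integral_const_mul]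
    exact integral_nonneg fun x => (Complex.clarkson hr hr2 _ _).1
  · have h0 : ∫ x, (p.toReal - 2) * clarksonDefect p.toReal (f x) (g x) ∂μ = 0 := by
      rw [integral_const_mul, ← (key f g).1, h, mul_zero]
    rw [integral_eq_zero_iff_of_nonneg (fun x => (Complex.clarkson hr hr2 _ _).1)
      ((key f g).2.const_mul _)] at h0
    rw [(Lp_norm_sub_rpow_integrable hp f g).1, Lp_norm_rpow_eq_integral hp f,
      Lp_norm_rpow_eq_integral hp g,
      ← integral_add (Lp_integrable_norm_rpow hp f) (Lp_integrable_norm_rpow hp g)]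
    refine integral_congr_ae ?_
    filter_upwards [h0] with x hx
    refine clarksonDefect_eq_zero_of_or (by linarith) ((Complex.clarkson hr hr2 _ _).2 ?_)
    exact (mul_eq_zero.1 hx).resolve_left (sub_ne_zero.2 hr2)

end LpNorm

/-! ### Hermitian operators on `ℓ^p(ι, E)` are diagonal -/

section Diagonal

variable {p : ℝ≥0∞} [Fact (1 ≤ p)] {ι : Type*} {E : Type*} [NormedAddCommGroup E]

theorem lp_hasSum_clarksonDefect (hp : p ≠ ∞) (a b : lp (fun _ : ι => E) p) :
    HasSum (fun i => clarksonDefect p.toReal (a i) (b i)) (clarksonDefect p.toReal a b) := by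
  have hr : 0 < p.toReal := by linarith [one_le_toReal p hp]
  exact ((lp.hasSum_norm hr (a + b)).add (lp.hasSum_norm hr (a - b))).sub
    (((lp.hasSum_norm hr a).add (lp.hasSum_norm hr b)).mul_left 2)

theorem lp_norm_sub_rpow_of_forall (hp : p ≠ ∞) {a b : lp (fun _ : ι => E) p}
    (h : ∀ i, ‖a i - b i‖ ^ p.toReal = ‖a i‖ ^ p.toReal + ‖b i‖ ^ p.toReal) :
    ‖a - b‖ ^ p.toReal = ‖a‖ ^ p.toReal + ‖b‖ ^ p.toReal := by
  have hr : 0 < p.toReal := by linarith [one_le_toReal p hp]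
  refine (lp.hasSum_norm hr (a - b)).unique ?_
  refine ((lp.hasSum_norm hr a).add (lp.hasSum_norm hr b)).congr_fun fun i => ?_
  exact h i

theorem lp_clarkson_apply (hp : p ≠ ∞) (hp2 : p ≠ 2) (hE : HasClarkson p.toReal E)
    {a b : lp (fun _ : ι => E) p} (h : clarksonDefect p.toReal a b = 0) (i : ι) :
    ‖a i - b i‖ ^ p.toReal = ‖a i‖ ^ p.toReal + ‖b i‖ ^ p.toReal := by
  have hs := (lp_hasSum_clarksonDefect hp a b).mul_left (p.toReal - 2)
  rw [h, mul_zero, hasSum_zero_iff_of_nonneg fun i => hE.1 _ _] at hs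
  exact hE.2 _ _ ((mul_eq_zero.1 (congrFun hs i)).resolve_left
    (sub_ne_zero.2 (toReal_ne_two hp2)))

theorem clarksonDefect_eq_zero_of_norm_sub {r : ℝ} {a b : E}
    (h1 : ‖a - b‖ ^ r = ‖a‖ ^ r + ‖b‖ ^ r) (h2 : ‖a - -b‖ ^ r = ‖a‖ ^ r + ‖-b‖ ^ r) :
    clarksonDefect r a b = 0 := by
  rw [sub_neg_eq_add, norm_neg] at h2
  unfold clarksonDefect; linarith

variable [NormedSpace ℂ E]

open Classical in
/-- A linear isometry of `ℓ^p(ι, E)` preserves disjointness; if it is at distance at most one from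
the identity, it preserves each coordinate subspace. -/
theorem isometry_near_one_apply_single (hp : p ≠ ∞) (hp2 : p ≠ 2) (hE : HasClarkson p.toReal E)
    (U : lp (fun _ : ι => E) p →L[ℂ] lp (fun _ : ι => E) p) (hU : ∀ x, ‖U x‖ = ‖x‖)
    (hU1 : ‖U - 1‖ ≤ 1) (i j : ι) (hij : j ≠ i) (ξ : E) : U (lp.single p i ξ) j = 0 := by
  have hr : 0 < p.toReal := by linarith [one_le_toReal p hp]
  set f : lp (fun _ : ι => E) p := lp.single p i ξ
  -- `m` is the off-diagonal part of `U f`. It is disjoint from `f`, so `U m` is disjoint from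
  -- `U f`, of which `m` is a piece; hence `m` and `U m` are disjoint, which `‖U m - m‖ ≤ ‖m‖`
  -- rules out unless `m = 0`.
  set m := U f - lp.single p i (U f i) with hm
  have hmi : m i = 0 := by simp [hm]
  have hmj : ∀ k, k ≠ i → m k = U f k := fun k hk => by simp [hm, hk]
  have hfk : ∀ k, k ≠ i → f k = 0 := fun k hk => by simp [f, hk]
  have hfm : ∀ m' : lp (fun _ : ι => E) p, m' i = 0 →
      ‖f - m'‖ ^ p.toReal = ‖f‖ ^ p.toReal + ‖m'‖ ^ p.toReal := fun m' h =>
    lp_norm_sub_rpow_of_forall hp fun k =>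
      clarksonDefect_eq_zero_of_or hr.ne' <| (eq_or_ne k i).symm.imp (hfk k) fun hk => by rw [hk, h]
  have h0 : clarksonDefect p.toReal f m = 0 :=
    clarksonDefect_eq_zero_of_norm_sub (hfm m hmi) (hfm (-m) (by simp [hmi]))
  have hUd : clarksonDefect p.toReal (U f) (U m) = 0 := by
    rw [← h0]; unfold clarksonDefect
    rw [← map_add, ← map_sub]; simp only [hU]
  have hmU : ‖m - U m‖ ^ p.toReal = ‖m‖ ^ p.toReal + ‖U m‖ ^ p.toReal := by
    refine lp_norm_sub_rpow_of_forall hp fun k => ?_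
    rcases eq_or_ne k i with rfl | hk
    · exact clarksonDefect_eq_zero_of_or hr.ne' (Or.inl hmi)
    · rw [hmj k hk]; exact lp_clarkson_apply hp hp2 hE hUd k
  have hle : ‖m - U m‖ ≤ ‖m‖ := by
    rw [norm_sub_rev]
    calc ‖U m - m‖ = ‖(U - 1) m‖ := by simp
      _ ≤ ‖U - 1‖ * ‖m‖ := (U - 1).le_opNorm m
      _ ≤ 1 * ‖m‖ := by gcongr
      _ = ‖m‖ := one_mul _
  have hle' := Real.rpow_le_rpow (norm_nonneg _) hle hr.le
  rw [hmU, hU] at hle'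
  have hm0 : ‖m‖ ^ p.toReal = 0 := le_antisymm (by linarith) (by positivity)
  rw [Real.rpow_eq_zero (norm_nonneg _) hr.ne', norm_eq_zero] at hm0
  rw [← hmj j hij, hm0]; rfl

/-- The one-parameter group `t ↦ exp (i t a)`, which consists of isometries in the contractive
case. -/
theorem exists_isometry_group {B : Type*} [NormedRing B] [NormedAlgebra ℂ B] [CompleteSpace B]
    (a : B) (h : ∀ t : ℝ, ‖NormedSpace.exp ((Complex.I * (t : ℂ)) • a)‖ ≤ 1) :
    ∃ V : ℝ → B, (∀ t, ‖V t‖ ≤ 1) ∧ (∀ t, V (-t) * V t = 1) ∧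
      HasDerivAt V (Complex.I • a) 0 ∧ V 0 = 1 := by
  have hsm : ∀ t : ℝ, (Complex.I * (t : ℂ)) • a = (t : ℂ) • (Complex.I • a) := fun t => by
    rw [mul_comm, mul_smul]
  refine ⟨fun t => NormedSpace.exp ((Complex.I * (t : ℂ)) • a), h, fun t => ?_, ?_, by simp⟩
  · let := NormedAlgebra.restrictScalars ℚ ℂ B
    have : (Complex.I * ((-t : ℝ) : ℂ)) • a = -((Complex.I * (t : ℂ)) • a) := by simp
    beta_reduce
    rw [this, ← NormedSpace.exp_add_of_commute (Commute.neg_left (Commute.refl _))]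
    simp
  · simp only [hsm]
    have h1 := hasDerivAt_exp_smul_const (Complex.I • a) ((0 : ℝ) : ℂ)
    simpa [Function.comp_def] using h1.scomp (0 : ℝ) Complex.ofRealCLM.hasDerivAt

open Classical in
/-- A bounded operator generating a one-parameter group of isometries of `ℓ^p(ι, E)` is diagonal. -/
theorem apply_single_eq_zero_of_norm_exp_le (hp : p ≠ ∞) (hp2 : p ≠ 2)
    (hE : HasClarkson p.toReal E) [CompleteSpace E]
    (T : lp (fun _ : ι => E) p →L[ℂ] lp (fun _ : ι => E) p)
    (hT : ∀ t : ℝ, ‖NormedSpace.exp ((Complex.I * (t : ℂ)) • T)‖ ≤ 1) (i j : ι) (hij : j ≠ i)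
    (ξ : E) : T (lp.single p i ξ) j = 0 := by
  obtain ⟨V, hV, hinv, hder, hV0⟩ := exists_isometry_group T hT
  have hiso : ∀ t : ℝ, ∀ x, ‖V t x‖ = ‖x‖ := fun t x => by
    have hle : ∀ t : ℝ, ∀ y, ‖V t y‖ ≤ ‖y‖ := fun t y =>
      ((V t).le_opNorm y).trans (mul_le_of_le_one_left (norm_nonneg _) (hV t))
    refine le_antisymm (hle t x) ?_
    have hx : V (-t) (V t x) = x := congrArg (· x) (hinv t)
    calc ‖x‖ = ‖V (-t) (V t x)‖ := by rw [hx]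
      _ ≤ _ := hle _ _
  have hnear : ∀ᶠ t : ℝ in nhds 0, ‖V t - 1‖ ≤ 1 := by
    have hc : ContinuousAt (fun t : ℝ => ‖V t - 1‖) 0 :=
      (hder.continuousAt.sub continuousAt_const).norm
    have : Filter.Tendsto (fun t : ℝ => ‖V t - 1‖) (nhds 0) (nhds 0) := by
      simpa [ContinuousAt, hV0] using hc
    exact this.eventually (Iic_mem_nhds one_pos)
  -- The `j`-th coordinate at `single i ξ`, as a bounded linear functional of the operator.
  let ev : (lp (fun _ : ι => E) p →L[ℂ] lp (fun _ : ι => E) p) →L[ℝ] E :=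
    ((lp.evalCLM ℂ (fun _ : ι => E) p j).comp
      (ContinuousLinearMap.apply ℂ _ (lp.single p i ξ))).restrictScalars ℝ
  have hev : ∀ V, ev V = V (lp.single p i ξ) j := fun V => rfl
  have hd1 : HasDerivAt (fun t : ℝ => ev (V t)) (ev (Complex.I • T)) 0 :=
    (ev.hasFDerivAt.comp_hasDerivAt (0 : ℝ) hder)
  have hd2 : HasDerivAt (fun t : ℝ => ev (V t)) 0 0 := by
    refine (hasDerivAt_const (0 : ℝ) (0 : E)).congr_of_eventuallyEq ?_
    filter_upwards [hnear] with t ht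
    exact isometry_near_one_apply_single hp hp2 hE _ (hiso t) ht i j hij ξ
  have h0 := hd1.unique hd2
  have : Complex.I • (T (lp.single p i ξ) j) = 0 := h0
  exact (smul_eq_zero.1 this).resolve_left Complex.I_ne_zero

end Diagonal

/-! ### Hermitian elements under homomorphisms -/

theorem exp_map_of_continuous {B C : Type*} [NormedRing B] [NormedAlgebra ℂ B] [CompleteSpace B]
    [NormedRing C] [NormedAlgebra ℂ C] (f : B →ₐ[ℂ] C) (hf : Continuous f) (a : B) :
    f (NormedSpace.exp a) = NormedSpace.exp (f a) :=
  NormedSpace.map_exp_of_mem_ball (𝕂 := ℂ) f hf a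
    ((NormedSpace.expSeries_radius_eq_top ℂ B).symm ▸ edist_lt_top _ _)

/-- There is only an inequality here, because the target may be the zero algebra. -/
theorem norm_exp_map_le_one {B C : Type*} [NormedRing B] [NormedAlgebra ℂ B] [CompleteSpace B]
    [NormedRing C] [NormedAlgebra ℂ C] (f : B →ₐ[ℂ] C) (hf : ∀ b, ‖f b‖ ≤ ‖b‖) {a : B}
    (ha : IsHermitianElement a) (t : ℝ) :
    ‖NormedSpace.exp ((Complex.I * (t : ℂ)) • f a)‖ ≤ 1 := by
  have hc : Continuous f :=
    AddMonoidHomClass.continuous_of_bound f 1 fun b => by simpa using hf b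
  rw [← map_smul, ← exp_map_of_continuous f hc]
  exact (hf _).trans (ha t).le

theorem isHermitianElement_map_iff {B C : Type*} [NormedRing B] [NormedAlgebra ℂ B]
    [CompleteSpace B] [NormedRing C] [NormedAlgebra ℂ C] (f : B →ₐ[ℂ] C)
    (hf : ∀ b, ‖f b‖ = ‖b‖) (a : B) : IsHermitianElement (f a) ↔ IsHermitianElement a := by
  have hc : Continuous f :=
    AddMonoidHomClass.continuous_of_bound f 1 fun b => by simpa using (hf b).le
  refine forall_congr' fun t => ?_
  rw [← map_smul, ← exp_map_of_continuous f hc, hf]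

/-! ### Matrix entries of the regular representations -/

section Entries

variable {G : Type v} [Group G] {A : Type u} [NormedRing A] [NormedAlgebra ℂ A]
  {p : ℝ≥0∞} (α : IsometricAction G A)

namespace CovariantAlgebra

/-- The coefficient `a_g` of `∑ a_g u_g`. -/
def coeffHom (g : G) : CovariantAlgebra p α →+ A where
  toFun x := SkewMonoidAlgebra.coeff x g
  map_zero' := rfl
  map_add' x y := congrFun (congrArg DFunLike.coe (SkewMonoidAlgebra.coeff_add x y)) g

open Classical in
theorem coeffHom_single (g h : G) (a : A) :
    coeffHom α g (single p α h a) = if h = g then a else 0 :=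
  SkewMonoidAlgebra.coeff_single_apply

variable [Fact (1 ≤ p)]

open Classical in
/-- The matrix entry at `(h, k)` of `(π ⋊ v)(∑ a_g u_g)` is `π₀(α_h⁻¹(a_{h k⁻¹}))`. -/
theorem regRep_apply_single (π₀ : ContractiveLpRep p A) (x : CovariantAlgebra p α) (k h : G) :
    letI := π₀.mX
    ∀ ξ : Lp ℂ p π₀.μ, (π₀.regRep α x (lp.single p k ξ) : π₀.RegSpace G) h =
      π₀.toAlgHom ((α.toHom h)⁻¹ (coeffHom α (h * k⁻¹) x)) ξ := by
  intro ξ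
  let _ := π₀.mX
  have hadd : ∀ y z : CovariantAlgebra p α,
      (π₀.regRep α (y + z) (lp.single p k ξ) : π₀.RegSpace G) h =
      (π₀.regRep α y (lp.single p k ξ) : π₀.RegSpace G) h +
      (π₀.regRep α z (lp.single p k ξ) : π₀.RegSpace G) h := fun y z => by
    rw [map_add]; rfl
  refine SkewMonoidAlgebra.induction_on (p := fun x : SkewMonoidAlgebra A G =>
    (π₀.regRep α (show CovariantAlgebra p α from x) (lp.single p k ξ) : π₀.RegSpace G) h =
      π₀.toAlgHom ((α.toHom h)⁻¹ (coeffHom (p := p) α (h * k⁻¹) x)) ξ) x ?_ ?_ ?_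
  · have : π₀.regRep α (0 : CovariantAlgebra p α) = 0 := map_zero _
    change (π₀.regRep α (0 : CovariantAlgebra p α) (lp.single p k ξ) : π₀.RegSpace G) h =
      π₀.toAlgHom ((α.toHom h)⁻¹ (coeffHom (p := p) α (h * k⁻¹) 0)) ξ
    rw [this, map_zero, map_zero, map_zero]; rfl
  · intro g a
    change (π₀.regRep α (single p α g a) (lp.single p k ξ) : π₀.RegSpace G) h =
      π₀.toAlgHom ((α.toHom h)⁻¹ (coeffHom (p := p) α (h * k⁻¹) (single p α g a))) ξ
    rw [π₀.regRep_single, coeffHom_single]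
    change π₀.toAlgHom ((α.toHom h)⁻¹ a) ((lp.single p k ξ : π₀.RegSpace G) (g⁻¹ * h)) = _
    by_cases hg : g = h * k⁻¹
    · subst hg; simp
    · rw [if_neg hg, map_zero, map_zero, lp.single_apply_ne]
      · simp
      · rintro rfl; apply hg; group
  · intro y z hy hz
    refine (hadd y z).trans ?_
    have h2 : coeffHom (p := p) α (h * k⁻¹) (y + z) = coeffHom (p := p) α (h * k⁻¹) y
      + coeffHom (p := p) α (h * k⁻¹) z := map_add _ _ _
    erw [h2]
    rw [map_add, map_add]
    exact congrArg₂ _ hy hz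

end CovariantAlgebra

end Entries

/-! ### The core of a reduced crossed product -/

/-- The extension of a contractive homomorphism to the completion of its domain. -/
def completionLift {R C : Type u} [SeminormedRing R] [NormedAlgebra ℂ R] [NormedRing C]
    [NormedAlgebra ℂ C] [CompleteSpace C] (f : R →ₐ[ℂ] C) (hf : ∀ x, ‖f x‖ ≤ ‖x‖) :
    UniformSpace.Completion R →ₐ[ℂ] C :=
  { UniformSpace.Completion.extensionHom (f : R →+* C)
      (AddMonoidHomClass.continuous_of_bound f 1 fun x => by simpa using hf x) with
    commutes' := fun c => (UniformSpace.Completion.extensionHom_coe _ _ _).trans (f.commutes c) }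

theorem completionLift_coe {R C : Type u} [SeminormedRing R] [NormedAlgebra ℂ R] [NormedRing C]
    [NormedAlgebra ℂ C] [CompleteSpace C] (f : R →ₐ[ℂ] C) (hf : ∀ x, ‖f x‖ ≤ ‖x‖) (x : R) :
    completionLift f hf x = f x :=
  UniformSpace.Completion.extensionHom_coe (f : R →+* C)
    (AddMonoidHomClass.continuous_of_bound f 1 fun x => by simpa using hf x) x

section Core

variable {G : Type v} [Group G] {A : Type u} [NormedRing A] [NormedAlgebra ℂ A]
  {p : ℝ≥0∞} [Fact (1 ≤ p)] (α : IsometricAction G A)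

/-- The regular representation, extended to the reduced crossed product. -/
def ContractiveLpRep.regRepCompletion (π₀ : ContractiveLpRep p A) :
    ReducedCrossedProduct p α →ₐ[ℂ] (π₀.RegSpace G →L[ℂ] π₀.RegSpace G) :=
  letI := π₀.mX
  completionLift (π₀.regRep α) fun x => CovariantAlgebra.norm_regRep_le α π₀ x

theorem ContractiveLpRep.regRepCompletion_coe (π₀ : ContractiveLpRep p A)
    (x : CovariantAlgebra p α) :
    π₀.regRepCompletion α (x : ReducedCrossedProduct p α) = π₀.regRep α x :=
  letI := π₀.mX
  completionLift_coe _ _ _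

theorem ContractiveLpRep.continuous_regRepCompletion (π₀ : ContractiveLpRep p A) :
    Continuous (π₀.regRepCompletion α) :=
  UniformSpace.Completion.continuous_extension

theorem ContractiveLpRep.norm_regRepCompletion_le (π₀ : ContractiveLpRep p A)
    (y : ReducedCrossedProduct p α) : ‖π₀.regRepCompletion α y‖ ≤ ‖y‖ := by
  refine UniformSpace.Completion.induction_on y
    (isClosed_le (π₀.continuous_regRepCompletion α).norm continuous_norm) fun x => ?_
  rw [π₀.regRepCompletion_coe, UniformSpace.Completion.norm_coe]
  exact CovariantAlgebra.norm_regRep_le α π₀ x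

/-- The regular representations separate the points of the completion: each point is the limit of
elements whose norm is a supremum over them. -/
theorem ReducedCrossedProduct.eq_zero_of_forall (y : ReducedCrossedProduct p α)
    (h : ∀ π₀ : ContractiveLpRep p A, π₀.regRepCompletion α y = 0) : y = 0 := by
  by_contra hy
  have hpos : 0 < ‖y‖ / 2 := half_pos (norm_pos_iff.2 hy)
  obtain ⟨x, hx⟩ := UniformSpace.Completion.denseRange_coe.exists_dist_lt y hpos
  have hxle : ‖x‖ ≤ ‖y - x‖ := by
    refine CovariantAlgebra.norm_le_of_forall α fun π₀ => ?_
    rw [← π₀.regRepCompletion_coe, ← norm_neg, ← zero_sub, ← h π₀, ← map_sub]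
    exact π₀.norm_regRepCompletion_le α _
  rw [dist_eq_norm] at hx
  have : ‖y‖ ≤ ‖y - x‖ + ‖(x : ReducedCrossedProduct p α)‖ := by
    simpa using norm_add_le (y - (x : ReducedCrossedProduct p α)) x
  rw [UniformSpace.Completion.norm_coe] at this
  linarith

namespace CovariantAlgebra

/-- The coefficient at the unit is the diagonal entry at the unit. -/
theorem norm_toAlgHom_coeffHom_le (π₀ : ContractiveLpRep p A) (x : CovariantAlgebra p α) :
    ‖π₀.toAlgHom (coeffHom α 1 x)‖ ≤ ‖x‖ := by
  classical
  let _ := π₀.mX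
  refine le_trans ?_ (norm_regRep_le α π₀ x)
  refine ContinuousLinearMap.opNorm_le_bound _ (norm_nonneg _) fun ξ => ?_
  have h := regRep_apply_single α π₀ x 1 1 ξ
  simp only [map_one, inv_one, mul_one, AlgEquiv.one_apply] at h
  rw [← h]
  have h0 : (0 : ℝ≥0∞) < p := zero_lt_one.trans_le Fact.out
  calc _ ≤ ‖(π₀.regRep α x (lp.single p 1 ξ) : π₀.RegSpace G)‖ :=
        lp.norm_apply_le_norm h0.ne' _ _
    _ ≤ ‖π₀.regRep α x‖ * ‖(lp.single p 1 ξ : π₀.RegSpace G)‖ :=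
        ContinuousLinearMap.le_opNorm _ _
    _ = _ := by rw [lp.norm_single h0]

end CovariantAlgebra

variable (π₁ : ContractiveLpRep p A) (hπ₁ : ∀ a, ‖π₁.toAlgHom a‖ = ‖a‖)
include hπ₁

theorem CovariantAlgebra.norm_coeffHom_le (x : CovariantAlgebra p α) :
    ‖coeffHom α 1 x‖ ≤ ‖x‖ :=
  (hπ₁ _).ge.trans (norm_toAlgHom_coeffHom_le α π₁ x)

theorem ReducedCrossedProduct.norm_ofBase (a : A) : ‖ofBase p α a‖ = ‖a‖ := by
  change ‖((CovariantAlgebra.single p α 1 a : CovariantAlgebra p α) :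
    ReducedCrossedProduct p α)‖ = ‖a‖
  rw [UniformSpace.Completion.norm_coe]
  refine le_antisymm (CovariantAlgebra.norm_le_of_forall α fun π₀ => ?_) ?_
  · let _ := π₀.mX
    rw [π₀.regRep_single, map_one, mul_one]
    exact π₀.norm_regBase_le α a
  · have := CovariantAlgebra.norm_coeffHom_le α π₁ hπ₁ (CovariantAlgebra.single p α 1 a)
    rwa [CovariantAlgebra.coeffHom_single, if_pos rfl] at this

/-- An isometric representation of `A` yields a conditional expectation `F^p_λ(G, A, α) → A`,
extending the coefficient at the unit; it gives all diagonal entries of all regular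
representations. -/
theorem ReducedCrossedProduct.exists_expectation [CompleteSpace A]
    (y : ReducedCrossedProduct p α) : ∃ a : A, ∀ (π₀ : ContractiveLpRep p A) (h : G),
      letI := π₀.mX
      ∀ ξ : Lp ℂ p π₀.μ, (π₀.regRepCompletion α y
        (letI := Classical.decEq G; lp.single p h ξ) : π₀.RegSpace G) h =
        π₀.toAlgHom ((α.toHom h)⁻¹ a) ξ := by
  have hu : UniformContinuous (CovariantAlgebra.coeffHom (p := p) α 1) :=
    uniformContinuous_addMonoidHom_of_continuous <|
      AddMonoidHomClass.continuous_of_bound _ 1 fun x => by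
        simpa using CovariantAlgebra.norm_coeffHom_le α π₁ hπ₁ x
  refine ⟨UniformSpace.Completion.extension (CovariantAlgebra.coeffHom (p := p) α 1) y,
    fun π₀ h => ?_⟩
  intro ξ
  let _ := π₀.mX
  refine UniformSpace.Completion.induction_on y (isClosed_eq ?_ ?_) fun x => ?_
  · exact (lp.evalCLM ℂ (fun _ : G => Lp ℂ p π₀.μ) p h).continuous.comp
      ((ContinuousLinearMap.apply ℂ _ _).continuous.comp (π₀.continuous_regRepCompletion α))
  · have h1 : Continuous fun a : A => (α.toHom h)⁻¹ a :=
      AddMonoidHomClass.continuous_of_bound ((α.toHom h)⁻¹) 1 fun a => by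
        simpa using (α.norm_inv_map h a).le
    have h2 : Continuous π₀.toAlgHom :=
      AddMonoidHomClass.continuous_of_bound _ 1 fun a => by simpa using π₀.contractive a
    exact (ContinuousLinearMap.apply ℂ _ ξ).continuous.comp
      (h2.comp (h1.comp UniformSpace.Completion.continuous_extension))
  · rw [UniformSpace.Completion.extension_coe hu, π₀.regRepCompletion_coe]
    have := CovariantAlgebra.regRep_apply_single α π₀ x h h ξ
    rw [mul_inv_cancel] at this
    convert this

/-- All regular representations of a hermitian element are diagonal, so it coincides with its
conditional expectation. -/
theorem ReducedCrossedProduct.exists_of_isHermitianElement [CompleteSpace A] (hp : p ≠ ∞)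
    (hp2 : p ≠ 2) {y : ReducedCrossedProduct p α} (hy : IsHermitianElement y) :
    ∃ a : A, ofBase p α a = y := by
  classical
  obtain ⟨a, ha⟩ := exists_expectation α π₁ hπ₁ y
  refine ⟨a, sub_eq_zero.1 <| eq_zero_of_forall α _ fun π₀ => ?_⟩
  let _ := π₀.mX
  rw [map_sub, sub_eq_zero]
  have key : ∀ h ξ, π₀.regRepCompletion α (ofBase p α a) (lp.single p h ξ : π₀.RegSpace G) =
      π₀.regRepCompletion α y (lp.single p h ξ : π₀.RegSpace G) := fun h ξ => by
    apply lp.ext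
    funext k
    have h1 : π₀.regRepCompletion α (ofBase p α a) = π₀.regBase α a := by
      change π₀.regRepCompletion α (CovariantAlgebra.single p α 1 a : CovariantAlgebra p α) = _
      rw [π₀.regRepCompletion_coe, π₀.regRep_single, map_one, mul_one]
    rw [h1]
    refine (π₀.regBase_apply α a _ k).trans ?_
    rcases eq_or_ne k h with rfl | hk
    · have := ha π₀ k ξ
      rw [lp.single_apply_self, ← this]
    · rw [lp.single_apply_ne _ _ _ hk, map_zero]
      exact (apply_single_eq_zero_of_norm_exp_le hp hp2 (Lp.hasClarkson hp hp2) _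
        (norm_exp_map_le_one (π₀.regRepCompletion α) (π₀.norm_regRepCompletion_le α) hy)
        h k hk ξ).symm
  ext1 ξ
  have hs := lp.hasSum_single hp ξ
  refine ((hs.mapL (π₀.regRepCompletion α (ofBase p α a))).unique ?_)
  simp only [key]
  exact hs.mapL _

theorem ReducedCrossedProduct.isometry_ofBase : Isometry (ofBase p α) :=
  AddMonoidHomClass.isometry_of_norm _ (norm_ofBase α π₁ hπ₁)

theorem ReducedCrossedProduct.image_cstarCore [CompleteSpace A] (hp : p ≠ ∞) (hp2 : p ≠ 2) :
    ofBase p α '' cstarCore A = cstarCore (ReducedCrossedProduct p α) := by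
  have hiff := isHermitianElement_map_iff (ofBase p α) (norm_ofBase α π₁ hπ₁)
  apply Set.Subset.antisymm
  · rintro _ ⟨a, ⟨x, y, hx, hy, rfl⟩, rfl⟩
    exact ⟨ofBase p α x, ofBase p α y, (hiff x).2 hx, (hiff y).2 hy, by
      rw [map_add, map_smul]⟩
  · rintro _ ⟨x, y, hx, hy, rfl⟩
    obtain ⟨a, rfl⟩ := exists_of_isHermitianElement α π₁ hπ₁ hp hp2 hx
    obtain ⟨b, rfl⟩ := exists_of_isHermitianElement α π₁ hπ₁ hp hp2 hy
    exact ⟨a + Complex.I • b, ⟨a, b, (hiff a).1 hx, (hiff b).1 hy, rfl⟩, by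
      rw [map_add, map_smul]⟩

end Core

/-! ### The core of the reduced group algebra -/

section GroupAlgebra

variable {G : Type v} [Group G] {p : ℝ≥0∞} [Fact (1 ≤ p)]

/-- The operator `ξ ↦ ξ(· k)` on `ℓ^p(G)`. -/
def rightTranslation (p : ℝ≥0∞) [Fact (1 ≤ p)] (k : G) :
    lp (fun _ : G => ℂ) p →L[ℂ] lp (fun _ : G => ℂ) p :=
  LinearMap.mkContinuous
    { toFun := fun ξ => ⟨fun h => ξ (h * k), memℓp_comp_equiv p ℂ (lp.memℓp ξ) (Equiv.mulRight k)⟩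
      map_add' := fun _ _ => rfl
      map_smul' := fun _ _ => rfl }
    1 fun ξ => by
      rw [one_mul]
      exact norm_comp_equiv_le p ℂ ξ (Equiv.mulRight k)

theorem rightTranslation_apply (k h : G) (ξ : lp (fun _ : G => ℂ) p) :
    rightTranslation p k ξ h = ξ (h * k) := rfl

theorem commute_rightTranslation {T : lp (fun _ : G => ℂ) p →L[ℂ] lp (fun _ : G => ℂ) p}
    (hT : T ∈ reducedGroupAlgebra p G) (k : G) : Commute (rightTranslation p k) T := by
  have hcl : IsClosed {S : lp (fun _ : G => ℂ) p →L[ℂ] lp (fun _ : G => ℂ) p |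
      rightTranslation p k * S = S * rightTranslation p k} :=
    isClosed_eq (continuous_const.mul continuous_id) (continuous_id.mul continuous_const)
  refine closure_minimal (fun S hS => ?_) hcl hT
  have hle : Algebra.adjoin ℂ (Set.range (translation p (G := G) ℂ)) ≤
      Subalgebra.centralizer ℂ {rightTranslation p k} := by
    rw [Algebra.adjoin_le_iff]
    rintro _ ⟨g, rfl⟩
    rw [SetLike.mem_coe, Subalgebra.mem_centralizer_iff]
    rintro _ rfl
    ext ξ h
    change ξ (g⁻¹ * (h * k)) = ξ (g⁻¹ * h * k)
    rw [mul_assoc]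
  exact (Subalgebra.mem_centralizer_iff ℂ).1 (hle hS) _ rfl

/-- Commutation with the right translations makes all diagonal entries equal. -/
theorem exists_eq_algebraMap_of_diagonal (hp : p ≠ ∞) (T : reducedGroupAlgebra p G)
    (hT : letI := Classical.decEq G; ∀ (i j : G), j ≠ i → ∀ c : ℂ, T.1 (lp.single p i c) j = 0) :
    ∃ c : ℂ, algebraMap ℂ (reducedGroupAlgebra p G) c = T := by
  classical
  refine ⟨T.1 (lp.single p 1 1) 1, Subtype.ext ?_⟩
  have hsingle : ∀ (g : G) (c : ℂ),
      T.1 (lp.single p g c) = (T.1 (lp.single p 1 1) 1) • lp.single p g c := fun g c => by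
    have h1 : rightTranslation p g (lp.single p g c) = lp.single p 1 c := by
      apply lp.ext; funext h
      rw [rightTranslation_apply]
      by_cases hh : h = 1
      · subst hh; simp
      · rw [lp.single_apply_ne _ _ _ hh, lp.single_apply_ne]
        simpa using hh
    apply lp.ext; funext h
    rcases eq_or_ne h g with rfl | hne
    · have h2 := congrArg (fun S => S (lp.single p h c) 1) (commute_rightTranslation T.2 h).eq
      have h3 : T.1 (lp.single p h c) h = T.1 (lp.single p 1 c) 1 := by
        have h4 : rightTranslation p h (T.1 (lp.single p h c)) 1 =
          T.1 (rightTranslation p h (lp.single p h c)) 1 := h2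
        rwa [h1, rightTranslation_apply, one_mul] at h4
      have h5 : (lp.single p (1 : G) c : lp (fun _ : G => ℂ) p) = c • lp.single p 1 1 := by
        rw [← lp.single_smul, smul_eq_mul, mul_one]
      rw [h3, h5, map_smul]
      simp [mul_comm]
    · have := hT g h hne c
      rw [lp.coeFn_smul, Pi.smul_apply, lp.single_apply_ne _ _ _ hne, smul_zero, ← this]
  ext1 ξ
  have hs := lp.hasSum_single hp ξ
  refine HasSum.unique (hs.mapL _) ?_
  exact (hs.mapL T.1).congr_fun fun i => (hsingle i (ξ i)).symm

theorem isHermitianElement_algebraMap_ofReal {B : Type*} [NormedRing B] [NormedAlgebra ℂ B]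
    [NormOneClass B] (r : ℝ) : IsHermitianElement (algebraMap ℂ B r) := fun t => by
  have h : (Complex.I * (t : ℂ)) • algebraMap ℂ B r =
      Algebra.ofId ℂ B (((t * r : ℝ) : ℂ) * Complex.I) := by
    rw [Algebra.ofId_apply, Algebra.smul_def, ← map_mul]; congr 1; push_cast; ring
  rw [h, ← exp_map_of_continuous (Algebra.ofId ℂ B) (algebraMapCLM ℂ B).continuous,
    Algebra.ofId_apply, norm_algebraMap', ← Complex.exp_eq_exp_ℂ, Complex.norm_exp_ofReal_mul_I]

theorem cstarCore_reducedGroupAlgebra (hp : p ≠ ∞) (hp2 : p ≠ 2) :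
    cstarCore (reducedGroupAlgebra p G) = Set.range (algebraMap ℂ (reducedGroupAlgebra p G)) := by
  classical
  have : Nontrivial (lp (fun _ : G => ℂ) p) :=
    ⟨⟨lp.single p 1 1, 0, fun h => one_ne_zero (α := ℂ) <| by
      simpa using congrArg (fun ξ : lp (fun _ : G => ℂ) p => ξ 1) h⟩⟩
  have : NormOneClass (reducedGroupAlgebra p G) :=
    ⟨norm_one (α := lp (fun _ : G => ℂ) p →L[ℂ] lp (fun _ : G => ℂ) p)⟩
  have : CompleteSpace (reducedGroupAlgebra p G) :=
    (Subalgebra.isClosed_topologicalClosure _).completeSpace_coe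
  have key : ∀ x : reducedGroupAlgebra p G, IsHermitianElement x →
      ∃ c : ℂ, algebraMap ℂ (reducedGroupAlgebra p G) c = x := fun x hx =>
    exists_eq_algebraMap_of_diagonal hp x fun i j hij c =>
      apply_single_eq_zero_of_norm_exp_le hp hp2
        (Complex.hasClarkson (one_le_toReal p hp) (toReal_ne_two hp2)) _
        (norm_exp_map_le_one (reducedGroupAlgebra p G).val (fun _ => le_rfl) hx) i j hij c
  apply Set.Subset.antisymm
  · rintro _ ⟨x, y, hx, hy, rfl⟩
    obtain ⟨c, rfl⟩ := key x hx
    obtain ⟨d, rfl⟩ := key y hy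
    exact ⟨c + Complex.I * d, by rw [map_add, map_mul, Algebra.smul_def]⟩
  · rintro _ ⟨c, rfl⟩
    refine ⟨_, _, isHermitianElement_algebraMap_ofReal c.re,
      isHermitianElement_algebraMap_ofReal c.im, ?_⟩
    rw [Algebra.smul_def, ← map_mul, ← map_add]
    congr 1
    rw [mul_comm, Complex.re_add_im]

end GroupAlgebra

/-! ### The algebra of continuous functions -/

section ContinuousFunctions

variable {X : Type u} [TopologicalSpace X] [CompactSpace X] {p : ℝ≥0∞} [Fact (1 ≤ p)]

theorem isHermitianElement_of_real [Nonempty X] (f : C(X, ℂ)) (hf : ∀ x, (f x).im = 0) :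
    IsHermitianElement f := fun t => by
  have h : ∀ x, ‖NormedSpace.exp ((Complex.I * (t : ℂ)) • f) x‖ = 1 := fun x => by
    have h1 : ((Complex.I * (t : ℂ)) • f) x = ((t * (f x).re : ℝ) : ℂ) * Complex.I := by
      have : f x = ((f x).re : ℂ) := Complex.ext rfl (by simp [hf x])
      rw [ContinuousMap.smul_apply, this, smul_eq_mul]; push_cast; simp; ring
    have h2 := exp_map_of_continuous (ContinuousMap.evalAlgHom ℂ ℂ x)
      (continuous_eval_const x) ((Complex.I * (t : ℂ)) • f)
    simp only [ContinuousMap.evalAlgHom_apply] at h2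
    rw [h2, h1, ← Complex.exp_eq_exp_ℂ, Complex.norm_exp_ofReal_mul_I]
  refine le_antisymm ((ContinuousMap.norm_le _ zero_le_one).2 fun x => (h x).le) ?_
  obtain ⟨x⟩ := ‹Nonempty X›
  exact (h x).ge.trans (ContinuousMap.norm_coe_le_norm _ x)

theorem cstarCore_continuousMap [Nonempty X] : cstarCore C(X, ℂ) = Set.univ := by
  refine Set.eq_univ_of_forall fun f => ?_
  refine ⟨⟨fun x => ((f x).re : ℂ), by fun_prop⟩, ⟨fun x => ((f x).im : ℂ), by fun_prop⟩,
    isHermitianElement_of_real _ fun x => by simp,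
    isHermitianElement_of_real _ fun x => by simp, ?_⟩
  ext x
  simp [mul_comm Complex.I, Complex.re_add_im]

end ContinuousFunctions

section Counting

variable {X : Type u} {p : ℝ≥0∞} [MeasurableSpace X]

theorem Lp_count_ext {ξ η : Lp ℂ p (Measure.count : Measure X)} (h : ∀ x, ξ x = η x) : ξ = η :=
  Lp.ext (Filter.Eventually.of_forall h)

theorem Lp_count_add_apply (ξ η : Lp ℂ p (Measure.count : Measure X)) (x : X) :
    (ξ + η) x = ξ x + η x :=
  Measure.ae_count_iff.1 (Lp.coeFn_add ξ η) x

theorem Lp_count_smul_apply (c : ℂ) (ξ : Lp ℂ p (Measure.count : Measure X)) (x : X) :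
    (c • ξ) x = c * ξ x :=
  Measure.ae_count_iff.1 (Lp.coeFn_smul c ξ) x

end Counting

section ContinuousFunctions

variable {X : Type u} [TopologicalSpace X] [CompactSpace X] {p : ℝ≥0∞}
  [MeasurableSpace X] [DiscreteMeasurableSpace X]

theorem memLp_continuousMap_mul (f : C(X, ℂ)) (ξ : Lp ℂ p (Measure.count : Measure X)) :
    MemLp (fun x => f x * ξ x) p Measure.count :=
  (Lp.memLp ξ).of_le_mul (c := ‖f‖) (Measurable.of_discrete).aestronglyMeasurable <|
    Filter.Eventually.of_forall fun x => by
      rw [norm_mul]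
      exact mul_le_mul_of_nonneg_right (f.norm_coe_le_norm x) (norm_nonneg _)

variable [Fact (1 ≤ p)]

/-- Multiplication by a continuous function on `ℓ^p(X)`, realized as `L^p` of the counting measure
on the discrete measurable space `X`, where functions equal almost everywhere are equal. -/
def continuousMapMul (f : C(X, ℂ)) :
    Lp ℂ p (Measure.count : Measure X) →L[ℂ] Lp ℂ p (Measure.count : Measure X) :=
  have key : ∀ (ξ : Lp ℂ p Measure.count) (x : X),
      (memLp_continuousMap_mul f ξ).toLp _ x = f x * ξ x := fun ξ =>
    Measure.ae_count_iff.1 (memLp_continuousMap_mul f ξ).coeFn_toLp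
  LinearMap.mkContinuous
    { toFun := fun ξ => (memLp_continuousMap_mul f ξ).toLp _
      map_add' := fun ξ η => Lp_count_ext fun x => by
        rw [key, Lp_count_add_apply, Lp_count_add_apply, key, key, mul_add]
      map_smul' := fun c ξ => Lp_count_ext fun x => by
        rw [RingHom.id_apply, key, Lp_count_smul_apply, Lp_count_smul_apply, key, mul_left_comm] }
    ‖f‖ fun ξ => Lp.norm_le_mul_norm_of_ae_le_mul <| Filter.Eventually.of_forall fun x => by
      change ‖(memLp_continuousMap_mul f ξ).toLp _ x‖ ≤ _
      rw [key, norm_mul]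
      exact mul_le_mul_of_nonneg_right (f.norm_coe_le_norm x) (norm_nonneg _)

theorem continuousMapMul_apply (f : C(X, ℂ)) (ξ : Lp ℂ p (Measure.count : Measure X)) (x : X) :
    continuousMapMul f ξ x = f x * ξ x :=
  Measure.ae_count_iff.1 (memLp_continuousMap_mul f ξ).coeFn_toLp x

theorem norm_continuousMapMul_le (f : C(X, ℂ)) : ‖continuousMapMul (p := p) f‖ ≤ ‖f‖ :=
  ContinuousLinearMap.opNorm_le_bound _ (norm_nonneg f) fun ξ =>
    Lp.norm_le_mul_norm_of_ae_le_mul <| Filter.Eventually.of_forall fun x => by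
      rw [continuousMapMul_apply, norm_mul]
      exact mul_le_mul_of_nonneg_right (f.norm_coe_le_norm x) (norm_nonneg _)

/-- The representation of `C(X)` on `ℓ^p(X)` by multiplication operators. -/
def continuousMapRep : C(X, ℂ) →ₙₐ[ℂ]
    (Lp ℂ p (Measure.count : Measure X) →L[ℂ] Lp ℂ p (Measure.count : Measure X)) where
  toFun := continuousMapMul
  map_smul' c f := by
    ext1 ξ; refine Lp_count_ext fun x => ?_
    rw [MonoidHom.id_apply, _root_.smul_apply, Lp_count_smul_apply]
    simp only [continuousMapMul_apply, ContinuousMap.smul_apply, smul_eq_mul, mul_assoc]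
  map_zero' := by
    ext1 ξ; refine Lp_count_ext fun x => ?_
    have h0 : (0 : Lp ℂ p (Measure.count : Measure X)) x = 0 := by
      simpa using Lp_count_smul_apply (p := p) 0 0 x
    refine (continuousMapMul_apply 0 ξ x).trans ?_
    exact (zero_mul (ξ x)).trans h0.symm
  map_add' f g := by
    ext1 ξ; refine Lp_count_ext fun x => ?_
    rw [_root_.add_apply, Lp_count_add_apply]
    simp only [continuousMapMul_apply, ContinuousMap.add_apply, add_mul]
  map_mul' f g := by
    ext1 ξ; refine Lp_count_ext fun x => ?_
    rw [mul_apply_eq_comp]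
    simp only [continuousMapMul_apply, ContinuousMap.mul_apply, mul_assoc]

theorem norm_continuousMapRep (hp : p ≠ ∞) (f : C(X, ℂ)) :
    ‖continuousMapRep (p := p) f‖ = ‖f‖ := by
  refine le_antisymm (norm_continuousMapMul_le f)
    ((ContinuousMap.norm_le _ (norm_nonneg _)).2 fun x => ?_)
  have hfin : (Measure.count : Measure X) {x} ≠ ∞ := by simp
  have h0 : p ≠ 0 := (zero_lt_one.trans_le (Fact.out : 1 ≤ p)).ne'
  set δ : Lp ℂ p (Measure.count : Measure X) :=
    indicatorConstLp p (measurableSet_singleton x) hfin 1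
  have hδ : ‖δ‖ = 1 := by
    rw [norm_indicatorConstLp h0 hp]; simp [Measure.real]
  have hδx : ∀ y, δ y = Set.indicator {x} (fun _ => (1 : ℂ)) y :=
    Measure.ae_count_iff.1 indicatorConstLp_coeFn
  have hmul : continuousMapRep (p := p) f δ = f x • δ := by
    refine Lp_count_ext fun y => ?_
    rw [Lp_count_smul_apply]
    refine (continuousMapMul_apply f δ y).trans ?_
    rw [hδx]
    by_cases hy : y = x
    · subst hy; rfl
    · simp [hy]
  have := (continuousMapRep (p := p) f).le_opNorm δ
  rwa [hmul, norm_smul, hδ, mul_one, mul_one] at this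

end ContinuousFunctions

theorem isLpOperatorAlgebra_continuousMap (p : ℝ≥0∞) [Fact (1 ≤ p)] (hp : p ≠ ∞) (X : Type u)
    [TopologicalSpace X] [CompactSpace X] : IsLpOperatorAlgebra p C(X, ℂ) := by
  let _ : MeasurableSpace X := ⊤
  exact ⟨X, ⊤, Measure.count, continuousMapRep, norm_continuousMapRep hp⟩

/-! ### Phased sublattices of `L^p` -/

section Sublattice

open Filter Topology ComplexConjugate

/-- A class of functions that contains the constant multiples of indicators and is closed under sums
contains a dominated sequence of approximations of each measurable function. -/
theorem exists_approx_of_measurable {X : Type*} [MeasurableSpace X] {C : (X → ℂ) → Prop}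
    (hind : ∀ B, MeasurableSet B → ∀ c : ℂ, C (B.indicator fun _ => c))
    (hadd : ∀ u v, C u → C v → C (u + v)) {w : X → ℂ} (hw : Measurable w) :
    ∃ s : ℕ → X → ℂ, (∀ n, C (s n)) ∧ (∀ n x, ‖s n x‖ ≤ ‖w x‖ + ‖w x‖) ∧
      ∀ x, Tendsto (fun n => s n x) atTop (𝓝 (w x)) := by
  refine ⟨fun n => SimpleFunc.approxOn w hw Set.univ 0 (Set.mem_univ _) n, fun n => ?_,
    fun n x => SimpleFunc.norm_approxOn_zero_le hw _ x n,
    fun x => SimpleFunc.tendsto_approxOn hw _ (by simp)⟩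
  beta_reduce
  generalize SimpleFunc.approxOn w hw Set.univ 0 (Set.mem_univ _) n = s
  induction s using SimpleFunc.induction with
  | const c hB => simpa [Set.piecewise_eq_indicator] using! hind _ hB c
  | add _ h1 h2 => exact hadd _ _ h1 h2

variable {X : Type u} [mX : MeasurableSpace X] {μ : Measure X} {p : ℝ≥0∞}

/-- The function `u` represents an element of the subspace `E` of `L^p(μ)`. -/
def Represents (E : Submodule ℂ (Lp ℂ p μ)) (u : X → ℂ) : Prop := ∃ f ∈ E, f =ᵐ[μ] u

namespace Represents

variable {E : Submodule ℂ (Lp ℂ p μ)} {u w : X → ℂ}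

theorem coe {f : Lp ℂ p μ} (hf : f ∈ E) : Represents E f := ⟨f, hf, ae_eq_rfl⟩

theorem congr (hu : Represents E u) (h : u =ᵐ[μ] w) : Represents E w := by
  obtain ⟨f, hf, hfu⟩ := hu
  exact ⟨f, hf, hfu.trans h⟩

theorem memLp (hu : Represents E u) : MemLp u p μ := by
  obtain ⟨f, -, hfu⟩ := hu
  exact (memLp_congr_ae hfu).1 (Lp.memLp f)

theorem add (hu : Represents E u) (hw : Represents E w) : Represents E fun x => u x + w x := by
  obtain ⟨f, hf, hfu⟩ := hu
  obtain ⟨g, hg, hgw⟩ := hw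
  exact ⟨f + g, E.add_mem hf hg, (Lp.coeFn_add f g).trans (hfu.add hgw)⟩

theorem const_mul (hu : Represents E u) (c : ℂ) : Represents E fun x => c * u x := by
  obtain ⟨f, hf, hfu⟩ := hu
  exact ⟨c • f, E.smul_mem c hf, (Lp.coeFn_smul c f).trans (hfu.const_smul c)⟩

theorem sub (hu : Represents E u) (hw : Represents E w) : Represents E fun x => u x - w x :=
  (hu.add (hw.const_mul (-1))).congr <| Eventually.of_forall fun x => by ring

theorem zero : Represents E fun _ => 0 := ⟨0, E.zero_mem, Lp.coeFn_zero _ _ _⟩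

variable [Fact (1 ≤ p)]

/-- Dominated convergence in `L^p`. -/
theorem _root_.tendsto_toLp_of_dominated (hp : p ≠ ∞) {F : ℕ → X → ℂ} {g : X → ℝ}
    (hF : ∀ n, MemLp (F n) p μ) (hu : MemLp u p μ) (hg : MemLp g p μ)
    (hle : ∀ n, ∀ᵐ x ∂μ, ‖F n x - u x‖ ≤ g x)
    (hlim : ∀ᵐ x ∂μ, Tendsto (fun n => F n x) atTop (𝓝 (u x))) :
    Tendsto (fun n => (hF n).toLp) atTop (𝓝 hu.toLp) := by
  have hr := one_le_toReal p hp
  have hr0 : p.toReal ≠ 0 := by linarith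
  have h0 : p ≠ 0 := (zero_lt_one.trans_le (Fact.out : 1 ≤ p)).ne'
  have hlim' : Tendsto (fun n => ‖(hF n).toLp - hu.toLp‖ ^ p.toReal) atTop (𝓝 0) := by
    have heq : ∀ n, ‖(hF n).toLp - hu.toLp‖ ^ p.toReal = ∫ x, ‖F n x - u x‖ ^ p.toReal ∂μ :=
      fun n => by
        rw [(Lp_norm_sub_rpow_integrable hp _ _).1]
        refine integral_congr_ae ?_
        filter_upwards [(hF n).coeFn_toLp, hu.coeFn_toLp] with x h1 h2
        rw [h1, h2]
    simp only [heq]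
    have : (0 : ℝ) = ∫ x, (0 : ℝ) ∂μ := by simp
    rw [this]
    refine tendsto_integral_of_dominated_convergence (fun x => ‖g x‖ ^ p.toReal) (fun n => ?_)
      (hg.integrable_norm_rpow h0 hp) (fun n => ?_) ?_
    · exact (((hF n).sub hu).integrable_norm_rpow h0 hp).1
    · filter_upwards [hle n] with x hx
      rw [Real.norm_of_nonneg (by positivity)]
      exact Real.rpow_le_rpow (norm_nonneg _) (hx.trans (Real.le_norm_self _)) (by linarith)
    · filter_upwards [hlim] with x hx
      have := ((hx.sub_const (u x)).norm).rpow_const (p := p.toReal) (Or.inr (by linarith))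
      simpa [hr0] using this
  rw [tendsto_iff_norm_sub_tendsto_zero]
  have := hlim'.rpow_const (p := p.toReal⁻¹) (Or.inr (by positivity))
  simpa [Real.rpow_rpow_inv (norm_nonneg _) hr0, hr0] using this

/-- A closed subspace of `L^p` is closed under dominated convergence almost everywhere. -/
theorem of_tendsto (hp : p ≠ ∞) (hE : IsClosed (E : Set (Lp ℂ p μ)))
    {F : ℕ → X → ℂ} {g : X → ℝ} (hF : ∀ n, Represents E (F n)) (hg : MemLp g p μ)
    (hle : ∀ n, ∀ᵐ x ∂μ, ‖F n x‖ ≤ g x)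
    (hlim : ∀ᵐ x ∂μ, Tendsto (fun n => F n x) atTop (𝓝 (u x))) : Represents E u := by
  have hule : ∀ᵐ x ∂μ, ‖u x‖ ≤ g x := by
    filter_upwards [hlim, ae_all_iff.2 hle] with x h1 h2
    exact le_of_tendsto h1.norm (Eventually.of_forall h2)
  have hu : MemLp u p μ := hg.of_le
    (aestronglyMeasurable_of_tendsto_ae atTop (fun n => (hF n).memLp.1) hlim)
    (hule.mono fun x hx => hx.trans (Real.le_norm_self _))
  have ht := tendsto_toLp_of_dominated hp (fun n => (hF n).memLp) hu (hg.add hg)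
    (fun n => by
      filter_upwards [hle n, hule] with x h1 h2
      exact (norm_sub_le _ _).trans (add_le_add h1 h2)) hlim
  refine ⟨hu.toLp, hE.mem_of_tendsto ht (Eventually.of_forall fun n => ?_), hu.coeFn_toLp⟩
  obtain ⟨f, hf, hfu⟩ := hF n
  have : (hF n).memLp.toLp = f := Lp.ext ((hF n).memLp.coeFn_toLp.trans hfu.symm)
  rw [this]; exact hf

end Represents

variable [Fact (1 ≤ p)]

/-- A closed subspace `E` of `L^p(μ)` such that, for each `f ∈ E`, the set of all `h / f` with
`h ∈ E` (quotients being zero where `f` vanishes) is the complexification of a vector lattice. -/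
structure IsPhasedSublattice (E : Submodule ℂ (Lp ℂ p μ)) : Prop where
  isClosed : IsClosed (E : Set (Lp ℂ p μ))
  supportMem : ∀ f ∈ E, ∀ h ∈ E, Represents E fun x => f x * (h x / f x)
  conjMem : ∀ f ∈ E, ∀ h ∈ E, Represents E fun x => f x * conj (h x / f x)
  absMem : ∀ f ∈ E, ∀ h ∈ E, (∀ᵐ x ∂μ, (h x / f x).im = 0) →
    Represents E fun x => f x * ‖h x / f x‖

variable {E : Submodule ℂ (Lp ℂ p μ)}

namespace IsPhasedSublattice

variable (hE : IsPhasedSublattice E) {f : Lp ℂ p μ} (hf : f ∈ E)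
include hE hf

theorem mul_conj {w : X → ℂ} (hw : Represents E fun x => f x * w x) :
    Represents E fun x => f x * conj (w x) := by
  obtain ⟨h, hh, hhw⟩ := hw
  refine (hE.conjMem f hf h hh).congr ?_
  filter_upwards [hhw] with x hx
  by_cases h0 : f x = 0
  · simp [h0]
  · rw [hx, mul_div_cancel_left₀ _ h0]

theorem mul_abs {w : X → ℝ} (hw : Represents E fun x => f x * w x) :
    Represents E fun x => f x * (|w x| : ℝ) := by
  obtain ⟨h, hh, hhw⟩ := hw
  have key : ∀ᵐ x ∂μ, f x ≠ 0 → h x / f x = w x := by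
    filter_upwards [hhw] with x hx h0
    rw [hx, mul_div_cancel_left₀ _ h0]
  refine (hE.absMem f hf h hh ?_).congr ?_
  · filter_upwards [key] with x hx
    by_cases h0 : f x = 0
    · simp [h0]
    · rw [hx h0, Complex.ofReal_im]
  · filter_upwards [key] with x hx
    by_cases h0 : f x = 0
    · simp [h0]
    · rw [hx h0, Complex.norm_real, Real.norm_eq_abs]

theorem mul_max {w z : X → ℝ} (hw : Represents E fun x => f x * w x)
    (hz : Represents E fun x => f x * z x) : Represents E fun x => f x * (max (w x) (z x) : ℝ) := by
  have h1 : Represents E fun x => f x * ((w x - z x : ℝ) : ℂ) :=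
    (hw.sub hz).congr <| Eventually.of_forall fun x => by push_cast; ring
  refine (((hw.add hz).add (hE.mul_abs hf h1)).const_mul (1 / 2)).congr <|
    Eventually.of_forall fun x => ?_
  have : max (w x) (z x) = (1 / 2) * (w x + z x + |w x - z x|) := by
    linarith [max_add_min (w x) (z x), max_sub_min_eq_abs' (w x) (z x)]
  beta_reduce
  rw [this]; push_cast; ring

theorem mul_min {w z : X → ℝ} (hw : Represents E fun x => f x * w x)
    (hz : Represents E fun x => f x * z x) : Represents E fun x => f x * (min (w x) (z x) : ℝ) := by
  refine ((hw.add hz).sub (hE.mul_max hf hw hz)).congr <| Eventually.of_forall fun x => ?_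
  have : min (w x) (z x) = w x + z x - max (w x) (z x) := by
    linarith [max_add_min (w x) (z x)]
  beta_reduce
  rw [this]; push_cast; ring

omit hE [Fact (1 ≤ p)] in
theorem mul_const (c : ℂ) : Represents E fun x => f x * c :=
  ((Represents.coe hf).const_mul c).congr <| Eventually.of_forall fun _ => mul_comm _ _

variable (hp : p ≠ ∞)
include hp

omit hf in
theorem mul_of_tendsto {F : ℕ → X → ℝ} {w : X → ℝ} (hF : ∀ n, Represents E fun x => f x * F n x)
    (hle : ∀ n x, |F n x| ≤ 1) (hlim : ∀ x, Tendsto (fun n => F n x) atTop (𝓝 (w x))) :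
    Represents E fun x => f x * w x := by
  refine Represents.of_tendsto hp hE.isClosed hF (Lp.memLp f).norm
    (fun n => Eventually.of_forall fun x => ?_) (Eventually.of_forall fun x => ?_)
  · rw [norm_mul, Complex.norm_real]
    exact mul_le_of_le_one_right (norm_nonneg _) (hle n x)
  · exact ((Complex.continuous_ofReal.tendsto _).comp (hlim x)).const_mul (f x)

open Classical in
theorem mul_indicator_Ioi {w : X → ℝ} (hw : Represents E fun x => f x * w x) (c : ℝ) :
    Represents E fun x => f x * ((if c < w x then 1 else 0 : ℝ) : ℂ) := by
  -- `min 1 (n (w - c)⁺)` increases to the indicator of `w > c`.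
  refine hE.mul_of_tendsto hp (F := fun n x => min 1 (n * max (w x - c) 0)) (fun n => ?_)
    (fun n x => ?_) (fun x => ?_)
  · have h1 : Represents E fun x => f x * ((w x - c : ℝ) : ℂ) :=
      (hw.sub (mul_const hf c)).congr <| Eventually.of_forall fun x => by push_cast; ring
    have h2 := hE.mul_max hf h1 (z := fun _ => 0) (mul_const hf _)
    have h3 : Represents E fun x => f x * ((n * max (w x - c) 0 : ℝ) : ℂ) :=
      (h2.const_mul n).congr <| Eventually.of_forall fun x => by push_cast; ring
    exact hE.mul_min hf (w := fun _ => 1) (mul_const hf _) h3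
  · have : 0 ≤ (n : ℝ) * max (w x - c) 0 := by positivity
    rw [abs_of_nonneg (le_min zero_le_one this)]
    exact min_le_left _ _
  · split_ifs with h
    · refine tendsto_const_nhds.congr' ?_
      obtain ⟨N, hN⟩ := exists_nat_ge (1 / (w x - c))
      filter_upwards [eventually_ge_atTop N] with n hn
      have hpos : 0 < w x - c := sub_pos.2 h
      rw [max_eq_left hpos.le, min_eq_left]
      rw [div_le_iff₀ hpos] at hN
      refine hN.trans (mul_le_mul_of_nonneg_right (by exact_mod_cast hn) hpos.le)
    · refine tendsto_const_nhds.congr fun n => ?_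
      rw [max_eq_right (by linarith), mul_zero, min_eq_right zero_le_one]

/-- The `σ`-algebra of the measurable sets `B` such that `1_B f` belongs to `E`. -/
@[reducible]
def sigmaAlgebra : MeasurableSpace X :=
  letI : DecidableEq X := Classical.decEq X
  { MeasurableSet' := fun B => MeasurableSet B ∧
      Represents E fun x => f x * ((B.indicator (fun _ => (1 : ℝ)) x : ℝ) : ℂ)
    measurableSet_empty := ⟨MeasurableSet.empty, by simpa using Represents.zero⟩
    measurableSet_compl := fun B hB => ⟨hB.1.compl, by
      refine ((Represents.coe hf).sub hB.2).congr <| Eventually.of_forall fun x => ?_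
      by_cases hx : x ∈ B <;> simp [hx]⟩
    measurableSet_iUnion := fun B hB => ⟨MeasurableSet.iUnion fun n => (hB n).1, by
      have hacc : ∀ n, Represents E fun x =>
          f x * (((Set.accumulate B n).indicator (fun _ => (1 : ℝ)) x : ℝ) : ℂ) := fun n => by
        induction n with
        | zero => simpa using (hB 0).2
        | succ n ih =>
          refine (hE.mul_max hf ih (hB (n + 1)).2).congr <| Eventually.of_forall fun x => ?_
          rw [Set.accumulate_succ]
          by_cases h1 : x ∈ Set.accumulate B n <;> by_cases h2 : x ∈ B (n + 1) <;>
            simp [h1, h2]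
      refine hE.mul_of_tendsto hp hacc (fun n x => ?_) fun x => ?_
      · by_cases h1 : x ∈ Set.accumulate B n <;> simp [h1]
      · rw [← Set.iUnion_accumulate]
        exact (Set.monotone_accumulate.tendsto_indicator (Set.accumulate B) _ x).mono_right
          (pure_le_nhds _)⟩ }

theorem sigmaAlgebra_le : hE.sigmaAlgebra hf hp ≤ mX := fun _ hB => hB.1

/-- The indicator of `v > c` is obtained from `v` by lattice operations and a limit, so the level
sets of the real and imaginary parts of `w` belong to the `σ`-algebra. -/
theorem measurable_sigmaAlgebra {w : X → ℂ} (hwm : Measurable w)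
    (hw : Represents E fun x => f x * w x) : Measurable[hE.sigmaAlgebra hf hp] w := by
  have hreal : ∀ v : X → ℝ, Measurable v → (Represents E fun x => f x * v x) →
      Measurable[hE.sigmaAlgebra hf hp] v := fun v hvm hv => by
    refine @measurable_of_Ioi ℝ X _ _ _ (hE.sigmaAlgebra hf hp) _ _ _ _ fun c => ?_
    refine ⟨measurableSet_lt measurable_const hvm, ?_⟩
    refine (hE.mul_indicator_Ioi hf hp hv c).congr <| Eventually.of_forall fun x => ?_
    by_cases hx : c < v x <;> simp [hx]
  have hre := hreal (fun x => (w x).re) (Complex.measurable_re.comp hwm) <|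
    ((hw.add (hE.mul_conj hf hw)).const_mul (1 / 2)).congr <| Eventually.of_forall fun x => by
      beta_reduce
      rw [Complex.re_eq_add_conj]; ring
  have him := hreal (fun x => (w x).im) (Complex.measurable_im.comp hwm) <|
    ((hw.sub (hE.mul_conj hf hw)).const_mul (1 / (2 * Complex.I))).congr <|
      Eventually.of_forall fun x => by
        beta_reduce
        rw [Complex.im_eq_sub_conj]; ring
  have : w = fun x => ((w x).re : ℂ) + ((w x).im : ℂ) * Complex.I :=
    funext fun x => (Complex.re_add_im _).symm
  rw [this]
  exact (Complex.measurable_ofReal.comp hre).add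
    ((Complex.measurable_ofReal.comp him).mul_const _)

theorem measurable_div {h : Lp ℂ p μ} (hh : h ∈ E) :
    Measurable[hE.sigmaAlgebra hf hp] fun x => h x / f x :=
  hE.measurable_sigmaAlgebra hf hp
    ((Lp.stronglyMeasurable h).measurable.div (Lp.stronglyMeasurable f).measurable)
    (hE.supportMem f hf h hh)

/-- The converse of `measurable_sigmaAlgebra`, by approximation with simple functions. -/
theorem represents_mul {w : X → ℂ} (hwm : Measurable[hE.sigmaAlgebra hf hp] w)
    (hw : MemLp (fun x => f x * w x) p μ) : Represents E fun x => f x * w x := by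
  obtain ⟨s, hs, hle, hlim⟩ := @exists_approx_of_measurable X (hE.sigmaAlgebra hf hp)
    (fun v => Represents E fun x => f x * v x)
    (fun B hB c => (hB.2.const_mul c).congr <| Eventually.of_forall fun x => by
      by_cases hx : x ∈ B <;> simp [hx, mul_comm])
    (fun u v hu hv => (hu.add hv).congr <| Eventually.of_forall fun x => by simp [mul_add]) w hwm
  refine Represents.of_tendsto hp hE.isClosed hs (g := fun x => ‖f x * w x‖ + ‖f x * w x‖)
    (hw.norm.add hw.norm) (fun n => Eventually.of_forall fun x => ?_)
    (Eventually.of_forall fun x => (hlim x).const_mul (f x))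
  rw [norm_mul, norm_mul, ← mul_add]
  exact mul_le_mul_of_nonneg_left (hle n x) (norm_nonneg _)

end IsPhasedSublattice

end Sublattice

/-! ### Glued measure spaces -/

section Glue

open Filter Topology

variable {X : Type u} [mX : MeasurableSpace X] {ι : Type u}

/-- The `σ`-algebra on `ι × X` consisting of the sets whose slice at each index `i` belongs to
`S i`. -/
@[reducible]
def glueSpace (S : ι → MeasurableSpace X) : MeasurableSpace (ι × X) :=
  ⨅ i, (S i).map (Prod.mk i)

omit mX in
theorem measurable_glueSpace_iff {S : ι → MeasurableSpace X} {β : Type*} [MeasurableSpace β]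
    {g : ι × X → β} :
    Measurable[glueSpace S] g ↔ ∀ i, Measurable[S i] fun x => g (i, x) := by
  constructor
  · intro h i B hB
    exact MeasurableSpace.measurableSet_iInf.1 (h hB) i
  · intro h B hB
    exact MeasurableSpace.measurableSet_iInf.2 fun i => h i hB

/-- The measure on `ι × X` whose restriction to the slice at `i` is `d i • μ`. -/
def glueMeasure (S : ι → MeasurableSpace X) (μ : Measure X) (d : ι → X → ℝ≥0∞) :
    @Measure (ι × X) (glueSpace S) :=
  letI := glueSpace S
  Measure.sum fun i => (μ.withDensity (d i)).map (Prod.mk i)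

variable {S : ι → MeasurableSpace X} (hS : ∀ i, S i ≤ mX) {μ : Measure X} {d : ι → X → ℝ≥0∞}
  (hd : ∀ i, Measurable (d i))
include hS

theorem measurable_prodMk_glueSpace (i : ι) : @Measurable X (ι × X) mX (glueSpace S) (Prod.mk i) :=
  fun _ hB => hS i _ (MeasurableSpace.measurableSet_iInf.1 hB i)

include hd

theorem lintegral_glueMeasure {F : ι × X → ℝ≥0∞} (hF : Measurable[glueSpace S] F) :
    ∫⁻ z, F z ∂(glueMeasure S μ d) = ∑' i, ∫⁻ x, d i x * F (i, x) ∂μ := by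
  let _ := glueSpace S
  rw [glueMeasure, lintegral_sum_measure]
  refine tsum_congr fun i => ?_
  rw [lintegral_map hF (measurable_prodMk_glueSpace hS i)]
  exact lintegral_withDensity_eq_lintegral_mul _ (hd i)
    (hF.comp (measurable_prodMk_glueSpace hS i))

theorem ae_glueMeasure_iff {P : ι × X → Prop} (hP : MeasurableSet[glueSpace S] {z | P z}) :
    (∀ᵐ z ∂(glueMeasure S μ d), P z) ↔ ∀ i, ∀ᵐ x ∂μ, d i x ≠ 0 → P (i, x) := by
  let _ := glueSpace S
  rw [glueMeasure, Measure.ae_sum_iff' hP]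
  refine forall_congr' fun i => ?_
  rw [ae_map_iff (measurable_prodMk_glueSpace hS i).aemeasurable hP, ae_withDensity_iff (hd i)]

end Glue

/-! ### Phased sublattices are `L^p`-spaces -/

section Representation

open Filter Topology

variable {X : Type u} [mX : MeasurableSpace X] {μ : Measure X} {p : ℝ≥0∞} [Fact (1 ≤ p)]
  {E : Submodule ℂ (Lp ℂ p μ)}

theorem eLpNorm_eq_lintegral (hp : p ≠ ∞) {Y : Type*} [MeasurableSpace Y] {ν : Measure Y}
    {u : Y → ℂ} : eLpNorm u p ν = (∫⁻ x, ‖u x‖ₑ ^ p.toReal ∂ν) ^ (1 / p.toReal) :=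
  eLpNorm_eq_lintegral_rpow_enorm_toReal (zero_lt_one.trans_le (Fact.out : 1 ≤ p)).ne' hp

omit [Fact (1 ≤ p)] in
/-- A maximal family of elements of `E` with disjoint supports. -/
theorem exists_maximal_disjoint (E : Submodule ℂ (Lp ℂ p μ)) :
    ∃ I : Set (Lp ℂ p μ), I ⊆ E ∧
      (∀ f ∈ I, ∀ g ∈ I, f ≠ g → ∀ᵐ x ∂μ, f x = 0 ∨ g x = 0) ∧
      ∀ k ∈ E, (∀ f ∈ I, ∀ᵐ x ∂μ, f x = 0 ∨ k x = 0) → k = 0 := by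
  obtain ⟨I, hI⟩ := zorn_subset {I : Set (Lp ℂ p μ) | I ⊆ E \ {0} ∧
      ∀ f ∈ I, ∀ g ∈ I, f ≠ g → ∀ᵐ x ∂μ, f x = 0 ∨ g x = 0} fun c hc hchain => by
    refine ⟨⋃₀ c, ⟨Set.sUnion_subset fun s hs => (hc hs).1, ?_⟩, fun s hs =>
      Set.subset_sUnion_of_mem hs⟩
    rintro f ⟨s, hs, hfs⟩ g ⟨t, ht, hgt⟩ hfg
    rcases hchain.total hs ht with h | h
    · exact (hc ht).2 f (h hfs) g hgt hfg
    · exact (hc hs).2 f hfs g (h hgt) hfg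
  refine ⟨I, fun f hf => (hI.prop.1 hf).1, hI.prop.2, fun k hk hdisj => ?_⟩
  by_contra hk0
  have hins : insert k I ∈ {I : Set (Lp ℂ p μ) | I ⊆ E \ {0} ∧
      ∀ f ∈ I, ∀ g ∈ I, f ≠ g → ∀ᵐ x ∂μ, f x = 0 ∨ g x = 0} := by
    refine ⟨Set.insert_subset ⟨hk, hk0⟩ hI.prop.1, ?_⟩
    rintro f (rfl | hf) g (rfl | hg) hfg
    · exact absurd rfl hfg
    · exact (hdisj g hg).mono fun x hx => hx.symm
    · exact hdisj f hf
    · exact hI.prop.2 f hf g hg hfg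
  have hkI : k ∈ I := hI.le_of_ge hins (Set.subset_insert k I) (Set.mem_insert k I)
  have : ∀ᵐ x ∂μ, k x = 0 := (hdisj k hkI).mono fun x hx => hx.elim id id
  exact hk0 ((Lp.eq_zero_iff_ae_eq_zero).2 this)

namespace IsPhasedSublattice

variable (hE : IsPhasedSublattice E) (hp : p ≠ ∞)
include hE hp

/-- The restriction of an element of `E` to the common zero set of countably many elements of `E`.
-/
theorem represents_indicator_iInter {f : ℕ → Lp ℂ p μ} (hf : ∀ n, f n ∈ E) {h : Lp ℂ p μ}
    (hh : h ∈ E) : Represents E ({x | ∀ n, f n x = 0}.indicator h) := by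
  have hstep : ∀ n, Represents E ({x | ∀ k < n, f k x = 0}.indicator h) := fun n => by
    induction n with
    | zero => simpa using Represents.coe hh
    | succ n ih =>
      obtain ⟨g, hg, hgu⟩ := ih
      refine ((Represents.coe hg).sub (hE.supportMem (f n) (hf n) g hg)).congr ?_
      filter_upwards [hgu] with x hx
      have hiff : (∀ k < n + 1, f k x = 0) ↔ (∀ k < n, f k x = 0) ∧ f n x = 0 := by
        simp only [Nat.lt_succ_iff_lt_or_eq, or_imp, forall_and, forall_eq]
      simp only [Set.indicator, Set.mem_ofPred_eq, hiff] at hx ⊢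
      by_cases h1 : ∀ k < n, f k x = 0 <;> by_cases h2 : f n x = 0
      · rw [if_pos ⟨h1, h2⟩, hx, if_pos h1, h2, zero_mul, sub_zero]
      · rw [mul_div_cancel₀ _ h2, sub_self, if_neg fun h => h2 h.2]
      · rw [h2, zero_mul, sub_zero, hx, if_neg h1, if_neg fun h => h1 h.1]
      · rw [mul_div_cancel₀ _ h2, sub_self, if_neg fun h => h1 h.1]
  refine Represents.of_tendsto hp hE.isClosed hstep (Lp.memLp h).norm
    (fun n => Eventually.of_forall fun x => norm_indicator_le_norm_self _ _)
    (Eventually.of_forall fun x => ?_)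
  by_cases hx : ∀ n, f n x = 0
  · simp [Set.indicator, hx]
  · have hx' := hx
    push Not at hx'
    obtain ⟨N, hN⟩ := hx'
    refine tendsto_const_nhds.congr' ?_
    filter_upwards [eventually_gt_atTop N] with n hn
    have : ¬ ∀ k < n, f k x = 0 := fun h => hN (h N hn)
    simp [Set.indicator, hx, this]

variable {I : Set (Lp ℂ p μ)} (hIE : I ⊆ E)
  (hdisj : ∀ f ∈ I, ∀ g ∈ I, f ≠ g → ∀ᵐ x ∂μ, f x = 0 ∨ g x = 0)
  (hmax : ∀ k ∈ E, (∀ f ∈ I, ∀ᵐ x ∂μ, f x = 0 ∨ k x = 0) → k = 0)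
include hIE hdisj hmax

/-- The supports of a maximal disjoint family exhaust each element of `E`. Only countably many of
the supports meet that of `h`; removing them from `h` leaves an element of `E` disjoint from the
whole family. -/
theorem tsum_lintegral_support {h : Lp ℂ p μ} (hh : h ∈ E) :
    ∑' i : I, ∫⁻ x in {x | i.1 x ≠ 0}, ‖h x‖ₑ ^ p.toReal ∂μ = ∫⁻ x, ‖h x‖ₑ ^ p.toReal ∂μ := by
  have hr := one_le_toReal p hp
  have hmeas : ∀ f : Lp ℂ p μ, MeasurableSet {x | f x ≠ 0} := fun f =>
    (measurableSet_eq_fun (Lp.stronglyMeasurable f).measurable measurable_const).compl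
  have hpart : ∀ J : Set I, J.Countable →
      ∑' i : J, ∫⁻ x in {x | i.1.1 x ≠ 0}, ‖h x‖ₑ ^ p.toReal ∂μ =
      ∫⁻ x in ⋃ i : J, {x | i.1.1 x ≠ 0}, ‖h x‖ₑ ^ p.toReal ∂μ := fun J hJ => by
    have := hJ.to_subtype
    rw [lintegral_iUnion₀ (fun i => (hmeas _).nullMeasurableSet)]
    intro i j hij
    refine measure_mono_null ?_ (hdisj i.1.1 i.1.2 j.1.1 j.1.2
      fun h => hij (Subtype.ext (Subtype.ext h)))
    rintro x ⟨h1, h2⟩ h3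
    exact h3.elim h1 h2
  have hfin : ∫⁻ x, ‖h x‖ₑ ^ p.toReal ∂μ ≠ ∞ :=
    (lintegral_rpow_enorm_lt_top_of_eLpNorm_lt_top
      (zero_lt_one.trans_le (Fact.out : 1 ≤ p)).ne' hp (Lp.memLp h).2).ne
  have hle : ∑' i : I, ∫⁻ x in {x | i.1 x ≠ 0}, ‖h x‖ₑ ^ p.toReal ∂μ ≤
      ∫⁻ x, ‖h x‖ₑ ^ p.toReal ∂μ := by
    rw [ENNReal.tsum_eq_iSup_sum]
    refine iSup_le fun s => ?_
    rw [← Finset.tsum_subtype', hpart (s : Set I) s.countable_toSet]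
    exact setLIntegral_le_lintegral _ _
  set c : I → ℝ≥0∞ := fun i => ∫⁻ x in {x | i.1 x ≠ 0}, ‖h x‖ₑ ^ p.toReal ∂μ
  have hcount : c.support.Countable :=
    Summable.countable_support_ennreal (ne_top_of_le_ne_top hfin hle)
  have hvanish : ∀ᵐ x ∂μ, (∀ i ∈ c.support, i.1 x = 0) → h x = 0 := by
    obtain ⟨f, hf⟩ := ((hcount.image Subtype.val).insert 0).exists_eq_range
      (Set.insert_nonempty _ _)
    have hfmem : ∀ n, f n = 0 ∨ ∃ i ∈ c.support, i.1 = f n := fun n => by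
      have : f n ∈ Set.range f := ⟨n, rfl⟩
      rwa [← hf] at this
    have hfE : ∀ n, f n ∈ E := fun n => by
      rcases hfmem n with h0 | ⟨i, -, hi⟩
      · rw [h0]; exact E.zero_mem
      · rw [← hi]; exact hIE i.2
    obtain ⟨k, hk, hku⟩ := hE.represents_indicator_iInter hp hfE hh
    have hk0 : k = 0 := hmax k hk fun g hg => by
      by_cases hc : (⟨g, hg⟩ : I) ∈ c.support
      · obtain ⟨n, hn⟩ : g ∈ Set.range f := by
          rw [← hf]; exact Or.inr ⟨_, hc, rfl⟩
        filter_upwards [hku] with x hx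
        by_cases hgx : g x = 0
        · exact Or.inl hgx
        · refine Or.inr (hx.trans (Set.indicator_of_notMem (fun hall => hgx ?_) _))
          rw [← hn]; exact hall n
      · have hc0 : ∫⁻ x in {x | g x ≠ 0}, ‖h x‖ₑ ^ p.toReal ∂μ = 0 := by
          simpa [c] using hc
        rw [lintegral_eq_zero_iff' (by fun_prop), EventuallyEq, ae_restrict_iff' (hmeas g)] at hc0
        filter_upwards [hku, hc0] with x hx hx0
        by_cases hgx : g x = 0
        · exact Or.inl hgx
        · have hhx : h x = 0 := by
            simpa [(zero_lt_one.trans_le hr), (zero_lt_one.trans_le hr).not_gt] using hx0 hgx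
          exact Or.inr (hx.trans (Set.indicator_apply_eq_zero.2 fun _ => hhx))
    filter_upwards [hku, (Lp.eq_zero_iff_ae_eq_zero).1 hk0,
      Lp.coeFn_zero ℂ p μ] with x hx hkx h0 hall
    rw [hkx] at hx
    refine (Set.indicator_apply_eq_zero.1 hx.symm) fun n => ?_
    rcases hfmem n with h1 | ⟨i, hi, hi'⟩
    · rw [h1]; exact h0
    · rw [← hi']; exact hall i hi
  have := hcount.to_subtype
  rw [← tsum_subtype_eq_of_support_subset (s := c.support) subset_rfl, hpart _ hcount,
    ← lintegral_indicator (MeasurableSet.iUnion fun i => hmeas _)]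
  refine lintegral_congr_ae ?_
  filter_upwards [hvanish] with x hx
  refine Set.indicator_apply_eq_self.2 fun hxn => ?_
  rw [hx fun i hi => ?_]
  · simp [(zero_lt_one.trans_le hr)]
  · by_contra hne
    exact hxn (Set.mem_iUnion.2 ⟨⟨i, hi⟩, hne⟩)

end IsPhasedSublattice

namespace IsPhasedSublattice

/-- For a maximal disjoint family `I` in `E`, the map `h ↦ (h / f)_{f ∈ I}` identifies `E` with the
`L^p`-space of the disjoint union over `f ∈ I` of copies of `X`, each carrying the measure
`|f| ^ p μ` on the `σ`-algebra associated to `f`. -/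
theorem exists_linearIsometryEquiv (hE : IsPhasedSublattice E) (hp : p ≠ ∞) :
    ∃ (Y : Type u) (_ : MeasurableSpace Y) (ν : Measure Y), Nonempty (E ≃ₗᵢ[ℂ] Lp ℂ p ν) := by
  have hr := one_le_toReal p hp
  have hr0 : 0 < p.toReal := by linarith
  have hp0 : p ≠ 0 := (zero_lt_one.trans_le (Fact.out : 1 ≤ p)).ne'
  obtain ⟨I, hIE, hdisj, hmax⟩ := exists_maximal_disjoint E
  let S : I → MeasurableSpace X := fun i => hE.sigmaAlgebra (hIE i.2) hp
  let d : I → X → ℝ≥0∞ := fun i x => ‖i.1 x‖ₑ ^ p.toReal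
  have hS : ∀ i, S i ≤ mX := fun i => hE.sigmaAlgebra_le (hIE i.2) hp
  have hd : ∀ i, Measurable (d i) := fun i =>
    ((Lp.stronglyMeasurable i.1).measurable.enorm.pow_const _)
  have hd0 : ∀ i x, d i x ≠ 0 ↔ i.1 x ≠ 0 := fun i x => by
    simp [d, hr0, hr0.not_gt]
  let _ : MeasurableSpace (I × X) := glueSpace S
  set ν : Measure (I × X) := glueMeasure S μ d
  have hmeas : ∀ f : Lp ℂ p μ, MeasurableSet {x | f x ≠ 0} := fun f =>
    (measurableSet_eq_fun (Lp.stronglyMeasurable f).measurable measurable_const).compl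
  let V₀ : Lp ℂ p μ → I × X → ℂ := fun h z => h z.2 / z.1.1 z.2
  have hVm : ∀ h ∈ E, Measurable (V₀ h) := fun h hh =>
    measurable_glueSpace_iff.2 fun i => hE.measurable_div (hIE i.2) hp hh
  have hlint : ∀ w : I × X → ℂ, Measurable w → ∫⁻ z, ‖w z‖ₑ ^ p.toReal ∂ν =
      ∑' i : I, ∫⁻ x, ‖i.1 x * w (i, x)‖ₑ ^ p.toReal ∂μ := fun w hw => by
    rw [lintegral_glueMeasure hS hd (hw.enorm.pow_const _)]
    refine tsum_congr fun i => lintegral_congr fun x => ?_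
    rw [enorm_mul, ENNReal.mul_rpow_of_nonneg _ _ hr0.le]
  have hVnorm : ∀ h ∈ E, eLpNorm (V₀ h) p ν = eLpNorm h p μ := fun h hh => by
    rw [eLpNorm_eq_lintegral hp, eLpNorm_eq_lintegral hp, hlint _ (hVm h hh),
      ← hE.tsum_lintegral_support hp hIE hdisj hmax hh]
    congr 1
    refine tsum_congr fun i => ?_
    rw [← lintegral_indicator (hmeas _)]
    refine lintegral_congr fun x => ?_
    by_cases hx : i.1 x = 0
    · simp [V₀, hx, hr0]
    · simp only [V₀, mul_div_cancel₀ _ hx]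
      rw [Set.indicator_of_mem (by exact hx)]
  have hVmem : ∀ h ∈ E, MemLp (V₀ h) p ν := fun h hh =>
    ⟨(hVm h hh).aestronglyMeasurable, by rw [hVnorm h hh]; exact Lp.eLpNorm_lt_top h⟩
  have hae : ∀ w w' : I × X → ℂ, Measurable w → Measurable w' →
      (∀ i : I, ∀ᵐ x ∂μ, i.1 x ≠ 0 → w (i, x) = w' (i, x)) → w =ᵐ[ν] w' := fun w w' hw hw' h =>
    (ae_glueMeasure_iff hS hd (measurableSet_eq_fun hw hw')).2 fun i =>
      (h i).mono fun x hx h0 => hx ((hd0 i x).1 h0)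
  let V : E →ₗᵢ[ℂ] Lp ℂ p ν :=
    { toFun := fun h => (hVmem h.1 h.2).toLp
      map_add' := fun g h => by
        rw [← MemLp.toLp_add]
        refine (MemLp.toLp_eq_toLp_iff _ _).2 <|
          hae _ _ (hVm _ (g + h).2) ((hVm _ g.2).add (hVm _ h.2)) fun i => ?_
        filter_upwards [Lp.coeFn_add g.1 h.1] with x hx _
        simp only [V₀, Submodule.coe_add, hx, Pi.add_apply, add_div]
      map_smul' := fun c h => by
        rw [RingHom.id_apply, ← MemLp.toLp_const_smul]
        refine (MemLp.toLp_eq_toLp_iff _ _).2 <|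
          hae _ _ (hVm _ (c • h).2) ((hVm _ h.2).const_smul c) fun i => ?_
        filter_upwards [Lp.coeFn_smul c h.1] with x hx _
        simp only [V₀, Submodule.coe_smul, hx, Pi.smul_apply, smul_eq_mul, mul_div_assoc]
      norm_map' := fun h => by
        change ‖(hVmem h.1 h.2).toLp‖ = ‖h.1‖
        rw [Lp.norm_toLp, hVnorm _ h.2, Lp.norm_def] }
  have hVcoe : ∀ h : E, V h =ᵐ[ν] V₀ h := fun h => (hVmem h.1 h.2).coeFn_toLp
  have hcomplete : CompleteSpace E := hE.isClosed.completeSpace_coe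
  have hclosed : IsClosed (Set.range V) := V.isometry.isClosedEmbedding.isClosed_range
  refine ⟨I × X, glueSpace S, ν, ⟨LinearIsometryEquiv.ofSurjective V fun w => ?_⟩⟩
  obtain ⟨w', hw'm, hww'⟩ := (Lp.aestronglyMeasurable w)
  have hw'meas : Measurable w' := hw'm.measurable
  have hfin : ∑' i : I, ∫⁻ x, ‖i.1 x * w' (i, x)‖ₑ ^ p.toReal ∂μ ≠ ∞ := by
    rw [← hlint _ hw'meas]
    exact (lintegral_rpow_enorm_lt_top_of_eLpNorm_lt_top hp0 hp
      ((memLp_congr_ae hww').1 (Lp.memLp w)).2).ne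
  -- Each slice of `w'` comes from an element `g i` of `E`.
  have hrep : ∀ i : I, Represents E fun x => i.1 x * w' (i, x) := fun i => by
    refine hE.represents_mul (hIE i.2) hp (measurable_glueSpace_iff.1 hw'meas i) ⟨?_, ?_⟩
    · exact ((Lp.stronglyMeasurable i.1).measurable.mul
        ((measurable_glueSpace_iff.1 hw'meas i).mono (hS i) le_rfl)).aestronglyMeasurable
    · exact (eLpNorm_lt_top_iff_lintegral_rpow_enorm_lt_top hp0 hp).2
        ((ENNReal.le_tsum i).trans_lt hfin.lt_top)
  choose g hgE hg using hrep
  -- Finite sums of the `g i` are mapped to truncations of `w'`, which converge to `w'`.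
  let e : Finset I → E := fun s => ∑ i ∈ s, ⟨g i, hgE i⟩
  have hecoe : ∀ s, ∀ᵐ x ∂μ, (e s).1 x = ∑ i ∈ s, g i x := fun s => by
    have : (e s).1 = ∑ i ∈ s, g i := by simp [e]
    rw [this]
    filter_upwards [Lp.coeFn_finsetSum s g] with x hx
    rw [hx, Finset.sum_apply]
  classical
  let T : Finset I → I × X → ℂ := fun s z => if z.1 ∈ s then w' z else 0
  have hTm : ∀ s, Measurable (T s) := fun s => measurable_glueSpace_iff.2 fun i => by
    by_cases hi : i ∈ s
    · simpa [T, hi] using measurable_glueSpace_iff.1 hw'meas i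
    · simp [T, hi]
  have hVe : ∀ s, V (e s) =ᵐ[ν] T s := fun s => by
    refine (hVcoe (e s)).trans (hae _ _ (hVm _ (e s).2) (hTm s) fun j => ?_)
    have h1 : ∀ᵐ x ∂μ, ∀ i ∈ s, i ≠ j → i.1 x = 0 ∨ j.1 x = 0 :=
      (Finset.eventually_all s).2 fun i _ => by
        by_cases hij : i = j
        · exact Eventually.of_forall fun x h => absurd hij h
        · exact (hdisj i.1 i.2 j.1 j.2 fun h => hij (Subtype.ext h)).mono fun x hx _ => hx
    have h2 : ∀ᵐ x ∂μ, ∀ i ∈ s, g i x = i.1 x * w' (i, x) :=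
      (Finset.eventually_all s).2 fun i _ => hg i
    filter_upwards [hecoe s, h1, h2] with x hx hx1 hx2 hj
    have hsum : ∑ i ∈ s, g i x = if j ∈ s then j.1 x * w' (j, x) else 0 := by
      rw [← Finset.sum_ite_eq' s j fun i => i.1 x * w' (i, x)]
      refine Finset.sum_congr rfl fun i hi => ?_
      rw [hx2 i hi]
      split_ifs with hij
      · rfl
      · rw [(hx1 i hi hij).resolve_right hj, zero_mul]
    simp only [V₀, T, hx, hsum]
    split_ifs
    · rw [mul_div_cancel_left₀ _ hj]
    · rw [zero_div]
  change w ∈ Set.range V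
  refine hclosed.mem_of_tendsto (f := fun s => V (e s)) (b := atTop) ?_
    (Eventually.of_forall fun s => ⟨e s, rfl⟩)
  rw [Lp.tendsto_Lp_iff_tendsto_eLpNorm']
  have hnorm : ∀ s, eLpNorm (⇑(V (e s)) - ⇑w) p ν =
      (∑' i : {i // i ∉ s}, ∫⁻ x, ‖i.1.1 x * w' (i, x)‖ₑ ^ p.toReal ∂μ) ^ (1 / p.toReal) :=
    fun s => by
      have h1 : ⇑(V (e s)) - ⇑w =ᵐ[ν] fun z => T s z - w' z := (hVe s).sub hww'
      rw [eLpNorm_congr_ae h1, eLpNorm_eq_lintegral hp,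
        hlint (fun z => T s z - w' z) ((hTm s).sub hw'meas)]
      congr 1
      refine Eq.trans (tsum_congr fun i => ?_) (tsum_subtype {i | i ∉ s} fun i : I =>
        ∫⁻ x, ‖i.1 x * w' (i, x)‖ₑ ^ p.toReal ∂μ).symm
      by_cases hi : i ∈ s <;> simp [T, hi, hr0]
  simp only [hnorm]
  have h0 : (0 : ℝ≥0∞) = 0 ^ (1 / p.toReal) := (ENNReal.zero_rpow_of_pos (by positivity)).symm
  rw [h0]
  exact (ENNReal.tendsto_tsum_compl_atTop_zero hfin).ennrpow_const _

end IsPhasedSublattice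

end Representation

/-! ### The duality map `a ↦ |a| ^ (r - 2) * conj a` -/

section DualityMap

open ComplexConjugate Filter Topology

/-- The duality map for the exponent `r`; up to the factor `r`, `b ↦ Re (dualityMap r a * b)` is
the derivative of `‖·‖ ^ r` at `a`. -/
def dualityMap (r : ℝ) (a : ℂ) : ℂ := ((‖a‖ ^ (r - 2) : ℝ) : ℂ) * conj a

theorem dualityMap_zero (r : ℝ) : dualityMap r 0 = 0 := by simp [dualityMap]

theorem dualityMap_eq_zero_iff {r : ℝ} {a : ℂ} : dualityMap r a = 0 ↔ a = 0 := by
  refine ⟨fun h => ?_, fun h => h ▸ dualityMap_zero r⟩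
  by_contra ha
  have h1 : ‖a‖ ^ (r - 2) ≠ 0 := (Real.rpow_pos_of_pos (norm_pos_iff.2 ha) _).ne'
  simp [dualityMap, ha, h1] at h

theorem dualityMap_mul (r : ℝ) (a b : ℂ) :
    dualityMap r (a * b) = dualityMap r a * dualityMap r b := by
  simp only [dualityMap, norm_mul, map_mul, Real.mul_rpow (norm_nonneg a) (norm_nonneg b),
    Complex.ofReal_mul]
  ring

theorem measurable_dualityMap (r : ℝ) : Measurable (dualityMap r) := by
  unfold dualityMap
  exact (Complex.measurable_ofReal.comp (measurable_norm.pow_const _)).mul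
    Complex.continuous_conj.measurable

theorem norm_dualityMap {r : ℝ} {a : ℂ} (ha : a ≠ 0) : ‖dualityMap r a‖ = ‖a‖ ^ (r - 1) := by
  have h : 0 < ‖a‖ := norm_pos_iff.2 ha
  rw [dualityMap, norm_mul, RCLike.norm_conj, Complex.norm_real,
    Real.norm_of_nonneg (by positivity), ← Real.rpow_add_one h.ne']
  congr 1; ring

theorem norm_dualityMap_le (r : ℝ) (a : ℂ) : ‖dualityMap r a‖ ≤ ‖a‖ ^ (r - 1) := by
  rcases eq_or_ne a 0 with rfl | ha
  · rw [dualityMap_zero, norm_zero]; positivity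
  · exact (norm_dualityMap ha).le

theorem dualityMap_mul_self {r : ℝ} (hr : r ≠ 0) (a : ℂ) :
    dualityMap r a * a = ((‖a‖ ^ r : ℝ) : ℂ) := by
  rcases eq_or_ne a 0 with rfl | ha
  · simp [Real.zero_rpow hr]
  · have h : 0 < ‖a‖ := norm_pos_iff.2 ha
    rw [dualityMap, mul_assoc, mul_comm (conj a), Complex.mul_conj, Complex.normSq_eq_norm_sq,
      ← Complex.ofReal_mul, ← Real.rpow_natCast, ← Real.rpow_add h]
    congr 2; push_cast; ring

theorem dualityMap_dualityMap {r s : ℝ} (h : (r - 1) * (s - 1) = 1) (a : ℂ) :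
    dualityMap s (dualityMap r a) = a := by
  rcases eq_or_ne a 0 with rfl | ha
  · rw [dualityMap_zero, dualityMap_zero]
  · have hpos : 0 < ‖a‖ := norm_pos_iff.2 ha
    rw [dualityMap, norm_dualityMap ha, dualityMap, map_mul, Complex.conj_conj,
      Complex.conj_ofReal, ← mul_assoc, ← Complex.ofReal_mul, ← Real.rpow_mul hpos.le,
      ← Real.rpow_add hpos]
    have : (r - 1) * (s - 2) + (r - 2) = 0 := by linarith
    rw [this, Real.rpow_zero, Complex.ofReal_one, one_mul]

theorem dualityMap_of_norm_eq_one {r : ℝ} {a : ℂ} (h : ‖a‖ = 1) : dualityMap r a = conj a := by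
  simp [dualityMap, h]

theorem continuousAt_dualityMap {r : ℝ} {a : ℂ} (h : 1 < r ∨ a ≠ 0) :
    ContinuousAt (dualityMap r) a := by
  by_cases ha : a = 0
  · subst ha
    have hr : 1 < r := h.resolve_right (by simp)
    rw [ContinuousAt, dualityMap_zero]
    refine squeeze_zero_norm (norm_dualityMap_le r) ?_
    have : Tendsto (fun a : ℂ => ‖a‖ ^ (r - 1)) (𝓝 0) (𝓝 (‖(0 : ℂ)‖ ^ (r - 1))) :=
      ((continuous_norm.tendsto (0 : ℂ)).rpow_const (Or.inr (by linarith)))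
    rwa [norm_zero, Real.zero_rpow (by linarith)] at this
  · refine ContinuousAt.mul ?_ Complex.continuous_conj.continuousAt
    exact Complex.continuous_ofReal.continuousAt.comp
      (continuous_norm.continuousAt.rpow_const (Or.inl (norm_ne_zero_iff.2 ha)))

theorem norm_dualityMap_mul_le {r : ℝ} (hr : 1 ≤ r) (a b : ℂ) :
    ‖dualityMap r a‖ * ‖b‖ ≤ ‖a‖ ^ r + ‖b‖ ^ r := by
  have hmax : ‖a‖ ^ (r - 1) * ‖b‖ ≤ (max ‖a‖ ‖b‖) ^ r := by
    calc ‖a‖ ^ (r - 1) * ‖b‖ ≤ (max ‖a‖ ‖b‖) ^ (r - 1) * (max ‖a‖ ‖b‖) ^ (1 : ℝ) := by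
          rw [Real.rpow_one]
          gcongr
          · exact le_max_left _ _
          · exact le_max_right _ _
      _ = (max ‖a‖ ‖b‖) ^ r := by
          rw [← Real.rpow_add_of_nonneg (by positivity) (by linarith) zero_le_one]
          congr 1; ring
  refine (mul_le_mul_of_nonneg_right (norm_dualityMap_le r a) (norm_nonneg b)).trans
    (hmax.trans ?_)
  have ha : 0 ≤ ‖a‖ ^ r := by positivity
  have hb : 0 ≤ ‖b‖ ^ r := by positivity
  rcases max_cases ‖a‖ ‖b‖ with ⟨h, -⟩ | ⟨h, -⟩ <;> rw [h] <;> linarith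

/-- The tangent line inequality for `x ↦ x ^ r`. -/
theorem rpow_add_mul_sub_le {r x y : ℝ} (hr : 1 ≤ r) (hx : 0 ≤ x) (hy : 0 ≤ y) :
    y ^ r + r * (y ^ (r - 1) * (x - y)) ≤ x ^ r := by
  rcases hy.eq_or_lt with rfl | hy
  · rcases hr.eq_or_lt with rfl | hr
    · simp
    · rw [Real.zero_rpow (by linarith), Real.zero_rpow (by linarith)]
      have : 0 ≤ x ^ r := by positivity
      linarith
  · have h := one_add_mul_self_le_rpow_one_add (s := (x - y) / y) (by
      rw [le_div_iff₀ hy]; linarith) hr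
    have h1 : 1 + (x - y) / y = x / y := by field_simp; ring
    rw [h1, Real.div_rpow hx hy.le, le_div_iff₀ (by positivity)] at h
    have h2 : y ^ (r - 1) = y ^ r / y := by rw [Real.rpow_sub_one hy.ne']
    rw [h2]
    calc _ = (1 + r * ((x - y) / y)) * y ^ r := by field_simp
      _ ≤ _ := h

theorem eq_of_rpow_add_mul_sub {r x y : ℝ} (hr : 1 < r) (hx : 0 ≤ x) (hy : 0 ≤ y)
    (h : x ^ r ≤ y ^ r + r * (y ^ (r - 1) * (x - y))) : x = y := by
  rcases hy.eq_or_lt with rfl | hy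
  · rw [Real.zero_rpow (by linarith), Real.zero_rpow (by linarith)] at h
    by_contra hne
    have : 0 < x ^ r := Real.rpow_pos_of_pos (lt_of_le_of_ne hx (Ne.symm hne)) r
    linarith
  · by_contra hne
    have h' := one_add_mul_self_lt_rpow_one_add (s := (x - y) / y) (by
      rw [le_div_iff₀ hy]; linarith) (div_ne_zero (sub_ne_zero.2 hne) hy.ne') hr
    have h1 : 1 + (x - y) / y = x / y := by field_simp; ring
    rw [h1, Real.div_rpow hx hy.le, lt_div_iff₀ (by positivity)] at h'
    have h2 : y ^ (r - 1) = y ^ r / y := by rw [Real.rpow_sub_one hy.ne']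
    rw [h2] at h
    have : (1 + r * ((x - y) / y)) * y ^ r = y ^ r + r * (y ^ r / y * (x - y)) := by field_simp
    linarith

theorem re_dualityMap_mul_le (r : ℝ) (a b : ℂ) :
    (dualityMap r a * b).re ≤ ‖a‖ ^ (r - 1) * ‖b‖ :=
  ((Complex.re_le_norm _).trans (norm_mul_le _ _)).trans
    (mul_le_mul_of_nonneg_right (norm_dualityMap_le r a) (norm_nonneg b))

theorem rpow_eq_rpow_sub_one_mul {r x : ℝ} (hr : 1 ≤ r) (hx : 0 ≤ x) :
    x ^ r = x ^ (r - 1) * x := by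
  conv_rhs => rw [← Real.rpow_one x, ← Real.rpow_mul hx, one_mul]
  rw [← Real.rpow_add_of_nonneg hx (by linarith) zero_le_one]
  congr 1; ring

/-- The tangent plane inequality for `‖·‖ ^ r`. -/
theorem norm_rpow_add_re_dualityMap_le {r : ℝ} (hr : 1 ≤ r) (a b : ℂ) :
    ‖a‖ ^ r + r * (dualityMap r a * (b - a)).re ≤ ‖b‖ ^ r := by
  have h1 := rpow_add_mul_sub_le hr (norm_nonneg b) (norm_nonneg a)
  have h2 := re_dualityMap_mul_le r a b
  have h3 := rpow_eq_rpow_sub_one_mul hr (norm_nonneg a)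
  rw [mul_sub, dualityMap_mul_self (by linarith), Complex.sub_re, Complex.ofReal_re]
  refine le_trans ?_ h1
  have : (dualityMap r a * b).re - ‖a‖ ^ r ≤ ‖a‖ ^ (r - 1) * (‖b‖ - ‖a‖) := by
    rw [mul_sub, ← h3]; linarith
  have := mul_le_mul_of_nonneg_left this (show 0 ≤ r by linarith)
  linarith

/-- The equality case of `norm_rpow_add_re_dualityMap_le`, by strict convexity. -/
theorem eq_of_norm_rpow_le {r : ℝ} (hr : 1 < r) {a b : ℂ}
    (h : ‖b‖ ^ r ≤ ‖a‖ ^ r + r * (dualityMap r a * (b - a)).re) : b = a := by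
  have h2 := re_dualityMap_mul_le r a b
  have h3 := rpow_eq_rpow_sub_one_mul hr.le (norm_nonneg a)
  rw [mul_sub, dualityMap_mul_self (by linarith), Complex.sub_re, Complex.ofReal_re] at h
  have h4 : (dualityMap r a * b).re - ‖a‖ ^ r ≤ ‖a‖ ^ (r - 1) * (‖b‖ - ‖a‖) := by
    rw [mul_sub, ← h3]; linarith
  have h5 := mul_le_mul_of_nonneg_left h4 (show 0 ≤ r by linarith)
  have hnorm : ‖b‖ = ‖a‖ :=
    eq_of_rpow_add_mul_sub hr (norm_nonneg b) (norm_nonneg a) (by linarith)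
  rcases eq_or_ne a 0 with rfl | ha
  · simpa using hnorm
  · have hpos : 0 < ‖a‖ := norm_pos_iff.2 ha
    rw [hnorm] at h
    have h6 : ‖a‖ ^ r ≤ (dualityMap r a * b).re := by
      have : 0 ≤ r * ((dualityMap r a * b).re - ‖a‖ ^ r) := by linarith
      linarith [nonneg_of_mul_nonneg_right this (by linarith)]
    have h7 : (dualityMap r a * b).re = ‖a‖ ^ (r - 2) * (conj a * b).re := by
      rw [dualityMap, mul_assoc, Complex.re_ofReal_mul]
    have h8 : ‖a‖ ^ r = ‖a‖ ^ (r - 2) * ‖a‖ ^ 2 := by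
      rw [← Real.rpow_natCast, ← Real.rpow_add hpos]; congr 1; push_cast; ring
    rw [h7, h8] at h6
    have h9 : ‖a‖ ^ 2 ≤ (conj a * b).re := le_of_mul_le_mul_left h6 (by positivity)
    have h10 : ‖b - a‖ ^ 2 ≤ 0 := by
      have hs : ‖b - a‖ ^ 2 = ‖b‖ ^ 2 - 2 * (conj a * b).re + ‖a‖ ^ 2 := by
        simp only [← Complex.normSq_eq_norm_sq, Complex.normSq_sub]
        rw [mul_comm b]; ring
      rw [hs, hnorm]; linarith
    have : ‖b - a‖ = 0 := by nlinarith [norm_nonneg (b - a)]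
    exact sub_eq_zero.1 (norm_eq_zero.1 this)

theorem abs_rpow_sub_rpow_mul_le {s x y M : ℝ} (hs : 0 < s) (hx : 0 ≤ x) (hy : 0 ≤ y)
    (hxM : x ≤ M) (hyM : y ≤ M) : |x ^ s - y ^ s| * y ≤ (s + 1) * (M ^ s * |x - y|) := by
  have hmono : ∀ {x y : ℝ}, 0 ≤ y → y ≤ x → x ≤ M →
      x ^ (s + 1) - y ^ (s + 1) ≤ (s + 1) * (M ^ s * (x - y)) := fun {x y} hy hyx hxM => by
    have h := rpow_add_mul_sub_le (r := s + 1) (by linarith) hy (hy.trans hyx)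
    rw [add_sub_cancel_right] at h
    have h2 : x ^ s * (x - y) ≤ M ^ s * (x - y) :=
      mul_le_mul_of_nonneg_right (Real.rpow_le_rpow (hy.trans hyx) hxM hs.le) (by linarith)
    have h3 := mul_le_mul_of_nonneg_left h2 (show 0 ≤ s + 1 by linarith)
    linarith
  have hp1 : ∀ {x : ℝ}, 0 ≤ x → x ^ (s + 1) = x ^ s * x := fun {x} hx => by
    rw [rpow_eq_rpow_sub_one_mul (by linarith) hx, add_sub_cancel_right]
  rcases le_total x y with h | h
  · have hle := Real.rpow_le_rpow hx h hs.le
    rw [abs_of_nonpos (by linarith), abs_of_nonpos (by linarith)]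
    have h1 := hmono hx h hyM
    rw [hp1 hx, hp1 hy] at h1
    have h2 : x ^ s * x ≤ x ^ s * y := mul_le_mul_of_nonneg_left h (by positivity)
    linarith
  · have hle := Real.rpow_le_rpow hy h hs.le
    rw [abs_of_nonneg (by linarith), abs_of_nonneg (by linarith)]
    have h1 := hmono hy h hxM
    rw [hp1 hx, hp1 hy] at h1
    have h2 : x ^ s * y ≤ x ^ s * x := mul_le_mul_of_nonneg_left h (by positivity)
    linarith

/-- Local Lipschitz estimate for the duality map. -/
theorem norm_dualityMap_sub_le {r : ℝ} (hr : 2 < r) {x y : ℂ} {M : ℝ} (hx : ‖x‖ ≤ M)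
    (hy : ‖y‖ ≤ M) : ‖dualityMap r x - dualityMap r y‖ ≤ r * (M ^ (r - 2) * ‖x - y‖) := by
  have hM : 0 ≤ M := (norm_nonneg x).trans hx
  have hsplit : dualityMap r x - dualityMap r y = ((‖x‖ ^ (r - 2) : ℝ) : ℂ) * conj (x - y) +
      ((‖x‖ ^ (r - 2) - ‖y‖ ^ (r - 2) : ℝ) : ℂ) * conj y := by
    simp only [dualityMap, map_sub]; push_cast; ring
  have h1 := abs_rpow_sub_rpow_mul_le (s := r - 2) (by linarith) (norm_nonneg x) (norm_nonneg y)
    hx hy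
  have h2 : |‖x‖ - ‖y‖| ≤ ‖x - y‖ := abs_norm_sub_norm_le x y
  have h3 : ‖x‖ ^ (r - 2) ≤ M ^ (r - 2) := Real.rpow_le_rpow (norm_nonneg x) hx (by linarith)
  rw [hsplit]
  refine (norm_add_le _ _).trans ?_
  rw [norm_mul, norm_mul, RCLike.norm_conj, RCLike.norm_conj, Complex.norm_real,
    Complex.norm_real, Real.norm_of_nonneg (by positivity), Real.norm_eq_abs]
  have h4 : ‖x‖ ^ (r - 2) * ‖x - y‖ ≤ M ^ (r - 2) * ‖x - y‖ :=
    mul_le_mul_of_nonneg_right h3 (norm_nonneg _)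
  have h5 : (r - 2 + 1) * (M ^ (r - 2) * |‖x‖ - ‖y‖|) ≤
      (r - 2 + 1) * (M ^ (r - 2) * ‖x - y‖) :=
    mul_le_mul_of_nonneg_left (mul_le_mul_of_nonneg_left h2 (by positivity)) (by linarith)
  linarith

/-- The derivative of the duality map at `1`. It is real linear in `w`; the coefficient of `w`
vanishes exactly when `r = 2`. -/
theorem hasDerivAt_dualityMap_one_add (r : ℝ) (w : ℂ) :
    HasDerivAt (fun t : ℝ => dualityMap r (1 + t * w))
      (((r / 2 : ℝ) : ℂ) * conj w + ((r / 2 - 1 : ℝ) : ℂ) * w) 0 := by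
  have h1 : HasDerivAt (fun t : ℝ => (1 + t * w : ℂ)) w 0 := by
    simpa using ((Complex.ofRealCLM.hasDerivAt (x := (0 : ℝ))).mul_const w).const_add 1
  have h2 : HasDerivAt (fun t : ℝ => ‖(1 + t * w : ℂ)‖ ^ 2) (2 * w.re) 0 := by
    have := h1.norm_sq
    simpa [Complex.inner, mul_comm] using this
  have h3 : HasDerivAt (fun t : ℝ => ‖(1 + t * w : ℂ)‖ ^ (r - 2)) ((r - 2) * w.re) 0 := by
    have h := h2.rpow_const (p := (r - 2) / 2) (Or.inl (by simp))
    simp only [← norm_rpow_eq_sq_rpow] at h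
    convert h using 1
    simp; ring
  have h4 : HasDerivAt (fun t : ℝ => conj (1 + t * w : ℂ)) (conj w) 0 :=
    (Complex.conjCLE.toContinuousLinearMap.hasFDerivAt.comp_hasDerivAt (0 : ℝ) h1)
  have h5 := h3.ofReal_comp.mul h4
  refine h5.congr_deriv ?_
  simp only [Complex.ofReal_zero, zero_mul, add_zero, map_one, norm_one, Real.one_rpow,
    Complex.ofReal_one, one_mul, mul_one, Complex.ofReal_mul, Complex.re_eq_add_conj]
  push_cast; ring

end DualityMap

/-! ### Fixed vectors of contractions and the duality map -/

section Contraction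

open ComplexConjugate Filter Topology

variable {X : Type u} [mX : MeasurableSpace X] {μ : Measure X} {p : ℝ≥0∞} [Fact (1 ≤ p)]

theorem MemLp.integrable_norm_rpow_toReal {E : Type*} [NormedAddCommGroup E] (hp : p ≠ ∞)
    {f : X → E} (hf : MemLp f p μ) : Integrable (fun x => ‖f x‖ ^ p.toReal) μ :=
  hf.integrable_norm_rpow (zero_lt_one.trans_le (Fact.out : 1 ≤ p)).ne' hp

theorem aestronglyMeasurable_dualityMap (r : ℝ) {f : X → ℂ} (hf : AEStronglyMeasurable f μ) :
    AEStronglyMeasurable (fun x => dualityMap r (f x)) μ :=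
  ((measurable_dualityMap r).comp_aemeasurable hf.aemeasurable).aestronglyMeasurable

theorem integrable_dualityMap_mul (hp : p ≠ ∞) {f k : X → ℂ} (hf : MemLp f p μ)
    (hk : MemLp k p μ) : Integrable (fun x => dualityMap p.toReal (f x) * k x) μ := by
  refine ((MemLp.integrable_norm_rpow_toReal hp hf).add
    (MemLp.integrable_norm_rpow_toReal hp hk)).mono'
    ((aestronglyMeasurable_dualityMap _ hf.1).mul hk.1) (Eventually.of_forall fun x => ?_)
  rw [norm_mul]
  exact norm_dualityMap_mul_le (one_le_toReal p hp) _ _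

/-- The duality map is continuous except, for exponent one, at the origin; hence the condition on
the zeros of `f`. -/
theorem tendsto_integral_dualityMap (hp : p ≠ ∞) {f k : X → ℂ} (hf : MemLp f p μ)
    (hk : MemLp k p μ) (hfk : 1 < p.toReal ∨ ∀ᵐ x ∂μ, f x = 0 → k x = 0) :
    Tendsto (fun n : ℕ => ∫ x, dualityMap p.toReal (f x + (1 / ((n : ℝ) + 1) : ℝ) * k x) * k x ∂μ)
      atTop (𝓝 (∫ x, dualityMap p.toReal (f x) * k x ∂μ)) := by
  have hr := one_le_toReal p hp
  have ht : ∀ n : ℕ, (1 / ((n : ℝ) + 1) : ℝ) ≤ 1 := fun n => by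
    rw [div_le_one (by positivity)]; linarith [n.cast_nonneg (α := ℝ)]
  refine tendsto_integral_of_dominated_convergence
    (fun x => ‖‖f x‖ + ‖k x‖‖ ^ p.toReal + ‖k x‖ ^ p.toReal) (fun n => ?_)
    ((MemLp.integrable_norm_rpow_toReal hp (hf.norm.add hk.norm)).add
      (MemLp.integrable_norm_rpow_toReal hp hk)) (fun n => Eventually.of_forall fun x => ?_) ?_
  · exact (aestronglyMeasurable_dualityMap _ (hf.1.add (hk.1.const_mul _))).mul hk.1
  · rw [norm_mul]
    refine (norm_dualityMap_mul_le hr _ _).trans (add_le_add ?_ le_rfl)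
    refine Real.rpow_le_rpow (norm_nonneg _) ?_ (by linarith)
    rw [Real.norm_of_nonneg (by positivity)]
    refine (norm_add_le _ _).trans (add_le_add le_rfl ?_)
    rw [norm_mul, Complex.norm_real, Real.norm_of_nonneg (by positivity)]
    exact mul_le_of_le_one_left (norm_nonneg _) (ht n)
  · have hlim : ∀ x, Tendsto (fun n : ℕ => f x + (1 / ((n : ℝ) + 1) : ℝ) * k x) atTop (𝓝 (f x)) :=
      fun x => by
        have h1 : Tendsto (fun n : ℕ => ((1 / ((n : ℝ) + 1) : ℝ) : ℂ)) atTop (𝓝 ((0 : ℝ) : ℂ)) :=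
          (Complex.continuous_ofReal.tendsto _).comp tendsto_one_div_add_atTop_nhds_zero_nat
        simpa using (h1.mul_const (k x)).const_add (f x)
    have hgood : ∀ x, (1 < p.toReal ∨ f x ≠ 0) → Tendsto (fun n : ℕ =>
        dualityMap p.toReal (f x + (1 / ((n : ℝ) + 1) : ℝ) * k x) * k x) atTop
        (𝓝 (dualityMap p.toReal (f x) * k x)) := fun x hx =>
      ((continuousAt_dualityMap hx).tendsto.comp (hlim x)).mul_const _
    rcases hfk with h | h
    · exact Eventually.of_forall fun x => hgood x (Or.inl h)
    · filter_upwards [h] with x hx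
      by_cases h0 : f x = 0
      · simp [hx h0]
      · exact hgood x (Or.inr h0)

variable {P : Lp ℂ p μ →L[ℂ] Lp ℂ p μ} (hP : ∀ f, ‖P f‖ ≤ ‖f‖)
include hP

/-- Tangent plane inequalities at `f` and at `f + t k` compare `‖P (f + t k)‖ ^ p ≤ ‖f + t k‖ ^ p`
to first order in `t ↓ 0`. -/
theorem re_integral_dualityMap_mul_apply_le (hp : p ≠ ∞) {f : Lp ℂ p μ} (hf : P f = f)
    (k : Lp ℂ p μ) (hk : 1 < p.toReal ∨ ∀ᵐ x ∂μ, f x = 0 → k x = 0) :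
    (∫ x, dualityMap p.toReal (f x) * P k x ∂μ).re ≤
      (∫ x, dualityMap p.toReal (f x) * k x ∂μ).re := by
  have hr := one_le_toReal p hp
  have hr0 : 0 < p.toReal := by linarith
  refine ge_of_tendsto ((Complex.continuous_re.tendsto _).comp
    (tendsto_integral_dualityMap hp (Lp.memLp f) (Lp.memLp k) hk))
    (Eventually.of_forall fun n => ?_)
  set t : ℝ := 1 / ((n : ℝ) + 1)
  have ht : 0 < t := by positivity
  set g : Lp ℂ p μ := f + (t : ℂ) • k
  have hg : ∀ᵐ x ∂μ, g x = f x + t * k x := by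
    filter_upwards [Lp.coeFn_add f ((t : ℂ) • k), Lp.coeFn_smul (t : ℂ) k] with x h1 h2
    rw [h1, Pi.add_apply, h2, Pi.smul_apply, smul_eq_mul]
  have hPg : ∀ᵐ x ∂μ, P g x = f x + t * P k x := by
    have : P g = f + (t : ℂ) • P k := by rw [map_add, map_smul, hf]
    rw [this]
    filter_upwards [Lp.coeFn_add f ((t : ℂ) • P k), Lp.coeFn_smul (t : ℂ) (P k)] with x h1 h2
    rw [h1, Pi.add_apply, h2, Pi.smul_apply, smul_eq_mul]
  have hI1 := integrable_dualityMap_mul hp (Lp.memLp f) (Lp.memLp (P k))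
  have hI2 := integrable_dualityMap_mul hp (Lp.memLp g) (Lp.memLp k)
  have hJ1 := Lp_integrable_norm_rpow hp f
  have h1 : ‖f‖ ^ p.toReal + p.toReal * (t * (∫ x, dualityMap p.toReal (f x) * P k x ∂μ).re) ≤
      ‖P g‖ ^ p.toReal := by
    have hre : (∫ x, dualityMap p.toReal (f x) * P k x ∂μ).re =
      ∫ x, (dualityMap p.toReal (f x) * P k x).re ∂μ := (integral_re hI1).symm
    have hI1r : Integrable (fun x => (dualityMap p.toReal (f x) * P k x).re) μ := hI1.re
    rw [Lp_norm_rpow_eq_integral hp, Lp_norm_rpow_eq_integral hp, hre, ← integral_const_mul,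
      ← integral_const_mul, ← integral_add hJ1 ((hI1r.const_mul _).const_mul _)]
    refine integral_mono_ae (hJ1.add ((hI1r.const_mul _).const_mul _))
      (Lp_integrable_norm_rpow hp _) ?_
    filter_upwards [hPg] with x hx
    have := norm_rpow_add_re_dualityMap_le hr (f x) (P g x)
    rw [hx, add_sub_cancel_left, mul_left_comm, Complex.re_ofReal_mul] at this
    rw [hx]; exact this
  have h2 : ‖g‖ ^ p.toReal - p.toReal * (t * (∫ x, dualityMap p.toReal (g x) * k x ∂μ).re) ≤
      ‖f‖ ^ p.toReal := by
    have hre : (∫ x, dualityMap p.toReal (g x) * k x ∂μ).re =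
      ∫ x, (dualityMap p.toReal (g x) * k x).re ∂μ := (integral_re hI2).symm
    have hI2r : Integrable (fun x => (dualityMap p.toReal (g x) * k x).re) μ := hI2.re
    have hJ2 := Lp_integrable_norm_rpow hp g
    rw [Lp_norm_rpow_eq_integral hp, Lp_norm_rpow_eq_integral hp, hre, ← integral_const_mul,
      ← integral_const_mul, ← integral_sub hJ2 ((hI2r.const_mul _).const_mul _)]
    refine integral_mono_ae (hJ2.sub ((hI2r.const_mul _).const_mul _)) hJ1 ?_
    filter_upwards [hg] with x hx
    have := norm_rpow_add_re_dualityMap_le hr (g x) (f x)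
    have hd : f x - g x = -(t * k x) := by rw [hx]; ring
    rw [hd, mul_neg, Complex.neg_re, mul_left_comm, Complex.re_ofReal_mul] at this
    change ‖g x‖ ^ p.toReal - p.toReal * (t * (dualityMap p.toReal (g x) * k x).re) ≤ _
    linarith
  have h3 := Real.rpow_le_rpow (norm_nonneg _) (hP g) hr0.le
  have h4 : (∫ x, dualityMap p.toReal (g x) * k x ∂μ) =
      ∫ x, dualityMap p.toReal (f x + t * k x) * k x ∂μ :=
    integral_congr_ae (hg.mono fun x hx => by beta_reduce; rw [hx])
  rw [h4] at h2
  have h5 : p.toReal * t * (∫ x, dualityMap p.toReal (f x) * P k x ∂μ).re ≤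
      p.toReal * t * (∫ x, dualityMap p.toReal (f x + t * k x) * k x ∂μ).re := by linarith
  exact le_of_mul_le_mul_left h5 (by positivity)

/-- The dual vector of a fixed vector is fixed by the adjoint of the contraction. -/
theorem integral_dualityMap_mul_apply (hp : p ≠ ∞) {f : Lp ℂ p μ} (hf : P f = f)
    (k : Lp ℂ p μ) (hk : 1 < p.toReal ∨ ∀ᵐ x ∂μ, f x = 0 → k x = 0) :
    ∫ x, dualityMap p.toReal (f x) * P k x ∂μ = ∫ x, dualityMap p.toReal (f x) * k x ∂μ := by
  have hsm : ∀ (c : ℂ) (g : Lp ℂ p μ), ∫ x, dualityMap p.toReal (f x) * (c • g) x ∂μ =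
      c * ∫ x, dualityMap p.toReal (f x) * g x ∂μ := fun c g => by
    rw [← integral_const_mul]
    refine integral_congr_ae ?_
    filter_upwards [Lp.coeFn_smul c g] with x hx
    rw [hx, Pi.smul_apply, smul_eq_mul, mul_left_comm]
  have key : ∀ c : ℂ, (c * ∫ x, dualityMap p.toReal (f x) * P k x ∂μ).re ≤
      (c * ∫ x, dualityMap p.toReal (f x) * k x ∂μ).re := fun c => by
    have := re_integral_dualityMap_mul_apply_le hP hp hf (c • k) <| hk.imp_right fun h => by
      filter_upwards [h, Lp.coeFn_smul c k] with x hx h2 h0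
      rw [h2, Pi.smul_apply, hx h0, smul_zero]
    rwa [map_smul, hsm, hsm] at this
  have h1 := key 1
  have h2 := key (-1)
  have h3 := key Complex.I
  have h4 := key (-Complex.I)
  simp only [one_mul, neg_mul, Complex.neg_re, Complex.I_mul_re, neg_neg] at h1 h2 h3 h4
  exact Complex.ext (by linarith) (by linarith)

/-- The converse of `integral_dualityMap_mul_apply`, by strict convexity. -/
theorem apply_eq_self_of_integral_dualityMap (hp : p ≠ ∞) (hp1 : 1 < p.toReal) {f : Lp ℂ p μ}
    (h : ∫ x, dualityMap p.toReal (f x) * P f x ∂μ = ∫ x, dualityMap p.toReal (f x) * f x ∂μ) :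
    P f = f := by
  have hI1 := integrable_dualityMap_mul hp (Lp.memLp f) (Lp.memLp (P f))
  have hI2 := integrable_dualityMap_mul hp (Lp.memLp f) (Lp.memLp f)
  have hI : Integrable (fun x => dualityMap p.toReal (f x) * (P f x - f x)) μ := by
    simpa only [mul_sub] using! hI1.sub hI2
  have h0 : ∫ x, dualityMap p.toReal (f x) * (P f x - f x) ∂μ = 0 := by
    simp only [mul_sub]
    rw [integral_sub hI1 hI2, h, sub_self]
  have h0' : ∫ x, (dualityMap p.toReal (f x) * (P f x - f x)).re ∂μ = 0 := by
    have : ∫ x, (dualityMap p.toReal (f x) * (P f x - f x)).re ∂μ = _ := integral_re hI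
    rw [this, h0]; rfl
  have hJ1 := Lp_integrable_norm_rpow hp f
  have hJ2 := Lp_integrable_norm_rpow hp (P f)
  set D : X → ℝ := fun x => ‖P f x‖ ^ p.toReal -
    (‖f x‖ ^ p.toReal + p.toReal * (dualityMap p.toReal (f x) * (P f x - f x)).re)
  have hD : Integrable D μ := hJ2.sub (hJ1.add (hI.re.const_mul _))
  have hDpos : 0 ≤ D := fun x => sub_nonneg.2 (norm_rpow_add_re_dualityMap_le hp1.le _ _)
  have hDint : ∫ x, D x ∂μ ≤ 0 := by
    have : ∫ x, D x ∂μ = ‖P f‖ ^ p.toReal - (‖f‖ ^ p.toReal + p.toReal *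
        ∫ x, (dualityMap p.toReal (f x) * (P f x - f x)).re ∂μ) := by
      rw [Lp_norm_rpow_eq_integral hp, Lp_norm_rpow_eq_integral hp, ← integral_const_mul]
      refine (integral_sub hJ2 (hJ1.add (hI.re.const_mul _))).trans ?_
      congr 1
      exact integral_add hJ1 (hI.re.const_mul _)
    rw [this, h0', mul_zero, add_zero]
    exact sub_nonpos.2 (Real.rpow_le_rpow (norm_nonneg _) (hP f) (by linarith))
  have hD0 := (integral_eq_zero_iff_of_nonneg hDpos hD).1
    (le_antisymm hDint (integral_nonneg hDpos))
  refine Lp.ext ?_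
  filter_upwards [hD0] with x hx
  exact eq_of_norm_rpow_le hp1 (sub_eq_zero.1 hx).le

end Contraction

/-! ### Fixed spaces of contractions of `L^1` -/

section FixedSpace

open ComplexConjugate Filter Topology

variable {X : Type u} [mX : MeasurableSpace X] {μ : Measure X}

/-- The space of fixed vectors of an operator. -/
def fixedSubmodule {p : ℝ≥0∞} [Fact (1 ≤ p)] (P : Lp ℂ p μ →L[ℂ] Lp ℂ p μ) :
    Submodule ℂ (Lp ℂ p μ) :=
  LinearMap.eqLocus (P : Lp ℂ p μ →ₗ[ℂ] Lp ℂ p μ) LinearMap.id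

theorem mem_fixedSubmodule {p : ℝ≥0∞} [Fact (1 ≤ p)] {P : Lp ℂ p μ →L[ℂ] Lp ℂ p μ}
    {f : Lp ℂ p μ} : f ∈ fixedSubmodule P ↔ P f = f := Iff.rfl

theorem isClosed_fixedSubmodule {p : ℝ≥0∞} [Fact (1 ≤ p)] (P : Lp ℂ p μ →L[ℂ] Lp ℂ p μ) :
    IsClosed (fixedSubmodule P : Set (Lp ℂ p μ)) :=
  isClosed_eq P.continuous continuous_id

theorem memLp_mul_of_norm_le {p : ℝ≥0∞} (f h : Lp ℂ p μ) {v : X → ℂ} (hv : Measurable v)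
    (hle : ∀ x, ‖v x‖ ≤ ‖h x / f x‖) : MemLp (fun x => f x * v x) p μ := by
  refine (Lp.memLp h).of_le ((Lp.memLp f).1.mul hv.aestronglyMeasurable)
    (Eventually.of_forall fun x => ?_)
  by_cases h0 : f x = 0
  · simp [h0]
  · rw [norm_mul]
    have := hle x
    rwa [norm_div, le_div_iff₀' (norm_pos_iff.2 h0)] at this

theorem measurable_coeFn_div {p : ℝ≥0∞} (f h : Lp ℂ p μ) : Measurable fun x => h x / f x :=
  (Lp.stronglyMeasurable h).measurable.div (Lp.stronglyMeasurable f).measurable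

/-- The equality case of `re_dualityMap_mul_le` for exponent one: `b` is a nonnegative multiple of
`a`. -/
theorem eq_mul_norm_div_of_norm_eq {a b : ℂ} (h : (dualityMap 1 a * b).re = ‖b‖) :
    b = a * (‖b / a‖ : ℝ) := by
  by_cases ha : a = 0
  · subst ha
    rw [dualityMap_zero, zero_mul, Complex.zero_re] at h
    simp [norm_eq_zero.1 h.symm]
  · have ha' : 0 < ‖a‖ := norm_pos_iff.2 ha
    have h1 : dualityMap 1 a * b = (‖a‖ : ℝ) * (b / a) := by
      have h2 := dualityMap_mul_self one_ne_zero a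
      rw [Real.rpow_one] at h2
      rw [← h2]
      field_simp
    rw [h1, Complex.re_ofReal_mul, ← div_mul_cancel₀ b ha, norm_mul, div_mul_cancel₀ b ha,
      mul_comm] at h
    have h2 := Complex.re_eq_norm.1 (mul_right_cancel₀ ha'.ne' h)
    rw [← Complex.eq_coe_norm_of_nonneg h2, mul_div_cancel₀ _ ha]

section L1

variable {P : Lp ℂ 1 μ →L[ℂ] Lp ℂ 1 μ} (hP : ∀ f, ‖P f‖ ≤ ‖f‖) {f : Lp ℂ 1 μ} (hf : P f = f)
include hP

theorem integral_norm_apply_le (f : Lp ℂ 1 μ) : ∫ x, ‖P f x‖ ∂μ ≤ ∫ x, ‖f x‖ ∂μ := by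
  have := hP f
  rwa [L1.norm_eq_integral_norm, L1.norm_eq_integral_norm] at this

include hf

/-- A contraction of `L^1` fixing `f` maps the cone of nonnegative multiples of `f` to itself. -/
theorem apply_eq_mul_norm_div {u : Lp ℂ 1 μ} {v : X → ℝ} (hv : ∀ x, 0 ≤ v x)
    (hu : ∀ᵐ x ∂μ, u x = f x * v x) : ∀ᵐ x ∂μ, P u x = f x * (‖P u x / f x‖ : ℝ) := by
  have h1 := integral_dualityMap_mul_apply hP ENNReal.one_ne_top hf u <| Or.inr <| by
    filter_upwards [hu] with x hx h0
    rw [hx, h0, zero_mul]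
  have hI := integrable_dualityMap_mul ENNReal.one_ne_top (Lp.memLp f) (Lp.memLp (P u))
  rw [ENNReal.toReal_one] at h1 hI
  have hIr : Integrable (fun x => (dualityMap 1 (f x) * P u x).re) μ := hI.re
  have hle : ∀ x, (dualityMap 1 (f x) * P u x).re ≤ ‖P u x‖ := fun x => by
    refine (re_dualityMap_mul_le 1 _ _).trans ?_
    simp
  have hint : ∫ x, (dualityMap 1 (f x) * P u x).re ∂μ = ∫ x, ‖u x‖ ∂μ := by
    have h2 : ∫ x, (dualityMap 1 (f x) * P u x).re ∂μ = _ := integral_re hI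
    rw [h2, h1]
    have h3 : ∫ x, dualityMap 1 (f x) * u x ∂μ = ∫ x, ((‖u x‖ : ℝ) : ℂ) ∂μ := by
      refine integral_congr_ae ?_
      filter_upwards [hu] with x hx
      rw [hx, ← mul_assoc, dualityMap_mul_self one_ne_zero, Real.rpow_one, norm_mul,
        Complex.norm_real, Real.norm_of_nonneg (hv x), Complex.ofReal_mul]
    rw [h3, integral_complex_ofReal]
    rfl
  have heq := (integral_eq_iff_of_ae_le hIr (L1.integrable_coeFn (P u)).norm
    (Eventually.of_forall hle)).1 (le_antisymm
      (integral_mono hIr (L1.integrable_coeFn (P u)).norm hle)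
      (hint ▸ integral_norm_apply_le hP u))
  filter_upwards [heq] with x hx
  exact eq_mul_norm_div_of_norm_eq hx

/-- A contraction of `L^1` fixing `f` maps real multiples `f v` of `f` to real multiples of `f`, and
the image of `f |v|` dominates that of `f v`. -/
theorem exists_apply_eq_mul {v : X → ℝ} (hv : Measurable v)
    (h : Lp ℂ 1 μ) (hle : ∀ x, ‖v x‖ ≤ ‖h x / f x‖) :
    ∃ (u a : Lp ℂ 1 μ) (z y : X → ℝ), (∀ᵐ x ∂μ, u x = f x * v x) ∧ (∀ᵐ x ∂μ, a x = f x * |v x|) ∧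
      (∀ x, |z x| ≤ y x) ∧ (∀ᵐ x ∂μ, P u x = f x * z x) ∧ ∀ᵐ x ∂μ, P a x = f x * y x := by
  have hmem : ∀ w : X → ℝ, Measurable w → (∀ x, |w x| ≤ |v x|) →
      MemLp (fun x => f x * ((w x : ℝ) : ℂ)) 1 μ := fun w hw hwv =>
    memLp_mul_of_norm_le f h (Complex.measurable_ofReal.comp hw) fun x => by
      rw [Complex.norm_real]; exact (hwv x).trans (hle x)
  have h1 := hmem (fun x => max (v x) 0) (hv.max measurable_const) fun x => by
    rw [abs_of_nonneg (le_max_right _ _)]; exact max_le (le_abs_self _) (abs_nonneg _)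
  have h2 := hmem (fun x => max (-v x) 0) (hv.neg.max measurable_const) fun x => by
    rw [abs_of_nonneg (le_max_right _ _)]; exact max_le (neg_le_abs _) (abs_nonneg _)
  have hP1 := apply_eq_mul_norm_div hP hf (fun x => le_max_right (v x) 0) h1.coeFn_toLp
  have hP2 := apply_eq_mul_norm_div hP hf (fun x => le_max_right (-v x) 0) h2.coeFn_toLp
  refine ⟨h1.toLp - h2.toLp, h1.toLp + h2.toLp,
    fun x => ‖P h1.toLp x / f x‖ - ‖P h2.toLp x / f x‖,
    fun x => ‖P h1.toLp x / f x‖ + ‖P h2.toLp x / f x‖, ?_, ?_, fun x => ?_, ?_, ?_⟩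
  · filter_upwards [Lp.coeFn_sub h1.toLp h2.toLp, h1.coeFn_toLp, h2.coeFn_toLp] with x e e1 e2
    rw [e, Pi.sub_apply, e1, e2, ← mul_sub, ← Complex.ofReal_sub,
      max_zero_sub_max_neg_zero_eq_self]
  · filter_upwards [Lp.coeFn_add h1.toLp h2.toLp, h1.coeFn_toLp, h2.coeFn_toLp] with x e e1 e2
    rw [e, Pi.add_apply, e1, e2, ← mul_add, ← Complex.ofReal_add,
      max_zero_add_max_neg_zero_eq_abs_self]
  · refine (abs_sub _ _).trans (le_of_eq ?_)
    rw [abs_norm, abs_norm]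
  · rw [map_sub]
    filter_upwards [Lp.coeFn_sub (P h1.toLp) (P h2.toLp), hP1, hP2] with x e e1 e2
    rw [e, Pi.sub_apply, Complex.ofReal_sub, mul_sub, ← e1, ← e2]
  · rw [map_add]
    filter_upwards [Lp.coeFn_add (P h1.toLp) (P h2.toLp), hP1, hP2] with x e e1 e2
    rw [e, Pi.add_apply, Complex.ofReal_add, mul_add, ← e1, ← e2]

end L1

/-- Conjugates are obtained from the fact that real and imaginary parts are mapped to real
multiples. For supports and absolute values, norms are compared: a vector that is dominated in
modulus by its image under the contraction has the same modulus as its image. -/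
theorem isPhasedSublattice_fixedSubmodule_one {P : Lp ℂ 1 μ →L[ℂ] Lp ℂ 1 μ}
    (hP : ∀ f, ‖P f‖ ≤ ‖f‖) : IsPhasedSublattice (fixedSubmodule P) := by
  have hsplit : ∀ f ∈ fixedSubmodule P, ∀ h : Lp ℂ 1 μ, ∃ u₁ u₂ : Lp ℂ 1 μ, ∃ z₁ z₂ : X → ℝ,
      (∀ᵐ x ∂μ, u₁ x = f x * (h x / f x).re) ∧ (∀ᵐ x ∂μ, u₂ x = f x * (h x / f x).im) ∧
      (∀ᵐ x ∂μ, P u₁ x = f x * z₁ x) ∧ (∀ᵐ x ∂μ, P u₂ x = f x * z₂ x) := fun f hf h => by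
    obtain ⟨u₁, -, z₁, -, h1, -, -, h2, -⟩ := exists_apply_eq_mul hP hf
      (Complex.measurable_re.comp (measurable_coeFn_div f h)) h fun x => Complex.abs_re_le_norm _
    obtain ⟨u₂, -, z₂, -, h3, -, -, h4, -⟩ := exists_apply_eq_mul hP hf
      (Complex.measurable_im.comp (measurable_coeFn_div f h)) h fun x => Complex.abs_im_le_norm _
    exact ⟨u₁, u₂, z₁, z₂, h1, h3, h2, h4⟩
  have hcomb : ∀ u₁ u₂ : Lp ℂ 1 μ, ∀ᵐ x ∂μ, (u₁ + Complex.I • u₂) x = u₁ x + u₂ x * Complex.I :=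
    fun u₁ u₂ => by
      filter_upwards [Lp.coeFn_add u₁ (Complex.I • u₂), Lp.coeFn_smul Complex.I u₂] with x e1 e2
      rw [e1, Pi.add_apply, e2, Pi.smul_apply, smul_eq_mul, mul_comm]
  have hsupp : ∀ f ∈ fixedSubmodule P, ∀ h ∈ fixedSubmodule P,
      Represents (fixedSubmodule P) fun x => f x * (h x / f x) := fun f hf h hh => by
    obtain ⟨u₁, u₂, z₁, z₂, h1, h2, h3, h4⟩ := hsplit f hf h
    set g := u₁ + Complex.I • u₂
    have hg : ∀ᵐ x ∂μ, g x = f x * (h x / f x) := by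
      filter_upwards [hcomb u₁ u₂, h1, h2] with x e e1 e2
      rw [e, e1, e2, mul_assoc, ← mul_add, Complex.re_add_im]
    have hPg : ∀ᵐ x ∂μ, f x = 0 → P g x = 0 := by
      have : P g = P u₁ + Complex.I • P u₂ := by rw [map_add, map_smul]
      rw [this]
      filter_upwards [hcomb (P u₁) (P u₂), h3, h4] with x e e1 e2 h0
      rw [e, e1, e2, h0, zero_mul, zero_mul, zero_mul, add_zero]
    -- `k = h - g` lives where `f` vanishes, and `P k` agrees with it there.
    have hk : ∀ᵐ x ∂μ, f x ≠ 0 → (h - g) x = 0 := by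
      filter_upwards [Lp.coeFn_sub h g, hg] with x e e1 h0
      rw [e, Pi.sub_apply, e1, mul_div_cancel₀ _ h0, sub_self]
    have hPk : ∀ᵐ x ∂μ, f x = 0 → P (h - g) x = (h - g) x := by
      have : P (h - g) = h - P g := by rw [map_sub, mem_fixedSubmodule.1 hh]
      rw [this]
      filter_upwards [Lp.coeFn_sub h g, Lp.coeFn_sub h (P g), hg, hPg] with x e e' e1 e2 h0
      rw [e, e', Pi.sub_apply, Pi.sub_apply, e2 h0, e1, h0, zero_mul]
    have hle : (fun x => ‖(h - g) x‖) ≤ᵐ[μ] fun x => ‖P (h - g) x‖ := by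
      filter_upwards [hk, hPk] with x e1 e2
      by_cases h0 : f x = 0
      · rw [e2 h0]
      · rw [e1 h0, norm_zero]; exact norm_nonneg _
    have hi := (L1.integrable_coeFn (h - g)).norm
    have hi' := (L1.integrable_coeFn (P (h - g))).norm
    have heq := (integral_eq_iff_of_ae_le hi hi' hle).1
      (le_antisymm (integral_mono_ae hi hi' hle) (integral_norm_apply_le hP _))
    have hfix : P (h - g) = h - g := by
      refine Lp.ext ?_
      filter_upwards [hk, hPk, heq] with x e1 e2 e3
      by_cases h0 : f x = 0
      · exact e2 h0
      · rw [e1 h0, norm_zero] at e3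
        rw [e1 h0, norm_eq_zero.1 e3.symm]
    refine ⟨g, ?_, hg⟩
    have := (fixedSubmodule P).sub_mem hh (mem_fixedSubmodule.2 hfix)
    rwa [sub_sub_cancel] at this
  refine ⟨isClosed_fixedSubmodule P, hsupp, fun f hf h hh => ?_, fun f hf h hh him => ?_⟩
  · obtain ⟨u₁, u₂, z₁, z₂, h1, h2, h3, h4⟩ := hsplit f hf h
    obtain ⟨g, hgE, hg⟩ := hsupp f hf h hh
    have hgu : g = u₁ + Complex.I • u₂ := by
      refine Lp.ext ?_
      filter_upwards [hg, hcomb u₁ u₂, h1, h2] with x e' e e1 e2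
      rw [e', e, e1, e2, mul_assoc, ← mul_add, Complex.re_add_im]
    have hPgu : g = P u₁ + Complex.I • P u₂ := by
      rw [← map_smul, ← map_add, ← hgu, mem_fixedSubmodule.1 hgE]
    have hz : ∀ᵐ x ∂μ, f x ≠ 0 → z₁ x = (h x / f x).re ∧ z₂ x = (h x / f x).im := by
      have : ∀ᵐ x ∂μ, g x = P u₁ x + P u₂ x * Complex.I := hPgu ▸ hcomb (P u₁) (P u₂)
      filter_upwards [hg, this, h3, h4] with x e' e e1 e2 h0
      rw [e', e1, e2, mul_assoc, ← mul_add] at e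
      rw [mul_left_cancel₀ h0 e]
      simp
    have hE1 : P u₁ = u₁ := by
      refine Lp.ext ?_
      filter_upwards [hz, h1, h3] with x e e1 e3
      by_cases h0 : f x = 0
      · rw [e1, e3, h0, zero_mul, zero_mul]
      · rw [e1, e3, (e h0).1]
    have hE2 : P u₂ = u₂ := by
      refine Lp.ext ?_
      filter_upwards [hz, h2, h4] with x e e1 e3
      by_cases h0 : f x = 0
      · rw [e1, e3, h0, zero_mul, zero_mul]
      · rw [e1, e3, (e h0).2]
    refine (((Represents.coe (mem_fixedSubmodule.2 hE1)).sub
      ((Represents.coe (mem_fixedSubmodule.2 hE2)).const_mul Complex.I))).congr ?_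
    filter_upwards [h1, h2] with x e1 e2
    rw [e1, e2]
    conv_rhs => rw [← Complex.re_add_im (h x / f x)]
    simp only [map_add, map_mul, Complex.conj_ofReal, Complex.conj_I]
    ring
  · obtain ⟨u, a, z, y, h1, h2, hzy, h3, h4⟩ := exists_apply_eq_mul hP hf
      (Complex.measurable_re.comp (measurable_coeFn_div f h)) h fun x => Complex.abs_re_le_norm _
    have hre : ∀ᵐ x ∂μ, ((h x / f x).re : ℂ) = h x / f x := by
      filter_upwards [him] with x hx
      exact Complex.ext rfl hx.symm
    obtain ⟨g, hgE, hg⟩ := hsupp f hf h hh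
    have hgu : g = u := by
      refine Lp.ext ?_
      filter_upwards [hg, h1, hre] with x e e1 e2
      rw [e, e1, Function.comp_apply, e2]
    subst hgu
    have hz : ∀ᵐ x ∂μ, f x ≠ 0 → z x = (h x / f x).re := by
      rw [mem_fixedSubmodule.1 hgE] at h3
      filter_upwards [h1, h3] with x e1 e3 h0
      rw [e1] at e3
      exact (Complex.ofReal_injective (mul_left_cancel₀ h0 e3)).symm
    have hle : (fun x => ‖a x‖) ≤ᵐ[μ] fun x => ‖P a x‖ := by
      filter_upwards [h2, h4, hz] with x e2 e4 e
      rw [e2, e4, norm_mul, norm_mul]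
      by_cases h0 : f x = 0
      · simp [h0]
      · refine mul_le_mul_of_nonneg_left ?_ (norm_nonneg _)
        rw [Complex.norm_real, Complex.norm_real, Function.comp_apply, ← e h0]
        rw [Real.norm_eq_abs, abs_abs]
        exact (hzy x).trans (le_abs_self _)
    have hi := (L1.integrable_coeFn a).norm
    have hi' := (L1.integrable_coeFn (P a)).norm
    have heq := (integral_eq_iff_of_ae_le hi hi' hle).1
      (le_antisymm (integral_mono_ae hi hi' hle) (integral_norm_apply_le hP _))
    refine ⟨a, ?_, ?_⟩
    · refine mem_fixedSubmodule.2 (Lp.ext ?_)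
      filter_upwards [h2, h4, heq] with x e2 e4 e
      by_cases h0 : f x = 0
      · rw [e2, e4, h0, zero_mul, zero_mul]
      · rw [e2, e4, norm_mul, norm_mul] at e
        have := mul_left_cancel₀ (norm_ne_zero_iff.2 h0) e
        rw [Complex.norm_real, Complex.norm_real, Real.norm_eq_abs, abs_abs,
          Real.norm_of_nonneg ((abs_nonneg _).trans (hzy x))] at this
        rw [e2, e4, this]
    · filter_upwards [h2, hre] with x e2 e
      rw [e2, ← e, Complex.norm_real, Function.comp_apply, Real.norm_eq_abs]

end FixedSpace

/-! ### Subspaces closed under taking phases -/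

section Phase

open ComplexConjugate Filter Topology

/-- The phase `z / |z|` of a complex number, with the value `0` at `0`. -/
def phase (z : ℂ) : ℂ := z / (‖z‖ : ℝ)

theorem phase_zero : phase 0 = 0 := by simp [phase]

theorem phase_one : phase 1 = 1 := by simp [phase]

theorem norm_mul_phase (z : ℂ) : (‖z‖ : ℝ) * phase z = z := by
  by_cases h : z = 0
  · simp [h]
  · have : ((‖z‖ : ℝ) : ℂ) ≠ 0 := by simpa using h
    rw [phase, mul_div_cancel₀ _ this]

theorem phase_mul (a b : ℂ) : phase (a * b) = phase a * phase b := by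
  rw [phase, phase, phase, norm_mul, Complex.ofReal_mul, mul_div_mul_comm]

theorem phase_div (a b : ℂ) : phase (a / b) = phase a / phase b := by
  rw [phase, phase, phase, norm_div, Complex.ofReal_div, div_div_div_comm]

theorem phase_ne_zero {a : ℂ} (h : a ≠ 0) : phase a ≠ 0 := by
  simpa [phase] using h

theorem norm_phase {a : ℂ} (h : a ≠ 0) : ‖phase a‖ = 1 := by
  simp [phase, h]

theorem conj_phase (a : ℂ) : conj (phase a) = phase (conj a) := by
  simp [phase]

theorem phase_ofReal_of_pos {x : ℝ} (hx : 0 < x) : phase x = 1 := by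
  have : (x : ℂ) ≠ 0 := by exact_mod_cast hx.ne'
  rw [phase, Complex.norm_real, Real.norm_of_nonneg hx.le, div_self this]

theorem phase_phase (a : ℂ) : phase (phase a) = phase a := by
  by_cases h : a = 0
  · simp [h, phase_zero]
  · rw [phase, norm_phase h, Complex.ofReal_one, div_one]

theorem phase_dualityMap (r : ℝ) (a : ℂ) : phase (dualityMap r a) = conj (phase a) := by
  by_cases h : a = 0
  · simp [h, dualityMap_zero, phase_zero]
  · rw [dualityMap, phase_mul, phase_ofReal_of_pos (Real.rpow_pos_of_pos (norm_pos_iff.2 h) _),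
      one_mul, conj_phase]

variable {X : Type u} [mX : MeasurableSpace X] {μ : Measure X} {p : ℝ≥0∞} [Fact (1 ≤ p)]

/-- With `sgn` for the phase and `a = h sgn(f / h)`, one has `f |h / f| = a` and
`f (h / f) = a sgn(h / a)`; for `b` the product of `f` with the conjugate of `sgn(h / f)`, the
product of `f` with the conjugate of `h / f` is `h sgn(b / h)`. -/
theorem isPhasedSublattice_of_phase {E : Submodule ℂ (Lp ℂ p μ)}
    (hE : IsClosed (E : Set (Lp ℂ p μ)))
    (h1 : ∀ f h : X → ℂ, Represents E f → Represents E h →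
      Represents E fun x => f x * phase (h x / f x))
    (h2 : ∀ f h : X → ℂ, Represents E f → Represents E h →
      Represents E fun x => f x * conj (phase (h x / f x))) : IsPhasedSublattice E := by
  refine ⟨hE, fun f hf h hh => ?_, fun f hf h hh => ?_, fun f hf h hh _ => ?_⟩
  · refine (h1 _ _ (h1 _ _ (.coe hh) (.coe hf)) (.coe hh)).congr (Eventually.of_forall fun x => ?_)
    by_cases hf0 : f x = 0
    · simp [hf0, phase_zero]
    by_cases hh0 : h x = 0
    · simp [hh0]
    have hp := phase_ne_zero (div_ne_zero hf0 hh0)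
    have e : h x / (h x * phase (f x / h x)) = 1 / phase (f x / h x) := by field_simp
    beta_reduce
    rw [e, phase_div 1, phase_phase, mul_assoc, mul_div_cancel₀ _ hp, phase_one, mul_one,
      mul_div_cancel₀ _ hf0]
  · refine (h1 _ _ (.coe hh) (h2 _ _ (.coe hf) (.coe hh))).congr (Eventually.of_forall fun x => ?_)
    by_cases hf0 : f x = 0
    · simp [hf0, phase_zero]
    by_cases hh0 : h x = 0
    · simp [hh0]
    have hw := div_ne_zero hh0 hf0
    have e : f x * conj (phase (h x / f x)) / h x = conj (phase (h x / f x)) / (h x / f x) := by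
      field_simp
    beta_reduce
    rw [e]
    have hh' : h x = f x * (h x / f x) := (mul_div_cancel₀ _ hf0).symm
    generalize h x / f x = w at *
    rw [hh', phase_div, conj_phase, phase_phase, ← conj_phase, mul_assoc]
    congr 1
    nth_rw 1 4 [← norm_mul_phase w]
    rw [map_mul, Complex.conj_ofReal, mul_assoc, mul_div_cancel₀ _ (phase_ne_zero hw)]
  · refine (h1 _ _ (.coe hh) (.coe hf)).congr (Eventually.of_forall fun x => ?_)
    by_cases hf0 : f x = 0
    · simp [hf0, phase_zero]
    by_cases hh0 : h x = 0
    · simp [hh0]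
    have : ((‖h x‖ : ℝ) : ℂ) ≠ 0 := by simpa using hh0
    have : ((‖f x‖ : ℝ) : ℂ) ≠ 0 := by simpa using hf0
    simp only [phase, norm_div, Complex.ofReal_div]
    field_simp

end Phase

/-! ### Pairs of subspaces exchanged by the duality maps -/

section DualPair

open ComplexConjugate Filter Topology

theorem dualityMap_conj_rpow_mul (r c : ℝ) (w : ℂ) :
    dualityMap r (conj (((‖w‖ ^ (c - 1) : ℝ) : ℂ) * w)) =
      ((‖w‖ ^ (c * (r - 1) - 1) : ℝ) : ℂ) * w := by
  by_cases h : w = 0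
  · simp [h, dualityMap_zero]
  have hw : 0 < ‖w‖ := norm_pos_iff.2 h
  rw [dualityMap, Complex.conj_conj, RCLike.norm_conj, ← mul_assoc, ← Complex.ofReal_mul, norm_mul,
    Complex.norm_real, Real.norm_of_nonneg (by positivity), ← Real.rpow_add_one hw.ne',
    ← Real.rpow_mul hw.le, ← Real.rpow_add hw]
  congr 3; ring

theorem tendsto_rpow_sub_one_mul_phase {ρ : ℝ} (h0 : 0 ≤ ρ) (h1 : ρ < 1) (w : ℂ) :
    Tendsto (fun n : ℕ => ((‖w‖ ^ (ρ ^ n - 1) : ℝ) : ℂ) * w) atTop (𝓝 (phase w)) := by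
  by_cases h : w = 0
  · simp [h, phase_zero]
  have hw : ‖w‖ ≠ 0 := norm_ne_zero_iff.2 h
  have h2 : Tendsto (fun n : ℕ => ρ ^ n - 1) atTop (𝓝 (0 - 1)) :=
    (tendsto_pow_atTop_nhds_zero_of_lt_one h0 h1).sub_const 1
  have h3 := ((Real.continuous_const_rpow hw).tendsto _).comp h2
  have h4 := ((Complex.continuous_ofReal.tendsto _).comp h3).mul_const w
  have h5 : ((‖w‖ ^ ((0 : ℝ) - 1) : ℝ) : ℂ) * w = phase w := by
    rw [zero_sub, Real.rpow_neg_one, phase, Complex.ofReal_inv, mul_comm, div_eq_mul_inv]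
  rwa [h5] at h4

theorem norm_rpow_sub_one_mul_le {c : ℝ} (hc : 0 < c) (hc1 : c ≤ 1) (w : ℂ) :
    ‖((‖w‖ ^ (c - 1) : ℝ) : ℂ) * w‖ ≤ 1 + ‖w‖ := by
  by_cases h : w = 0
  · simp [h]
  have hw : 0 < ‖w‖ := norm_pos_iff.2 h
  rw [norm_mul, Complex.norm_real, Real.norm_of_nonneg (by positivity),
    ← Real.rpow_add_one hw.ne', sub_add_cancel]
  rcases le_total ‖w‖ 1 with h1 | h1
  · exact (Real.rpow_le_one hw.le h1 hc.le).trans (by linarith)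
  · refine (Real.rpow_le_rpow_of_exponent_le h1 hc1).trans ?_
    rw [Real.rpow_one]; linarith

variable {X : Type u} [mX : MeasurableSpace X] {μ : Measure X} {p q : ℝ≥0∞} [Fact (1 ≤ p)]
  [Fact (1 ≤ q)]

theorem memLp_norm_rpow_sub_one (hp : p ≠ ∞) (hq : q ≠ ∞)
    (hpq : (p.toReal - 1) * (q.toReal - 1) = 1) {F : Type*} [NormedAddCommGroup F] {f : X → F}
    (hf : MemLp f p μ) : MemLp (fun x => ‖f x‖ ^ (p.toReal - 1)) q μ := by
  refine (integrable_norm_rpow_iff ((hf.1.norm.aemeasurable.pow_const _).aestronglyMeasurable)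
    (zero_lt_one.trans_le (Fact.out : 1 ≤ q)).ne' hq).1 ?_
  refine (MemLp.integrable_norm_rpow_toReal hp hf).congr (Eventually.of_forall fun x => ?_)
  beta_reduce
  rw [Real.norm_of_nonneg (by positivity), ← Real.rpow_mul (norm_nonneg _)]
  congr 1
  linarith

theorem memLp_dualityMap (hp : p ≠ ∞) (hq : q ≠ ∞) (hpq : (p.toReal - 1) * (q.toReal - 1) = 1)
    {f : X → ℂ} (hf : MemLp f p μ) : MemLp (fun x => dualityMap p.toReal (f x)) q μ :=
  (memLp_norm_rpow_sub_one hp hq hpq hf).of_le (aestronglyMeasurable_dualityMap _ hf.1)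
    (Eventually.of_forall fun _ => (norm_dualityMap_le _ _).trans (Real.le_norm_self _))

section

variable {E : Submodule ℂ (Lp ℂ p μ)} {N : Submodule ℂ (Lp ℂ q μ)}
  (hp : p ≠ ∞) (hq : q ≠ ∞) (hpq : (p.toReal - 1) * (q.toReal - 1) = 1) (hp2 : 2 < p.toReal)
  (hN : IsClosed (N : Set (Lp ℂ q μ)))
  (hEN : ∀ f, Represents E f → Represents N fun x => dualityMap p.toReal (f x))
include hp hq hpq hp2 hN hEN

/-- The derivative of the duality map at `f` in the direction `h`, as a limit of difference
quotients. These are dominated by `r (|f| + |h|) ^ (r - 1)`, since the duality map is locally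
Lipschitz for `r > 2`; they tend to `0` where `f` vanishes. -/
theorem represents_deriv {f h : X → ℂ} (hf : Represents E f) (hh : Represents E h) :
    Represents N fun x => dualityMap p.toReal (f x) * (((p.toReal / 2 : ℝ) : ℂ) *
      conj (h x / f x) + ((p.toReal / 2 - 1 : ℝ) : ℂ) * (h x / f x)) := by
  set r := p.toReal
  let t : ℕ → ℝ := fun n => 1 / ((n : ℝ) + 1)
  have ht : ∀ n, 0 < t n := fun n => by positivity
  have ht1 : ∀ n, t n ≤ 1 := fun n => by
    simp only [t]
    rw [div_le_one (by positivity)]; linarith [n.cast_nonneg (α := ℝ)]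
  have ht0 : Tendsto t atTop (𝓝[≠] 0) := tendsto_nhdsWithin_iff.2
    ⟨tendsto_one_div_add_atTop_nhds_zero_nat, Eventually.of_forall fun n => (ht n).ne'⟩
  refine Represents.of_tendsto hq hN
    (F := fun n x => ((t n)⁻¹ : ℝ) * (dualityMap r (f x + t n * h x) - dualityMap r (f x)))
    (g := fun x => r * ‖‖f x‖ + ‖h x‖‖ ^ (r - 1)) (fun n => ?_) ?_
    (fun n => Eventually.of_forall fun x => ?_) (Eventually.of_forall fun x => ?_)
  · exact ((hEN _ (hf.add (hh.const_mul _))).sub (hEN _ hf)).const_mul _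
  · exact (memLp_norm_rpow_sub_one hp hq hpq (hf.memLp.norm.add hh.memLp.norm)).const_mul r
  · have hM : (0 : ℝ) ≤ ‖f x‖ + ‖h x‖ := by positivity
    have hth : ‖(t n : ℂ) * h x‖ ≤ t n * ‖h x‖ := by
      rw [norm_mul, Complex.norm_real, Real.norm_of_nonneg (ht n).le]
    have hth' : t n * ‖h x‖ ≤ ‖h x‖ := mul_le_of_le_one_left (norm_nonneg _) (ht1 n)
    have := norm_dualityMap_sub_le hp2 (x := f x + t n * h x) (y := f x) (M := ‖f x‖ + ‖h x‖)
      ((norm_add_le _ _).trans (by linarith)) (by linarith [norm_nonneg (h x)])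
    rw [add_sub_cancel_left] at this
    rw [norm_mul, Complex.norm_real, Real.norm_of_nonneg (inv_pos.2 (ht n)).le,
      inv_mul_le_iff₀ (ht n), Real.norm_of_nonneg hM]
    refine this.trans ?_
    have e1 : (‖f x‖ + ‖h x‖) ^ (r - 1) = (‖f x‖ + ‖h x‖) ^ (r - 2) * (‖f x‖ + ‖h x‖) := by
      rw [show r - 1 = r - 2 + 1 by ring]
      exact Real.rpow_add_one' hM (by linarith)
    rw [e1]
    have e2 : ‖(t n : ℂ) * h x‖ ≤ t n * (‖f x‖ + ‖h x‖) :=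
      hth.trans (mul_le_mul_of_nonneg_left (by linarith [norm_nonneg (f x)]) (ht n).le)
    calc r * ((‖f x‖ + ‖h x‖) ^ (r - 2) * ‖(t n : ℂ) * h x‖)
        ≤ r * ((‖f x‖ + ‖h x‖) ^ (r - 2) * (t n * (‖f x‖ + ‖h x‖))) := by gcongr
      _ = _ := by ring
  · by_cases h0 : f x = 0
    · simp only [h0, dualityMap_zero, zero_mul, zero_add, sub_zero, dualityMap_mul]
      have e : ∀ n, (((t n)⁻¹ : ℝ) : ℂ) * (dualityMap r (t n) * dualityMap r (h x)) =
          ((t n ^ (r - 2) : ℝ) : ℂ) * dualityMap r (h x) := fun n => by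
        have : (t n : ℂ) ≠ 0 := by exact_mod_cast (ht n).ne'
        rw [dualityMap, Complex.conj_ofReal, Complex.norm_real, Real.norm_of_nonneg (ht n).le]
        push_cast
        field_simp
      simp only [e]
      have h1 : Tendsto (fun n => t n ^ (r - 2)) atTop (𝓝 (0 ^ (r - 2))) :=
        (ht0.mono_right nhdsWithin_le_nhds).rpow_const (Or.inr (by linarith))
      rw [Real.zero_rpow (by linarith)] at h1
      simpa using ((Complex.continuous_ofReal.tendsto _).comp h1).mul_const (dualityMap r (h x))
    · have h1 := ((hasDerivAt_dualityMap_one_add r (h x / f x)).tendsto_slope_zero.comp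
        ht0).const_mul (dualityMap r (f x))
      refine h1.congr fun n => ?_
      have e : f x + t n * h x = f x * (1 + t n * (h x / f x)) := by field_simp
      have e1 : dualityMap r 1 = 1 := by simp [dualityMap]
      rw [e, dualityMap_mul]
      simp only [Function.comp_apply, zero_add, Complex.ofReal_zero, zero_mul, add_zero, e1,
        Complex.real_smul]
      ring

/-- The derivatives in the directions `h` and `i h` are independent combinations of the linear and
the conjugate linear part, because `p ≠ 2`. -/
theorem represents_dualityMap_mul {f h : X → ℂ} (hf : Represents E f) (hh : Represents E h) :
    (Represents N fun x => dualityMap p.toReal (f x) * (h x / f x)) ∧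
      Represents N fun x => dualityMap p.toReal (f x) * conj (h x / f x) := by
  have h1 := represents_deriv hp hq hpq hp2 hN hEN hf hh
  have h2 := (represents_deriv hp hq hpq hp2 hN hEN hf (hh.const_mul Complex.I)).const_mul Complex.I
  have hr : (p.toReal : ℂ) ≠ 0 := by
    have : p.toReal ≠ 0 := by linarith
    exact_mod_cast this
  have hr2 : (p.toReal : ℂ) - 2 ≠ 0 := by
    have : p.toReal - 2 ≠ 0 := by linarith
    exact_mod_cast this
  constructor
  · refine ((h1.sub h2).const_mul (1 / (p.toReal - 2))).congr (Eventually.of_forall fun x => ?_)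
    beta_reduce
    rw [mul_div_assoc, map_mul, Complex.conj_I]
    push_cast
    field_simp
    ring_nf
    simp only [Complex.I_sq]
    ring
  · refine ((h1.add h2).const_mul (1 / p.toReal)).congr (Eventually.of_forall fun x => ?_)
    beta_reduce
    rw [mul_div_assoc, map_mul, Complex.conj_I]
    push_cast
    field_simp
    ring_nf
    simp only [Complex.I_sq]
    ring

variable (hE : IsClosed (E : Set (Lp ℂ p μ)))
  (hNE : ∀ f, Represents N f → Represents E fun x => dualityMap q.toReal (f x))
include hE hNE

omit hE in
theorem represents_mul_dualityMap {f h : X → ℂ} (hf : Represents E f) (hh : Represents E h) :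
    (Represents E fun x => f x * dualityMap q.toReal (h x / f x)) ∧
      Represents E fun x => f x * dualityMap q.toReal (conj (h x / f x)) := by
  obtain ⟨h1, h2⟩ := represents_dualityMap_mul hp hq hpq hp2 hN hEN hf hh
  constructor
  · refine (hNE _ h1).congr (Eventually.of_forall fun x => ?_)
    beta_reduce
    rw [dualityMap_mul, dualityMap_dualityMap hpq]
  · refine (hNE _ h2).congr (Eventually.of_forall fun x => ?_)
    beta_reduce
    rw [dualityMap_mul, dualityMap_dualityMap hpq]

/-- Iteration of `w ↦ |w| ^ (c - 1) w` with `0 < c < 1` converges to the phase of `w`. -/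
theorem represents_mul_phase {f h : X → ℂ} (hf : Represents E f) (hh : Represents E h) :
    Represents E fun x => f x * phase (h x / f x) := by
  set ρ := q.toReal - 1
  have hr : 1 < p.toReal - 1 := by linarith
  have hρ0 : 0 < ρ := pos_of_mul_pos_right (by rw [hpq]; exact one_pos) (zero_lt_one.trans hr).le
  have hρ1 : ρ < 1 := by
    by_contra hcon
    have : (p.toReal - 1) * 1 ≤ (p.toReal - 1) * ρ :=
      mul_le_mul_of_nonneg_left (not_lt.1 hcon) (by linarith)
    linarith
  have hmul : ∀ v : X → ℂ, (Represents E fun x => f x * v x) →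
      Represents E fun x => f x * dualityMap q.toReal (conj (v x)) := fun v hv => by
    refine (represents_mul_dualityMap hp hq hpq hp2 hN hEN hNE hf hv).2.congr
      (Eventually.of_forall fun x => ?_)
    by_cases h0 : f x = 0
    · simp [h0]
    · beta_reduce
      rw [mul_div_cancel_left₀ _ h0]
  -- The first application replaces `h` by a multiple of `f`, even where `f` vanishes.
  have hseq : ∀ n : ℕ, Represents E fun x =>
      f x * (((‖h x / f x‖ ^ (ρ ^ (n + 1) - 1) : ℝ) : ℂ) * (h x / f x)) := fun n => by
    induction n with
    | zero =>
      refine (represents_mul_dualityMap hp hq hpq hp2 hN hEN hNE hf hh).2.congr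
        (Eventually.of_forall fun x => ?_)
      have := dualityMap_conj_rpow_mul q.toReal 1 (h x / f x)
      simp only [sub_self, Real.rpow_zero, Complex.ofReal_one, one_mul] at this
      beta_reduce
      rw [this, zero_add, pow_one]
    | succ n ih =>
      refine (hmul _ ih).congr (Eventually.of_forall fun x => ?_)
      beta_reduce
      rw [dualityMap_conj_rpow_mul, pow_succ ρ (n + 1)]
  refine Represents.of_tendsto hp hE hseq (hf.memLp.norm.add hh.memLp.norm)
    (fun n => Eventually.of_forall fun x => ?_) (Eventually.of_forall fun x => ?_)
  · by_cases h0 : f x = 0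
    · simp [h0]
    · have := norm_rpow_sub_one_mul_le (c := ρ ^ (n + 1)) (by positivity)
        (pow_le_one₀ hρ0.le hρ1.le) (h x / f x)
      rw [norm_mul]
      refine (mul_le_mul_of_nonneg_left this (norm_nonneg _)).trans (le_of_eq ?_)
      rw [mul_add, mul_one, ← norm_mul, mul_div_cancel₀ _ h0]
      rfl
  · exact ((tendsto_rpow_sub_one_mul_phase hρ0.le hρ1 (h x / f x)).comp
      (tendsto_add_atTop_nat 1)).const_mul (f x)

theorem represents_mul_conj_phase {f h : X → ℂ} (hf : Represents E f) (hh : Represents E h) :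
    Represents E fun x => f x * conj (phase (h x / f x)) := by
  refine (represents_mul_phase hp hq hpq hp2 hN hEN hE hNE hf
    (represents_mul_dualityMap hp hq hpq hp2 hN hEN hNE hf hh).1).congr
      (Eventually.of_forall fun x => ?_)
  by_cases h0 : f x = 0
  · simp [h0]
  · beta_reduce
    rw [mul_div_cancel_left₀ _ h0, phase_dualityMap]

theorem isPhasedSublattice_of_two_lt : IsPhasedSublattice E :=
  isPhasedSublattice_of_phase hE
    (fun _ _ hf hh => represents_mul_phase hp hq hpq hp2 hN hEN hE hNE hf hh)
    fun _ _ hf hh => represents_mul_conj_phase hp hq hpq hp2 hN hEN hE hNE hf hh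

/-- The phase operations are transported from `E` to `N` by the duality maps, which are
multiplicative and conjugate phases. -/
theorem isPhasedSublattice_dual_of_two_lt : IsPhasedSublattice N := by
  have hqp : (q.toReal - 1) * (p.toReal - 1) = 1 := by rwa [mul_comm]
  have key : ∀ g k : X → ℂ, ∀ x, dualityMap q.toReal (k x) / dualityMap q.toReal (g x) =
      dualityMap q.toReal (k x / g x) := fun g k x => by
    by_cases h0 : g x = 0
    · simp [h0, dualityMap_zero]
    · rw [div_eq_iff (mt dualityMap_eq_zero_iff.1 h0), ← dualityMap_mul, div_mul_cancel₀ _ h0]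
  have hJ : ∀ w : ℂ, dualityMap p.toReal (phase w) = conj (phase w) := fun w => by
    by_cases h0 : w = 0
    · simp [h0, phase_zero, dualityMap_zero]
    · exact dualityMap_of_norm_eq_one (norm_phase h0)
  refine isPhasedSublattice_of_phase hN (fun g k hg hk => ?_) fun g k hg hk => ?_
  · refine (hEN _ (represents_mul_phase hp hq hpq hp2 hN hEN hE hNE (hNE _ hg) (hNE _ hk))).congr
      (Eventually.of_forall fun x => ?_)
    beta_reduce
    rw [dualityMap_mul, dualityMap_dualityMap hqp, hJ, key, phase_dualityMap, Complex.conj_conj]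
  · refine (hEN _ (represents_mul_conj_phase hp hq hpq hp2 hN hEN hE hNE (hNE _ hg)
      (hNE _ hk))).congr (Eventually.of_forall fun x => ?_)
    beta_reduce
    rw [dualityMap_mul, dualityMap_dualityMap hqp, conj_phase, hJ, ← conj_phase, Complex.conj_conj,
      key, phase_dualityMap]

end

/-- The fixed space of a contractive operator on `L^p`, `1 < p < ∞`, and the fixed space `N` of its
adjoint are exchanged by the duality maps. The adjoint itself is avoided: `N` is the annihilator of
the range of `P - 1` under the pairing of `L^q` with `L^p`. -/
theorem exists_dual_fixedSubmodule (hp : p ≠ ∞) (hq : q ≠ ∞)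
    (hpq : (p.toReal - 1) * (q.toReal - 1) = 1) (hp1 : 1 < p.toReal)
    {P : Lp ℂ p μ →L[ℂ] Lp ℂ p μ} (hP : ∀ f, ‖P f‖ ≤ ‖f‖) :
    ∃ N : Submodule ℂ (Lp ℂ q μ), IsClosed (N : Set (Lp ℂ q μ)) ∧
      (∀ f, Represents (fixedSubmodule P) f → Represents N fun x => dualityMap p.toReal (f x)) ∧
      ∀ f, Represents N f → Represents (fixedSubmodule P) fun x => dualityMap q.toReal (f x) := by
  have hqp : (q.toReal - 1) * (p.toReal - 1) = 1 := by rwa [mul_comm]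
  have hconj : q.toReal.HolderConjugate p.toReal := by
    have h1 : 0 < p.toReal - 1 := by linarith
    have h2 : 0 < q.toReal - 1 := pos_of_mul_pos_right (by rw [hpq]; exact one_pos) h1.le
    refine Real.holderConjugate_iff.2 ⟨by linarith, ?_⟩
    have : p.toReal ≠ 0 := by linarith
    have : q.toReal ≠ 0 := by linarith
    field_simp
    linarith
  have : q.HolderConjugate p := ENNReal.HolderConjugate.of_toReal hconj
  let B := (ContinuousLinearMap.mul ℂ ℂ).lpPairing μ q p
  have hB : ∀ g k, B g k = ∫ x, g x * k x ∂μ := fun g k => by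
    simp only [B, ContinuousLinearMap.lpPairing_eq_integral, ContinuousLinearMap.mul_apply']
  let N : Submodule ℂ (Lp ℂ q μ) :=
    ⨅ k : Lp ℂ p μ, (B.flip (P k - k)).ker
  have hmem : ∀ g, g ∈ N ↔ ∀ k, ∫ x, g x * P k x ∂μ = ∫ x, g x * k x ∂μ := fun g => by
    simp only [N, Submodule.mem_iInf]
    refine forall_congr' fun k => ?_
    change B g (P k - k) = 0 ↔ _
    rw [map_sub, sub_eq_zero, hB, hB]
  refine ⟨N, ?_, ?_, ?_⟩
  · rw [Submodule.coe_iInf]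
    exact isClosed_iInter fun k => ContinuousLinearMap.isClosed_ker _
  · rintro u ⟨f, hf, hfu⟩
    have hm := memLp_dualityMap hp hq hpq (Lp.memLp f)
    refine ⟨hm.toLp, (hmem _).2 fun k => ?_,
      hm.coeFn_toLp.trans (hfu.fun_comp (dualityMap p.toReal))⟩
    have hJ : ∀ k : Lp ℂ p μ, ∫ x, hm.toLp _ x * k x ∂μ = ∫ x, dualityMap p.toReal (f x) * k x ∂μ :=
      fun k => integral_congr_ae (hm.coeFn_toLp.mul (ae_eq_refl k))
    rw [hJ, hJ]
    exact integral_dualityMap_mul_apply hP hp hf k (Or.inl hp1)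
  · rintro u ⟨g, hg, hgu⟩
    have hm := memLp_dualityMap hq hp hqp (Lp.memLp g)
    refine ⟨hm.toLp, ?_, hm.coeFn_toLp.trans (hgu.fun_comp (dualityMap q.toReal))⟩
    refine apply_eq_self_of_integral_dualityMap hP hp hp1 ?_
    have hJ : ∀ k : Lp ℂ p μ, ∫ x, dualityMap p.toReal (hm.toLp _ x) * k x ∂μ = ∫ x, g x * k x ∂μ :=
      fun k => by
        refine integral_congr_ae ?_
        filter_upwards [hm.coeFn_toLp] with x hx
        rw [hx, dualityMap_dualityMap hqp]
    rw [hJ, hJ]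
    exact (hmem g).1 hg hm.toLp

end DualPair

theorem isPhasedSublattice_fixedSubmodule {X : Type u} [mX : MeasurableSpace X] {μ : Measure X}
    {p : ℝ≥0∞} [hp1 : Fact (1 ≤ p)] (hp : p ≠ ∞) (hp2 : p ≠ 2) {P : Lp ℂ p μ →L[ℂ] Lp ℂ p μ}
    (hP : ∀ f, ‖P f‖ ≤ ‖f‖) : IsPhasedSublattice (fixedSubmodule P) := by
  rcases hp1.out.eq_or_lt with rfl | hlt
  · exact isPhasedSublattice_fixedSubmodule_one hP
  have hlt' : 1 < p.toReal := by
    rw [← ENNReal.toReal_one]; exact (ENNReal.toReal_lt_toReal ENNReal.one_ne_top hp).2 hlt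
  set q : ℝ≥0∞ := ENNReal.ofReal (1 + (p.toReal - 1)⁻¹)
  have hpos : 0 < (p.toReal - 1)⁻¹ := inv_pos.2 (by linarith)
  have hqr : q.toReal = 1 + (p.toReal - 1)⁻¹ := ENNReal.toReal_ofReal (by linarith)
  have hq : q ≠ ∞ := ENNReal.ofReal_ne_top
  have : Fact (1 ≤ q) := ⟨by
    rw [← ENNReal.ofReal_one]; exact ENNReal.ofReal_le_ofReal (by linarith)⟩
  have hpq : (p.toReal - 1) * (q.toReal - 1) = 1 := by
    rw [hqr, add_sub_cancel_left]; exact mul_inv_cancel₀ (by linarith)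
  have hqp : (q.toReal - 1) * (p.toReal - 1) = 1 := by rwa [mul_comm]
  obtain ⟨N, hN, hEN, hNE⟩ := exists_dual_fixedSubmodule (q := q) hp hq hpq hlt' hP
  have hE := isClosed_fixedSubmodule P
  rcases (toReal_ne_two hp2).lt_or_gt with h | h
  -- For `p < 2` the dual exponent exceeds `2`, and `E` is the dual of `N`.
  · refine isPhasedSublattice_dual_of_two_lt hq hp hqp ?_ hE hNE hN hEN
    have : 1 < (p.toReal - 1)⁻¹ := (one_lt_inv₀ (by linarith)).2 (by linarith)
    linarith
  · exact isPhasedSublattice_of_two_lt hp hq hpq h hN hEN hE hNE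

/-! ### Unital representations of unital `L^p`-operator algebras -/

/-- A unital `L^p`-operator algebra, `p ≠ 2`, has a unital isometric representation: the unit acts
as a contractive idempotent, whose range is again an `L^p`-space. -/
theorem IsLpOperatorAlgebra.exists_contractiveLpRep {p : ℝ≥0∞} [Fact (1 ≤ p)] (hp : p ≠ ∞)
    (hp2 : p ≠ 2) {A : Type u} [NormedRing A] [NormedAlgebra ℂ A] [NormOneClass A]
    (hA : IsLpOperatorAlgebra p A) :
    ∃ π : ContractiveLpRep p A, ∀ a, ‖π.toAlgHom a‖ = ‖a‖ := by
  obtain ⟨X, mX, μ, φ, hφ⟩ := hA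
  have he : ∀ f, ‖φ 1 f‖ ≤ ‖f‖ := fun f => by
    refine ((φ 1).le_opNorm f).trans ?_
    rw [hφ, norm_one, one_mul]
  obtain ⟨Y, mY, ν, ⟨V⟩⟩ :=
    (isPhasedSublattice_fixedSubmodule hp hp2 he).exists_linearIsometryEquiv hp
  have hmem : ∀ a f, φ a f ∈ fixedSubmodule (φ 1) := fun a f => by
    rw [mem_fixedSubmodule, ← mul_apply_eq_comp, ← map_mul, one_mul]
  let T : A → (fixedSubmodule (φ 1) →L[ℂ] fixedSubmodule (φ 1)) := fun a =>
    ((φ a).comp (fixedSubmodule (φ 1)).subtypeL).codRestrict _ fun f => hmem a f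
  have hT : ∀ a f, (T a f : Lp ℂ p μ) = φ a f := fun _ _ => rfl
  let V₁ : fixedSubmodule (φ 1) →L[ℂ] Lp ℂ p ν := V.toContinuousLinearEquiv
  let V₂ : Lp ℂ p ν →L[ℂ] fixedSubmodule (φ 1) := V.symm.toContinuousLinearEquiv
  let S : A → (Lp ℂ p ν →L[ℂ] Lp ℂ p ν) := fun a => V₁.comp ((T a).comp V₂)
  have hS : ∀ a f, S a f = V (T a (V.symm f)) := fun _ _ => rfl
  let π : A →ₐ[ℂ] (Lp ℂ p ν →L[ℂ] Lp ℂ p ν) :=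
    { toFun := S
      map_one' := by
        ext1 f
        have : T 1 (V.symm f) = V.symm f := Subtype.ext (V.symm f).2
        rw [hS, this, V.apply_symm_apply]; rfl
      map_mul' := fun a b => by
        ext1 f
        rw [mul_apply_eq_comp, hS, hS, hS, V.symm_apply_apply]
        congr 1
        exact Subtype.ext (by rw [hT, hT, hT, map_mul, mul_apply_eq_comp])
      map_zero' := by
        ext1 f
        have : T 0 (V.symm f) = 0 := Subtype.ext (by rw [hT, map_zero]; rfl)
        rw [hS, this, map_zero]; rfl
      map_add' := fun a b => by
        ext1 f
        have : T (a + b) (V.symm f) = T a (V.symm f) + T b (V.symm f) :=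
          Subtype.ext (by rw [hT, map_add]; rfl)
        rw [hS, this, map_add]; rfl
      commutes' := fun c => by
        ext1 f
        have : T (algebraMap ℂ A c) (V.symm f) = c • V.symm f := Subtype.ext <| by
          rw [hT, Algebra.algebraMap_eq_smul_one, map_smul]
          exact congrArg (c • ·) (V.symm f).2
        rw [hS, this, map_smul, V.apply_symm_apply]; rfl }
  have hle : ∀ a, ‖π a‖ ≤ ‖a‖ := fun a => by
    refine ContinuousLinearMap.opNorm_le_bound _ (norm_nonneg a) fun f => ?_
    change ‖S a f‖ ≤ _
    rw [hS, V.norm_map, ← V.symm.norm_map f, ← hφ a]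
    exact (φ a).le_opNorm _
  refine ⟨⟨Y, mY, ν, π, hle⟩, fun a => le_antisymm (hle a) ?_⟩
  rw [← hφ a]
  refine ContinuousLinearMap.opNorm_le_bound _ (norm_nonneg _) fun f => ?_
  have h1 : φ a f = φ a (φ 1 f) := by
    rw [← mul_apply_eq_comp, ← map_mul, mul_one]
  have h2 : ‖φ a (φ 1 f)‖ = ‖π a (V ⟨φ 1 f, hmem 1 f⟩)‖ := by
    change _ = ‖S a _‖
    rw [hS, V.norm_map, V.symm_apply_apply]; rfl
  rw [h1, h2]
  refine ((π a).le_opNorm _).trans (mul_le_mul_of_nonneg_left ?_ (norm_nonneg _))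
  rw [V.norm_map]
  exact he f

end

theorem mainTheorem6 (p : ℝ≥0∞) [Fact (1 ≤ p)] (hp_top : p ≠ ∞) (hp_two : p ≠ 2)
    (G : Type v) [Group G] [Countable G] :
    -- crossed products of unital `L^p`-operator algebras
    (∀ (A : Type u) [NormedRing A] [NormedAlgebra ℂ A] [CompleteSpace A] [NormOneClass A],
      IsLpOperatorAlgebra p A → ∀ α : IsometricAction G A,
        Isometry (ReducedCrossedProduct.ofBase p α) ∧
        ReducedCrossedProduct.ofBase p α '' cstarCore A =
          cstarCore (ReducedCrossedProduct p α)) ∧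
    -- crossed products of topological dynamical systems
    (∀ (X : Type u) [TopologicalSpace X] [CompactSpace X] [T2Space X] [Nonempty X]
      [MulAction G X] [ContinuousConstSMul G X],
        Isometry (ReducedCrossedProduct.ofBase p (topologicalAction G X)) ∧
        cstarCore (ReducedCrossedProduct p (topologicalAction G X)) =
          Set.range (ReducedCrossedProduct.ofBase p (topologicalAction G X))) ∧
    -- reduced group algebras
    cstarCore (reducedGroupAlgebra p G) =
      Set.range (algebraMap ℂ (reducedGroupAlgebra p G)) := by
  have key : ∀ (A : Type u) [NormedRing A] [NormedAlgebra ℂ A] [CompleteSpace A] [NormOneClass A],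
      IsLpOperatorAlgebra p A → ∀ α : IsometricAction G A,
        Isometry (ReducedCrossedProduct.ofBase p α) ∧
        ReducedCrossedProduct.ofBase p α '' cstarCore A =
          cstarCore (ReducedCrossedProduct p α) := by
    intro A _ _ _ _ hA α
    obtain ⟨π, hπ⟩ := hA.exists_contractiveLpRep hp_top hp_two
    exact ⟨ReducedCrossedProduct.isometry_ofBase α π hπ,
      ReducedCrossedProduct.image_cstarCore α π hπ hp_top hp_two⟩
  refine ⟨key, fun X _ _ _ _ _ _ => ?_, cstarCore_reducedGroupAlgebra hp_top hp_two⟩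
  obtain ⟨h1, h2⟩ := key C(X, ℂ) (isLpOperatorAlgebra_continuousMap p hp_top X)
    (topologicalAction G X)
  refine ⟨h1, ?_⟩
  rw [← h2, cstarCore_continuousMap, Set.image_univ]
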